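/- **Setting.** Let $F$ be a non-archimedean local field of residual characteristic $\neq 2$, $R$ its ring of integers, $\varpi$ a generator of the maximal ideal of $R$, $q$ the number of elements of the residue field, and $|\cdot|$ the absolute value with $|\varpi|=q^{-1}$. Let $J$ be the $5\times 5$ matrix with $1$'s on the antidiagonal and $0$'s elsewhere, $G=\{g\in SL(5,F):\ {}^tgJg=J\}$, $K=G\cap SL(5,R)$, and $Q(v,v)={}^tvJv=2v_1v_5+2v_2v_4+v_3^2$ on the space of columns $F^5$. The group $G$ carries the Haar measure $dg$ with $\mathrm{vol}(K)=1$. Consider two cases. * *Split case:* $S=\{v\in F^5:\ Q(v,v)=1\}$ and $v_1={}^t(\tfrac12,0,0,0,1)\in S$. * *Non-split case:* $\theta\in R^\times$ is not a square in $F$, $S=\{v\in F^5:\ Q(v,v)=4\theta\}$ and $v_1={}^t(2\theta,0,0,1,1)\in S$. The group $G$ acts on $S$ by left multiplication. Let $ds$ be the $G$-invariant Borel measure on $S$ for which the orbit $Kv_1$ has volume $1$. For $r\ge 0$ put $d_r=\mathrm{diag}(\varpi^r,1,1,1,\varpi^{-r})\in G$, let $\phi_r$ be the characteristic function of $Kd_rv_1\subset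 S$, and put $\Phi_r=\sum_{i=0}^r\phi_i$. For $\zeta,\zeta'\in\mathbb C$ let $I_G(\zeta,\zeta')$ be the space of locally constant functions $\phi:G\to\mathbb C$ with $\phi(bg)=\delta_B(b)^{1/2}|\alpha/\beta|^{\zeta}|\beta|^{\zeta'}\phi(g)$ for every upper triangular $b\in G$ with diagonal $(\alpha,\beta,1,\beta^{-1},\alpha^{-1})$, where $\delta_B(b)=|\alpha|^3|\beta|$; $G$ acts by right translation. A function $f:G\to\mathbb C$ is called spherical if it is locally constant, compactly supported and $K$-biinvariant; its Satake transform is $f^\vee(\pi)=\mathrm{tr}\,\pi(f)$, where $(\pi(f)\phi)(h)=\int_G f(g)\phi(hg)\,dg$. For $\zeta\in\mathbb C$ put $\pi_\zeta=I_G(\zeta,\tfrac12+\zeta)$, and let $T_\zeta$ be the $K$-invariant function on $S$ such that $T_\zeta(v_1)=1$ and $$\int_G f(g)\,T_\zeta(gs)\,dg=f^\vee(\pi_\zeta)\,T_\zeta(s)\qquad(s\in S)$$ for every spherical $f$. **Proposition 2.3.** Let $\zeta\in\mathbb C$ and put $X=q^\zeta$. For every integer $r\ge 0$ the function $\Phi_rT_\zeta$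 is integrable on $S$, and $$\int_S\Phi_r(s)T_\zeta(s)\,ds=q^r\left[q^{r/2}\,\frac{X^{r+1}-X^{-(r+1)}}{X-X^{-1}}\mp q^{(r-1)/2}\,\frac{X^r-X^{-r}}{X-X^{-1}}\right],$$ where the sign is "$-$" in the split case and "$+$" in the non-split case. When $X=\pm1$, the quotient $\frac{X^n-X^{-n}}{X-X^{-1}}$ stands for its limit value $nX^{n-1}$. -/

import Mathlib

open MeasureTheory ValuativeRel
open scoped Matrix

noncomputable section

namespace SplitSO5

section Group

variable {F : Type*} [Field F]

/-! ### The group `G = SO(3,2)` and the quadratic form -/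

variable (F) in
/-- The matrix with `1` on the antidiagonal and `0` elsewhere. -/
def J : Matrix (Fin 5) (Fin 5) F := Matrix.of fun i j => if i = Fin.rev j then 1 else 0

variable (F) in
/-- `G = {g ∈ SL(5, F) : ᵗg J g = J}`. -/
def SO32 : Subgroup (Matrix.SpecialLinearGroup (Fin 5) F) where
  carrier := {g | (g : Matrix (Fin 5) (Fin 5) F)ᵀ * J F * (g : Matrix (Fin 5) (Fin 5) F) = J F}
  one_mem' := by simp
  mul_mem' := by
    intro a b ha hb
    simp only [Set.mem_ofPred_eq] at ha hb ⊢
    rw [Matrix.SpecialLinearGroup.coe_mul, Matrix.transpose_mul]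
    calc _ = (b : Matrix (Fin 5) (Fin 5) F)ᵀ * ((a : Matrix (Fin 5) (Fin 5) F)ᵀ * J F *
            (a : Matrix (Fin 5) (Fin 5) F)) * (b : Matrix (Fin 5) (Fin 5) F) := by
          simp only [Matrix.mul_assoc]
      _ = J F := by rw [ha, hb]
  inv_mem' := by
    intro a ha
    simp only [Set.mem_ofPred_eq] at ha ⊢
    have h1 : (a : Matrix (Fin 5) (Fin 5) F) * ((a⁻¹ : Matrix.SpecialLinearGroup (Fin 5) F) :
        Matrix (Fin 5) (Fin 5) F) = 1 := by
      rw [← Matrix.SpecialLinearGroup.coe_mul, mul_inv_cancel, Matrix.SpecialLinearGroup.coe_one]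
    have h2 := congrArg Matrix.transpose h1
    rw [Matrix.transpose_mul, Matrix.transpose_one] at h2
    calc _ = ((a⁻¹ : Matrix.SpecialLinearGroup (Fin 5) F) : Matrix (Fin 5) (Fin 5) F)ᵀ *
            ((a : Matrix (Fin 5) (Fin 5) F)ᵀ * J F * (a : Matrix (Fin 5) (Fin 5) F)) *
            ((a⁻¹ : Matrix.SpecialLinearGroup (Fin 5) F) : Matrix (Fin 5) (Fin 5) F) := by
          rw [ha]
      _ = (((a⁻¹ : Matrix.SpecialLinearGroup (Fin 5) F) : Matrix (Fin 5) (Fin 5) F)ᵀ *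
            (a : Matrix (Fin 5) (Fin 5) F)ᵀ) * J F * ((a : Matrix (Fin 5) (Fin 5) F) *
            ((a⁻¹ : Matrix.SpecialLinearGroup (Fin 5) F) : Matrix (Fin 5) (Fin 5) F)) := by
          simp only [Matrix.mul_assoc]
      _ = J F := by rw [h2, h1]; simp

/-- The matrix of an element of `G`. -/
def mat (g : SO32 F) : Matrix (Fin 5) (Fin 5) F := (g : Matrix.SpecialLinearGroup (Fin 5) F)

theorem mat_mul (g h : SO32 F) : mat (g * h) = mat g * mat h := rfl

theorem mat_one : mat (1 : SO32 F) = 1 := rfl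

theorem mat_isometry (g : SO32 F) : (mat g)ᵀ * J F * mat g = J F := g.2

/-- `a_α = diag(α, 1, 1, 1, α⁻¹)`. -/
def torusElt (α : Fˣ) : SO32 F :=
  ⟨⟨Matrix.diagonal ![(α : F), 1, 1, 1, ((α⁻¹ : Fˣ) : F)], by
      simp [Matrix.det_diagonal, Fin.prod_univ_five]⟩, by
    show (Matrix.diagonal _)ᵀ * J F * Matrix.diagonal _ = J F
    ext i j
    simp only [Matrix.diagonal_transpose, Matrix.mul_diagonal, Matrix.diagonal_mul, J,
      Matrix.of_apply]
    fin_cases i <;> fin_cases j <;> simp [Fin.rev]⟩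

/-- `Q(v, w) = ᵗv J w`. -/
def Q (v w : Fin 5 → F) : F := v ⬝ᵥ (J F *ᵥ w)

theorem Q_self (v : Fin 5 → F) : Q v v = 2 * v 0 * v 4 + 2 * v 1 * v 3 + v 2 ^ 2 := by
  simp only [Q, J, dotProduct, Matrix.mulVec, Fin.sum_univ_five, Matrix.of_apply]
  simp [Fin.rev, Fin.ext_iff]
  ring

theorem Q_smul (g : SO32 F) (v : Fin 5 → F) : Q (mat g *ᵥ v) (mat g *ᵥ v) = Q v v := by
  unfold Q
  conv_lhs => enter [1]; rw [← Matrix.vecMul_transpose]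
  rw [← Matrix.dotProduct_mulVec, Matrix.mulVec_mulVec, Matrix.mulVec_mulVec, mat_isometry]

end Group

variable (F : Type*) [Field F] [ValuativeRel F] [TopologicalSpace F]
  [IsNonarchimedeanLocalField F]

/-! ### The local field -/

/-- The number `q` of elements of the residue field. -/
def residueCard : ℕ := Nat.card 𝓀[F]

variable {F}

/-- The absolute value on `F`, normalized by `|ϖ| = q⁻¹` for a uniformizer `ϖ`.
(There is only one isomorphism of ordered monoids from the value group to `ℤᵐ⁰`.) -/
def nabs (x : F) : ℝ :=
  open scoped Classical in
  if x = 0 then 0 else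
    (residueCard F : ℝ) ^
      (WithZero.log (IsNonarchimedeanLocalField.valueGroupWithZeroIsoInt F (valuation F x)))

/-- `ϖ` is a generator of the maximal ideal of the ring of integers of `F`. -/
def IsUniformizer (ϖ : Fˣ) : Prop :=
  ∃ p : 𝒪[F], (p : F) = ϖ ∧ 𝓂[F] = Ideal.span {p}

theorem two_ne_zero_of_residue (hF : ringChar 𝓀[F] ≠ 2) : (2 : F) ≠ 0 := by
  intro h
  have h1 : (2 : 𝒪[F]) = 0 := Subtype.ext h
  have h2 : (2 : 𝓀[F]) = 0 := by
    have h3 := congrArg (IsLocalRing.residue 𝒪[F]) h1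
    rwa [map_ofNat, map_zero] at h3
  exact Ring.two_ne_zero hF h2

/-! ### The compact subgroup `K` -/

variable (F) in
/-- `K = SO(3,2; R)`: the elements of `G` which come from matrices over the ring of integers. -/
def maxCompact : Subgroup (SO32 F) :=
  (Matrix.SpecialLinearGroup.map (n := Fin 5) (algebraMap 𝒪[F] F)).range.subgroupOf (SO32 F)

theorem mem_maxCompact_iff (g : SO32 F) :
    g ∈ maxCompact F ↔ ∀ i j, mat g i j ∈ 𝒪[F] := by
  constructor
  · rintro ⟨h, hh⟩ i j
    have : mat g i j = algebraMap 𝒪[F] F (h i j) := by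
      unfold mat
      rw [← Subgroup.coe_subtype, ← hh]
      rfl
    rw [this]
    exact (h i j).2
  · intro hg
    let A : Matrix (Fin 5) (Fin 5) 𝒪[F] := Matrix.of fun i j => ⟨mat g i j, hg i j⟩
    have hA : A.map (algebraMap 𝒪[F] F) = mat g := by
      ext i j
      rfl
    have hdet : A.det = 1 := by
      apply Subtype.val_injective
      have h1 := RingHom.map_det (algebraMap 𝒪[F] F) A
      rw [RingHom.mapMatrix_apply, hA] at h1
      exact h1.trans (g : Matrix.SpecialLinearGroup (Fin 5) F).2
    refine ⟨⟨A, hdet⟩, ?_⟩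
    apply Subtype.ext
    exact hA

instance : MeasurableSpace (SO32 F) := borel _

instance : BorelSpace (SO32 F) := ⟨rfl⟩

theorem isOpen_maxCompact : IsOpen (maxCompact F : Set (SO32 F)) := by
  have hO : IsOpen (𝒪[F] : Set F) := by
    let := IsTopologicalAddGroup.rightUniformSpace F
    have := isUniformAddGroup_of_addCommGroup (G := F)
    exact Valued.isOpen_integer F
  have h : (maxCompact F : Set (SO32 F)) = ⋂ i, ⋂ j, (fun g => mat g i j) ⁻¹' (𝒪[F] : Set F) := by
    ext g
    simp [mem_maxCompact_iff]
  rw [h]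
  refine isOpen_iInter_of_finite fun i => isOpen_iInter_of_finite fun j => hO.preimage ?_
  have hc : Continuous fun g : SO32 F => mat g :=
    continuous_subtype_val.comp continuous_subtype_val
  exact hc.matrix_elem i j

/-! ### The spheres -/

variable (F) in
/-- The split case, and the non-split case attached to a unit `θ` of the ring of integers
which is not a square. -/
inductive SphereCase
  | split : SphereCase
  | nonsplit (θ : F) (hunit : valuation F θ = 1) (hθ : ¬ IsSquare θ) : SphereCase

/-- The sphere is `Q(v, v) = 1` in the split case and `Q(v, v) = 4 θ` in the non-split case. -/
def SphereCase.radius : SphereCase F → F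
  | .split => 1
  | .nonsplit θ _ _ => 4 * θ

/-- The base vector `v₁`. -/
def SphereCase.baseVec : SphereCase F → Fin 5 → F
  | .split => ![1 / 2, 0, 0, 0, 1]
  | .nonsplit θ _ _ => ![2 * θ, 0, 0, 1, 1]

/-- The upper sign of `∓ / ±` belongs to the split case, so this is the sign `±`. -/
def SphereCase.sign : SphereCase F → ℂ
  | .split => 1
  | .nonsplit _ _ _ => -1

/-- The sphere `S`. -/
def Sphere (C : SphereCase F) : Type _ := {v : Fin 5 → F // Q v v = C.radius}

instance (C : SphereCase F) : TopologicalSpace (Sphere C) :=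
  inferInstanceAs (TopologicalSpace {v : Fin 5 → F // Q v v = C.radius})

instance (C : SphereCase F) : MeasurableSpace (Sphere C) := borel _

instance (C : SphereCase F) : BorelSpace (Sphere C) := ⟨rfl⟩

/-- `G` acts on `S` by multiplication on the left. -/
instance (C : SphereCase F) : MulAction (SO32 F) (Sphere C) where
  smul g v := ⟨mat g *ᵥ v.1, (Q_smul g v.1).trans v.2⟩
  one_smul v := Subtype.ext (by
    show mat 1 *ᵥ v.1 = v.1
    rw [mat_one, Matrix.one_mulVec])
  mul_smul g h v := Subtype.ext (by
    show mat (g * h) *ᵥ v.1 = mat g *ᵥ (mat h *ᵥ v.1)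
    rw [mat_mul, Matrix.mulVec_mulVec])

/-- The point `v₁` of `S`. -/
def basePoint (hF : ringChar 𝓀[F] ≠ 2) (C : SphereCase F) : Sphere C :=
  ⟨C.baseVec, by
    have h2 := two_ne_zero_of_residue hF
    rw [Q_self]
    cases C with
    | split => simp [SphereCase.baseVec, SphereCase.radius, h2]
    | nonsplit θ _ _ =>
      simp [SphereCase.baseVec, SphereCase.radius]
      ring⟩

/-- The `K`-orbit of `d_r v₁`, where `d_r = diag(ϖ ^ r, 1, 1, 1, ϖ ^ (-r))`. -/
def orbitK (hF : ringChar 𝓀[F] ≠ 2) (ϖ : Fˣ) (C : SphereCase F) (r : ℕ) : Set (Sphere C) :=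
  MulAction.orbit (maxCompact F) (torusElt (ϖ ^ r) • basePoint hF C)

/-- `Φ_r = φ_0 + ⋯ + φ_r`, where `φ_i` is the characteristic function of the `K`-orbit
of `d_i v₁`. -/
def bigPhi (hF : ringChar 𝓀[F] ≠ 2) (ϖ : Fˣ) (C : SphereCase F) (r : ℕ) (s : Sphere C) : ℂ :=
  ∑ i ∈ Finset.range (r + 1), (orbitK hF ϖ C i).indicator (fun _ => (1 : ℂ)) s

/-! ### Induced representations and the Satake transform -/

/-- For `b` in the Borel subgroup with diagonal `(α, β, 1, β⁻¹, α⁻¹)`, the value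
`δ_B(b) ^ (1/2) |α₁(b)| ^ ζ |α₂(b)| ^ ζ'`, where `α₁(b) = α / β` and `α₂(b) = β` are the simple
roots and `δ_B(b) = |α| ^ 3 |β|` is the modulus character. -/
def borelChar (ζ ζ' : ℂ) (b : SO32 F) : ℂ :=
  ((nabs (mat b 0 0) ^ 3 * nabs (mat b 1 1) : ℝ) : ℂ) ^ (1 / 2 : ℂ) *
    ((nabs (mat b 0 0 / mat b 1 1) : ℝ) : ℂ) ^ ζ * ((nabs (mat b 1 1) : ℝ) : ℂ) ^ ζ'

variable (F) in
/-- The space of the normalizedly induced representation `I_G(ζ, ζ')`: the locally constant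
functions `φ` on `G` with `φ(b g) = δ_B(b) ^ (1/2) |α₁(b)| ^ ζ |α₂(b)| ^ ζ' φ(g)` for all upper
triangular `b`. The group acts by right translation. -/
def inducedSpace (ζ ζ' : ℂ) : Submodule ℂ (SO32 F → ℂ) where
  carrier := {φ | IsLocallyConstant φ ∧
    ∀ b g : SO32 F, (mat b).BlockTriangular id → φ (b * g) = borelChar ζ ζ' b * φ g}
  zero_mem' := ⟨IsLocallyConstant.const 0, by simp⟩
  add_mem' := by
    rintro φ ψ ⟨h1, h2⟩ ⟨h3, h4⟩
    exact ⟨h1.add h3, fun b g hb => by simp [h2 b g hb, h4 b g hb, mul_add]⟩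
  smul_mem' := by
    rintro c φ ⟨h1, h2⟩
    refine ⟨h1.comp fun z => c * z, fun b g hb => ?_⟩
    simp [h2 b g hb, mul_left_comm]

/-- Spherical functions on `G`: the locally constant, compactly supported, `K`-biinvariant
functions. -/
structure IsSpherical (f : SO32 F → ℂ) : Prop where
  locallyConstant : IsLocallyConstant f
  compactSupport : HasCompactSupport f
  biinvariant : ∀ k ∈ maxCompact F, ∀ k' ∈ maxCompact F, ∀ g, f (k * g * k') = f g

theorem IsSpherical.integrable_mul {f : SO32 F → ℂ} (hf : IsSpherical f) (dg : Measure (SO32 F))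
    [dg.IsHaarMeasure] {φ : SO32 F → ℂ} (hφ : IsLocallyConstant φ) (h : SO32 F) :
    Integrable (fun g => f g * φ (h * g)) dg := by
  apply Continuous.integrable_of_hasCompactSupport
  · exact hf.locallyConstant.continuous.mul (hφ.continuous.comp (continuous_const_mul h))
  · exact hf.compactSupport.mul_right

/-- The operator `π(f)`, `(π(f)φ)(h) = ∫_G f(g) φ(h g) dg`, of a spherical function `f`
on the space of `π = I_G(ζ, ζ')`. -/
def heckeOp (dg : Measure (SO32 F)) [dg.IsHaarMeasure] {f : SO32 F → ℂ} (hf : IsSpherical f)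
    (ζ ζ' : ℂ) : inducedSpace F ζ ζ' →ₗ[ℂ] inducedSpace F ζ ζ' where
  toFun φ := ⟨fun h => ∫ g, f g * φ.1 (h * g) ∂dg, by
    refine ⟨?_, fun b g hb => ?_⟩
    · rw [IsLocallyConstant.iff_exists_open]
      intro h
      refine ⟨(fun x => h⁻¹ * x) ⁻¹' (maxCompact F : Set (SO32 F)),
        isOpen_maxCompact.preimage (continuous_const_mul _), by simp [one_mem], fun x hx => ?_⟩
      have hx' : x⁻¹ * h ∈ maxCompact F := by
        have := inv_mem (show h⁻¹ * x ∈ maxCompact F from hx)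
        simpa using this
      rw [← integral_mul_left_eq_self (fun g => f g * φ.1 (x * g)) (x⁻¹ * h)]
      refine integral_congr_ae (Filter.Eventually.of_forall fun g => ?_)
      have h1 := hf.biinvariant _ hx' 1 (one_mem _) g
      rw [mul_one] at h1
      simp only [h1]
      congr 2
      group
    · rw [← integral_const_mul]
      refine integral_congr_ae (Filter.Eventually.of_forall fun x => ?_)
      simp only [mul_assoc, φ.2.2 b _ hb]
      ring⟩
  map_add' φ ψ := by
    apply Subtype.ext
    funext h
    simp only [Submodule.coe_add, Pi.add_apply, mul_add]
    exact integral_add (hf.integrable_mul dg φ.2.1 h) (hf.integrable_mul dg ψ.2.1 h)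
  map_smul' c φ := by
    apply Subtype.ext
    funext h
    simp only [SetLike.val_smul, Pi.smul_apply, smul_eq_mul, RingHom.id_apply, mul_left_comm _ c]
    exact integral_const_mul c _

/-- The trace of an endomorphism of finite rank: the trace of its restriction to its range. -/
def finiteRankTrace {V : Type*} [AddCommGroup V] [Module ℂ V] (A : V →ₗ[ℂ] V) : ℂ :=
  LinearMap.trace ℂ (LinearMap.range A)
    (A.restrict (p := LinearMap.range A) (q := LinearMap.range A)
      fun v _ => LinearMap.mem_range_self A v)

/-- The Satake transform `f^∨(π) = tr π(f)` at `π = I_G(ζ, ζ')`. -/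
def satake (dg : Measure (SO32 F)) [dg.IsHaarMeasure] {f : SO32 F → ℂ} (hf : IsSpherical f)
    (ζ ζ' : ℂ) : ℂ :=
  finiteRankTrace (heckeOp dg hf ζ ζ')

/-- `T` is the function `T_ζ`: the `K`-invariant function on `S` with `T(v₁) = 1` and
`∫_G f(g) T(g s) dg = f^∨(π_ζ) T(s)` for all spherical `f`, where `π_ζ = I_G(ζ, 1/2 + ζ)`. -/
structure IsSphericalEigenfunction (hF : ringChar 𝓀[F] ≠ 2) (C : SphereCase F)
    (dg : Measure (SO32 F)) [dg.IsHaarMeasure] (ζ : ℂ) (T : Sphere C → ℂ) : Prop where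
  invariant : ∀ k ∈ maxCompact F, ∀ s, T (k • s) = T s
  normalized : T (basePoint hF C) = 1
  eigen : ∀ (f : SO32 F → ℂ) (hf : IsSpherical f) (s : Sphere C),
    ∫ g, f g * T (g • s) ∂dg = satake dg hf ζ (1 / 2 + ζ) * T s

/-- The quotient `(X ^ n - X ^ (-n)) / (X - X⁻¹)`, read as the Laurent polynomial
`X ^ (n - 1) + X ^ (n - 3) + ⋯ + X ^ (1 - n)` at the points `X = ±1`, where its value is
`n X ^ (n - 1)`. -/
def powQuotient (X : ℂ) (n : ℕ) : ℂ :=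
  open scoped Classical in
  if X = X⁻¹ then n * X ^ ((n : ℤ) - 1)
  else (X ^ (n : ℤ) - X ^ (-(n : ℤ))) / (X - X⁻¹)

end SplitSO5

end

open SplitSO5

/-! The group `K` moves a primitive vector to a normal form depending only on its length, so the
`K`-orbits on `S` are the sets of vectors of given norm (`mem_orbitK_iff`). The integral is
therefore a finite sum of products of an orbit volume and a value `t_m = T(d_m v₁)`, and both
factors obey linear recurrences that come from counting vectors over the residue field.

Values. The eigenvalue equation is applied to the characteristic function of `K d K`, where `d =
diag(ϖ, 1, 1, 1, ϖ⁻¹)`. Its left side is the number of cosets in `K d K / K` times the mean of `T(d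
k s)` over `K`. For `s` of level `m`, the reduction of `k (ϖ^m s)` is equidistributed on the nonzero
vectors of its length (`exists_measure_maxCompact`), and the cell containing it decides whether `d`
raises, keeps or lowers the level of `k s`. The same count on isotropic vectors, applied to the
spherical vector of the induced representation, gives the Satake transform (`satake_heckeFun`); the
number of cosets cancels. At `ζ' = 1/2 + ζ` the cells that keep the level match the part of the
eigenvalue free of `X`, and what remains is `q³ t_{m+2} + t_m = y t_{m+1}` with `y = q^{3/2} (X +
X⁻¹)` (`recurrence_succ`). At level zero the length is a unit, and the count also involves the
number of its square roots, `1 + ε`, where `ε` is the sign of the case (`recurrence_zero`).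

Volumes. An element of `G` carries the part of level `m` that `d` raises onto the part of level `m +
1` that `d` lowers; comparing numbers of vectors, the mass over one vector is multiplied by `q³` at
each level (`exists_volumes`).

Sum. The products `w_m` of volume and value satisfy `w_{m+3} + q³ w_{m+1} = y w_{m+2}`. The initial
terms are such that the partial sums satisfy the same homogeneous recurrence from the start
(`sum_eq_of_recurrence`). It is a Chebyshev recurrence, solved by the quotients `powQuotient`. -/

noncomputable section

namespace SplitSO5

/-! ### Reduction of integral elements modulo the maximal ideal. -/

section LocalField

variable {F : Type*} [Field F] [ValuativeRel F]

/-- The reduction of an integral element modulo the maximal ideal (zero off the integers). -/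
def red (x : F) : 𝓀[F] :=
  open scoped Classical in
  if h : x ∈ 𝒪[F] then IsLocalRing.residue 𝒪[F] ⟨x, h⟩ else 0

theorem red_of_mem {x : F} (h : x ∈ 𝒪[F]) : red x = IsLocalRing.residue 𝒪[F] ⟨x, h⟩ := by
  simp [red, h]

theorem red_coe (x : 𝒪[F]) : red (x : F) = IsLocalRing.residue 𝒪[F] x := red_of_mem x.2

theorem red_surjective (a : 𝓀[F]) : ∃ x ∈ 𝒪[F], red x = a := by
  obtain ⟨x, hx⟩ := IsLocalRing.residue_surjective (R := 𝒪[F]) a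
  exact ⟨x, x.2, by rw [red_coe, hx]⟩

theorem red_zero : red (0 : F) = 0 := by
  have := red_coe (0 : 𝒪[F])
  simpa using this

theorem red_one : red (1 : F) = 1 := by
  have := red_coe (1 : 𝒪[F])
  simpa using this

theorem two_mem : (2 : F) ∈ 𝒪[F] := ofNat_mem _ 2

theorem red_two : red (2 : F) = 2 := by
  have := red_coe (2 : 𝒪[F])
  rwa [map_ofNat] at this

theorem red_add {x y : F} (hx : x ∈ 𝒪[F]) (hy : y ∈ 𝒪[F]) : red (x + y) = red x + red y := by
  rw [red_of_mem hx, red_of_mem hy, ← map_add, ← red_coe]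
  rfl

theorem red_mul {x y : F} (hx : x ∈ 𝒪[F]) (hy : y ∈ 𝒪[F]) : red (x * y) = red x * red y := by
  rw [red_of_mem hx, red_of_mem hy, ← map_mul, ← red_coe]
  rfl

theorem red_neg {x : F} (hx : x ∈ 𝒪[F]) : red (-x) = -red x := by
  rw [red_of_mem hx, ← map_neg, ← red_coe]
  rfl

theorem red_sub {x y : F} (hx : x ∈ 𝒪[F]) (hy : y ∈ 𝒪[F]) : red (x - y) = red x - red y := by
  rw [red_of_mem hx, red_of_mem hy, ← map_sub, ← red_coe]
  rfl

theorem red_pow {x : F} (hx : x ∈ 𝒪[F]) (n : ℕ) : red (x ^ n) = red x ^ n := by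
  rw [red_of_mem hx, ← map_pow, ← red_coe]
  rfl

theorem red_sum {ι : Type*} (s : Finset ι) {f : ι → F} (hf : ∀ i ∈ s, f i ∈ 𝒪[F]) :
    red (∑ i ∈ s, f i) = ∑ i ∈ s, red (f i) := by
  classical
  induction s using Finset.induction_on with
  | empty => simp [red_zero]
  | insert a s ha ih =>
    have h1 : ∀ i ∈ s, f i ∈ 𝒪[F] := fun i hi => hf i (Finset.mem_insert_of_mem hi)
    rw [Finset.sum_insert ha, Finset.sum_insert ha,
      red_add (hf a (Finset.mem_insert_self a s)) (sum_mem h1), ih h1]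

theorem isUnit_iff_valuation {x : 𝒪[F]} : IsUnit x ↔ valuation F x = 1 :=
  Valuation.Integers.isUnit_iff_valuation_eq_one (Valuation.integer.integers _)

theorem red_ne_zero_iff {x : F} (hx : x ∈ 𝒪[F]) : red x ≠ 0 ↔ valuation F x = 1 := by
  rw [red_of_mem hx, Ne, IsLocalRing.residue_eq_zero_iff, IsLocalRing.mem_maximalIdeal,
    mem_nonunits_iff, not_not, isUnit_iff_valuation]

theorem red_eq_zero_iff {x : F} (hx : x ∈ 𝒪[F]) : red x = 0 ↔ valuation F x < 1 := by
  rw [← not_iff_not, ← Ne, red_ne_zero_iff hx, not_lt]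
  exact ⟨fun h => h.ge, fun h => le_antisymm ((Valuation.mem_integer_iff _ _).1 hx) h⟩

theorem ne_zero_of_red {x : F} (h : red x ≠ 0) : x ≠ 0 := by
  rintro rfl
  exact h red_zero

/-- The value zero of `red` off the integers makes `red x ≠ 0` a complete way of saying that `x` is
a unit of the ring of integers. -/
theorem mem_of_red {x : F} (h : red x ≠ 0) : x ∈ 𝒪[F] := by
  by_contra hx
  exact h (by simp [red, hx])

theorem mem_of_valuation_one {x : F} (h : valuation F x = 1) : x ∈ 𝒪[F] :=
  (Valuation.mem_integer_iff _ _).2 h.le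

theorem inv_mem_of_red {x : F} (h : red x ≠ 0) : x⁻¹ ∈ 𝒪[F] := by
  rw [red_ne_zero_iff (mem_of_red h)] at h
  rw [Valuation.mem_integer_iff, map_inv₀, h, inv_one]

theorem red_inv {x : F} (h : red x ≠ 0) : red x⁻¹ = (red x)⁻¹ := by
  have h1 : red (x * x⁻¹) = red x * red x⁻¹ := red_mul (mem_of_red h) (inv_mem_of_red h)
  rw [mul_inv_cancel₀ (ne_zero_of_red h), red_one] at h1
  exact eq_inv_of_mul_eq_one_right h1.symm

theorem residue_two_ne_zero (hF : ringChar 𝓀[F] ≠ 2) : (2 : 𝓀[F]) ≠ 0 := Ring.two_ne_zero hF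

theorem red_two_ne_zero (hF : ringChar 𝓀[F] ≠ 2) : red (2 : F) ≠ 0 := by
  rw [red_two]
  exact residue_two_ne_zero hF

/-- A nonzero vector is a scalar multiple of a primitive one. -/
theorem exists_primitive_smul {n : ℕ} (w : Fin n → F) (hw : w ≠ 0) :
    ∃ c : F, c ≠ 0 ∧ (∀ i, c * w i ∈ 𝒪[F]) ∧ ∃ i, red (c * w i) ≠ 0 := by
  obtain ⟨j, hj⟩ := Function.ne_iff.1 hw
  obtain ⟨i, -, hi⟩ := Finset.exists_max_image Finset.univ (fun i => valuation F (w i))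
    ⟨j, Finset.mem_univ j⟩
  have h0 : w i ≠ 0 := by
    intro h
    have := hi j (Finset.mem_univ j)
    rw [h, map_zero, le_zero_iff, map_eq_zero] at this
    exact hj this
  refine ⟨(w i)⁻¹, inv_ne_zero h0, fun k => ?_, i, ?_⟩
  · rw [Valuation.mem_integer_iff, map_mul, map_inv₀]
    have h1 : valuation F (w i) ≠ 0 := (map_ne_zero _).2 h0
    calc _ ≤ (valuation F (w i))⁻¹ * valuation F (w i) :=
          mul_le_mul_right (hi k (Finset.mem_univ k)) _
      _ = 1 := inv_mul_cancel₀ h1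
  · rw [inv_mul_cancel₀ h0, red_one]
    exact one_ne_zero

end LocalField

/-! ### Uniformizers, residue classes, Hensel's lemma and the absolute value. -/

section Topological

variable {F : Type*} [Field F] [ValuativeRel F] [TopologicalSpace F]
  [IsNonarchimedeanLocalField F]

theorem IsUniformizer.mem {ϖ : Fˣ} (h : IsUniformizer ϖ) : (ϖ : F) ∈ 𝒪[F] := by
  obtain ⟨p, hp, -⟩ := h
  exact hp ▸ p.2

theorem IsUniformizer.red {ϖ : Fˣ} (h : IsUniformizer ϖ) : red (ϖ : F) = 0 := by
  obtain ⟨p, hp, hm⟩ := h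
  rw [← hp, red_coe, IsLocalRing.residue_eq_zero_iff, hm]
  exact Ideal.mem_span_singleton_self p

theorem IsUniformizer.inv_mul_mem {ϖ : Fˣ} (h : IsUniformizer ϖ) {x : F} (hx : x ∈ 𝒪[F])
    (h0 : SplitSO5.red x = 0) : (ϖ : F)⁻¹ * x ∈ 𝒪[F] := by
  obtain ⟨p, hp, hm⟩ := h
  rw [red_of_mem hx, IsLocalRing.residue_eq_zero_iff, hm, Ideal.mem_span_singleton] at h0
  obtain ⟨y, hy⟩ := h0
  have h1 : x = p * y := congrArg Subtype.val hy
  rw [h1, ← hp, inv_mul_cancel_left₀ (by rw [hp]; exact ϖ.ne_zero)]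
  exact y.2

theorem IsUniformizer.exists_eq_mul {ϖ : Fˣ} (h : IsUniformizer ϖ) {x : F} (hx : x ∈ 𝒪[F])
    (h0 : SplitSO5.red x = 0) : ∃ y ∈ 𝒪[F], x = ϖ * y :=
  ⟨_, h.inv_mul_mem hx h0, by rw [mul_inv_cancel_left₀ ϖ.ne_zero]⟩

instance : T2Space F := by
  let := IsTopologicalAddGroup.rightUniformSpace F
  have := isUniformAddGroup_of_addCommGroup (G := F)
  infer_instance

/-- The residue classes are open. -/
theorem isOpen_red_fibre (a : 𝓀[F]) : IsOpen {x : F | x ∈ 𝒪[F] ∧ red x = a} := by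
  obtain ⟨x₀, hx₀, rfl⟩ := red_surjective a
  have h0 : IsOpen {x : F | valuation F x < 1} := by
    let := IsTopologicalAddGroup.rightUniformSpace F
    have := isUniformAddGroup_of_addCommGroup (G := F)
    have := (IsValuativeTopology.hasBasis_nhds_zero' F)
    rw [isOpen_iff_mem_nhds]
    intro x hx
    rw [(IsValuativeTopology.hasBasis_nhds' x).mem_iff]
    refine ⟨1, one_ne_zero, fun y hy => ?_⟩
    have h2 : y = (y - x) + x := by ring
    have h3 := (valuation F).map_add_lt (g := 1) hy hx
    rw [← h2] at h3
    exact h3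
  have h1 : {x : F | x ∈ 𝒪[F] ∧ red x = red x₀} = (fun x => x - x₀) ⁻¹' {x : F | valuation F x < 1} := by
    ext x
    simp only [Set.mem_ofPred_eq, Set.mem_preimage]
    constructor
    · rintro ⟨h1, h2⟩
      rw [← red_eq_zero_iff (sub_mem h1 hx₀), red_sub h1 hx₀, h2, sub_self]
    · intro h
      have h1 : x - x₀ ∈ 𝒪[F] := (Valuation.mem_integer_iff _ _).2 h.le
      have h2 : x ∈ 𝒪[F] := by simpa using add_mem h1 hx₀
      rw [← red_eq_zero_iff h1, red_sub h2 hx₀, sub_eq_zero] at h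
      exact ⟨h2, h⟩
  rw [h1]
  exact h0.preimage (by fun_prop)

/-- A unit whose reduction is a square is a square. -/
theorem isSquare_of_isSquare_red (hF : ringChar 𝓀[F] ≠ 2) {θ : F} (hθ : red θ ≠ 0)
    (h : IsSquare (red θ)) : IsSquare θ := by
  let := IsTopologicalAddGroup.rightUniformSpace F
  have := isUniformAddGroup_of_addCommGroup (G := F)
  have hH := IsAdicComplete.henselianRing 𝒪[F] 𝓂[F]
  obtain ⟨a, ha⟩ := h
  obtain ⟨x, hx, rfl⟩ := red_surjective a
  have hx0 : red x ≠ 0 := by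
    intro h0
    rw [h0, mul_zero] at ha
    exact hθ ha
  have hm := mem_of_red hθ
  -- The derivative of `X² - θ` at `x` is `2 x`, a unit because the residual characteristic is odd.
  have hu : IsUnit (2 * (⟨x, hx⟩ : 𝒪[F])) := by
    rw [isUnit_iff_valuation, ← red_ne_zero_iff (Subtype.prop _)]
    change red (2 * x) ≠ 0
    rw [red_mul two_mem hx]
    exact mul_ne_zero (red_two_ne_zero hF) hx0
  obtain ⟨y, hy, -⟩ := hH.is_henselian (Polynomial.X ^ 2 - Polynomial.C (⟨θ, hm⟩ : 𝒪[F]))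
    (Polynomial.monic_X_pow_sub_C _ two_ne_zero) ⟨x, hx⟩ (by
      rw [← IsLocalRing.residue_eq_zero_iff, ← red_coe]
      simp only [Polynomial.eval_sub, Polynomial.eval_pow, Polynomial.eval_X, Polynomial.eval_C]
      change red (x ^ 2 - θ) = 0
      rw [red_sub (pow_mem hx 2) hm, red_pow hx, ha]
      ring) (by
      refine IsUnit.map _ ?_
      simpa [one_add_one_eq_two] using hu)
  refine ⟨y, ?_⟩
  have h1 : y ^ 2 = (⟨θ, hm⟩ : 𝒪[F]) := by
    simpa [sub_eq_zero] using hy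
  have h2 := congrArg Subtype.val h1
  change (y : F) ^ 2 = θ at h2
  rw [← h2, sq]

variable (F) in
theorem one_lt_residueCard : 1 < residueCard F := by
  exact Finite.one_lt_card

theorem nabs_mul (x y : F) : nabs (x * y) = nabs x * nabs y := by
  unfold nabs
  by_cases hx : x = 0
  · simp [hx]
  by_cases hy : y = 0
  · simp [hy]
  have h1 : (0 : ℝ) < residueCard F := by exact_mod_cast (one_lt_residueCard F).le
  rw [if_neg hx, if_neg hy, if_neg (mul_ne_zero hx hy), ← zpow_add₀ h1.ne', map_mul, map_mul,
    WithZero.log_mul]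
  · simpa using hx
  · simpa using hy

theorem nabs_pos {x : F} (hx : x ≠ 0) : 0 < nabs x := by
  have h1 : (0 : ℝ) < residueCard F := by exact_mod_cast (one_lt_residueCard F).le
  rw [nabs, if_neg hx]
  positivity

theorem nabs_of_valuation_one {x : F} (hx : valuation F x = 1) : nabs x = 1 := by
  have h0 : x ≠ 0 := by
    rintro rfl
    simp at hx
  rw [nabs, if_neg h0, hx, map_one, WithZero.log_one, zpow_zero]

theorem nabs_one : nabs (1 : F) = 1 := nabs_of_valuation_one (map_one _)

theorem nabs_inv (x : F) : nabs x⁻¹ = (nabs x)⁻¹ := by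
  by_cases hx : x = 0
  · simp [nabs, hx]
  · refine eq_inv_of_mul_eq_one_left ?_
    rw [← nabs_mul, inv_mul_cancel₀ hx, nabs_one]

/-- An element `y` of value `exp (-1)` is a multiple of `ϖ`, so `exp (-1) ≤ |ϖ| < 1`, and no value
lies strictly between `exp (-1)` and `1`. -/
theorem IsUniformizer.nabs {ϖ : Fˣ} (h : IsUniformizer ϖ) :
    SplitSO5.nabs (ϖ : F) = (residueCard F : ℝ)⁻¹ := by
  rw [SplitSO5.nabs, if_neg ϖ.ne_zero, ← zpow_neg_one]
  congr 1
  set e := IsNonarchimedeanLocalField.valueGroupWithZeroIsoInt F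
  obtain ⟨y, hy⟩ := ValuativeRel.valuation_surjective (e.symm (WithZero.exp (-1)))
  have hy1 : e (valuation F y) = WithZero.exp (-1) := by rw [hy]; simp
  have hy2 : valuation F y < 1 := by
    rw [← map_lt_map_iff e, hy1, map_one, ← WithZero.exp_zero, WithZero.exp_lt_exp]
    norm_num
  have hy3 : y ∈ 𝒪[F] := (Valuation.mem_integer_iff _ _).2 hy2.le
  have h1 : valuation F y ≤ valuation F ϖ := by
    obtain ⟨z, hz, hyz⟩ := h.exists_eq_mul hy3 ((red_eq_zero_iff hy3).2 hy2)
    rw [hyz, map_mul]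
    exact mul_le_of_le_one_right' ((Valuation.mem_integer_iff _ _).1 hz)
  have h2 : valuation F (ϖ : F) < 1 := (red_eq_zero_iff h.mem).1 h.red
  rw [← map_le_map_iff e, hy1] at h1
  rw [← map_lt_map_iff e, map_one] at h2
  have h3 : e (valuation F ϖ) ≠ 0 := by simp
  obtain ⟨n, hn⟩ : ∃ n : ℤ, e (valuation F ϖ) = WithZero.exp n :=
    ⟨WithZero.log (e (valuation F ϖ)), (WithZero.exp_log h3).symm⟩
  rw [hn] at h1 h2 ⊢
  rw [← WithZero.exp_zero, WithZero.exp_lt_exp] at h2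
  rw [WithZero.exp_le_exp] at h1
  rw [WithZero.log_exp]
  omega

end Topological

end SplitSO5

end

noncomputable section

namespace SplitSO5

/-! ### Explicit elements of the group and their action on vectors. -/

section Generators

variable {F : Type*} [Field F]

/-- An element of `G` from its matrix. -/
def ofMat (M : Matrix (Fin 5) (Fin 5) F) (hdet : M.det = 1) (hJ : Mᵀ * J F * M = J F) : SO32 F :=
  ⟨⟨M, hdet⟩, hJ⟩

/-- An element of the unipotent radical of the stabilizer of an isotropic line. -/
def unip (a t c : F) : SO32 F :=
  ofMat !![1, -c, -(2 * t), -a, -(a * c + 2 * t ^ 2); 0, 1, 0, 0, a; 0, 0, 1, 0, 2 * t;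
      0, 0, 0, 1, c; 0, 0, 0, 0, 1]
    (by
      rw [Matrix.det_of_isUpperTriangular]
      · simp [Fin.prod_univ_five]
      · intro i j hij
        fin_cases i <;> fin_cases j <;> first | rfl | (exfalso; revert hij; decide))
    (by
      ext i j
      fin_cases i <;> fin_cases j <;>
        simp [Matrix.mul_apply, Fin.sum_univ_five, J, Fin.rev] <;> ring)

/-- The isometry which exchanges the first and the last basis vectors. -/
def swapOuter (F : Type*) [Field F] : SO32 F :=
  ofMat !![0, 0, 0, 0, 1; 0, 1, 0, 0, 0; 0, 0, -1, 0, 0; 0, 0, 0, 1, 0; 1, 0, 0, 0, 0]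
    (by
      simp [Matrix.det_succ_row_zero, Fin.sum_univ_succ, Fin.succAbove]
      norm_num)
    (by
      ext i j
      fin_cases i <;> fin_cases j <;>
        simp [Matrix.mul_apply, Fin.sum_univ_five, J, Fin.rev])

/-- The isometry which exchanges the two hyperbolic planes. -/
def swapPlanes (F : Type*) [Field F] : SO32 F :=
  ofMat !![0, 1, 0, 0, 0; 1, 0, 0, 0, 0; 0, 0, 1, 0, 0; 0, 0, 0, 0, 1; 0, 0, 0, 1, 0]
    (by simp [Matrix.det_succ_row_zero, Fin.sum_univ_succ, Fin.succAbove])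
    (by
      ext i j
      fin_cases i <;> fin_cases j <;>
        simp [Matrix.mul_apply, Fin.sum_univ_five, J, Fin.rev])

/-- A lower triangular unipotent element which fixes the outer hyperbolic plane. -/
def lowUnip (t : F) : SO32 F :=
  ofMat !![1, 0, 0, 0, 0; 0, 1, 0, 0, 0; 0, 2 * t, 1, 0, 0; 0, -(2 * t ^ 2), -(2 * t), 1, 0;
      0, 0, 0, 0, 1]
    (by
      rw [Matrix.det_of_isLowerTriangular]
      · simp [Fin.prod_univ_five]
      · intro i j hij
        fin_cases i <;> fin_cases j <;> first | rfl | (exfalso; revert hij; decide))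
    (by
      ext i j
      fin_cases i <;> fin_cases j <;>
        simp [Matrix.mul_apply, Fin.sum_univ_five, J, Fin.rev] <;> ring)

theorem mat_unip (a t c : F) : mat (unip a t c) =
    !![1, -c, -(2 * t), -a, -(a * c + 2 * t ^ 2); 0, 1, 0, 0, a; 0, 0, 1, 0, 2 * t;
      0, 0, 0, 1, c; 0, 0, 0, 0, 1] := rfl

theorem mat_swapOuter : mat (swapOuter F) =
    !![0, 0, 0, 0, 1; 0, 1, 0, 0, 0; 0, 0, -1, 0, 0; 0, 0, 0, 1, 0; 1, 0, 0, 0, 0] := rfl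

theorem mat_swapPlanes : mat (swapPlanes F) =
    !![0, 1, 0, 0, 0; 1, 0, 0, 0, 0; 0, 0, 1, 0, 0; 0, 0, 0, 0, 1; 0, 0, 0, 1, 0] := rfl

theorem mat_lowUnip (t : F) : mat (lowUnip t) =
    !![1, 0, 0, 0, 0; 0, 1, 0, 0, 0; 0, 2 * t, 1, 0, 0; 0, -(2 * t ^ 2), -(2 * t), 1, 0;
      0, 0, 0, 0, 1] := rfl

theorem mat_torusElt (α : Fˣ) :
    mat (torusElt α) = Matrix.diagonal ![(α : F), 1, 1, 1, ((α⁻¹ : Fˣ) : F)] := rfl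

theorem unip_mulVec (a t c : F) (v : Fin 5 → F) : mat (unip a t c) *ᵥ v =
    ![v 0 - c * v 1 - 2 * t * v 2 - a * v 3 - (a * c + 2 * t ^ 2) * v 4, v 1 + a * v 4,
      v 2 + 2 * t * v 4, v 3 + c * v 4, v 4] := by
  ext i
  fin_cases i <;> simp [mat_unip, Matrix.mulVec, dotProduct, Fin.sum_univ_five] <;> ring

theorem swapOuter_mulVec (v : Fin 5 → F) :
    mat (swapOuter F) *ᵥ v = ![v 4, v 1, -v 2, v 3, v 0] := by
  ext i
  fin_cases i <;> simp [mat_swapOuter, Matrix.mulVec, dotProduct, Fin.sum_univ_five]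

theorem swapPlanes_mulVec (v : Fin 5 → F) :
    mat (swapPlanes F) *ᵥ v = ![v 1, v 0, v 2, v 4, v 3] := by
  ext i
  fin_cases i <;> simp [mat_swapPlanes, Matrix.mulVec, dotProduct, Fin.sum_univ_five]

theorem lowUnip_mulVec (t : F) (v : Fin 5 → F) : mat (lowUnip t) *ᵥ v =
    ![v 0, v 1, v 2 + 2 * t * v 1, v 3 - 2 * t * v 2 - 2 * t ^ 2 * v 1, v 4] := by
  ext i
  fin_cases i <;> simp [mat_lowUnip, Matrix.mulVec, dotProduct, Fin.sum_univ_five] <;> ring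

theorem torusElt_mulVec (α : Fˣ) (v : Fin 5 → F) : mat (torusElt α) *ᵥ v =
    ![α * v 0, v 1, v 2, v 3, (α : F)⁻¹ * v 4] := by
  ext i
  rw [mat_torusElt, Matrix.mulVec_diagonal]
  fin_cases i <;> simp

theorem mat_mul_mulVec (g h : SO32 F) (v : Fin 5 → F) :
    mat (g * h) *ᵥ v = mat g *ᵥ (mat h *ᵥ v) := by
  rw [mat_mul, Matrix.mulVec_mulVec]

/-- Orthogonality relations between the columns of an element of `G`. -/
theorem col_orthogonality (g : SO32 F) (i j : Fin 5) :
    mat g 0 i * mat g 4 j + mat g 1 i * mat g 3 j + mat g 2 i * mat g 2 j + mat g 3 i * mat g 1 j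
      + mat g 4 i * mat g 0 j = J F i j := by
  have h := congrFun (congrFun (mat_isometry g) i) j
  rw [← h]
  simp [Matrix.mul_apply, Fin.sum_univ_five, J, Fin.rev, Fin.ext_iff]
  ring

theorem mat_inv (g : SO32 F) : mat g⁻¹ = J F * (mat g)ᵀ * J F := by
  have hJ : J F * J F = 1 := by
    ext i j
    fin_cases i <;> fin_cases j <;> simp [Matrix.mul_apply, J, Fin.rev]
  have h1 : mat g * mat g⁻¹ = 1 := by rw [← mat_mul, mul_inv_cancel, mat_one]
  calc mat g⁻¹ = J F * J F * mat g⁻¹ := by rw [hJ, Matrix.one_mul]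
    _ = J F * ((mat g)ᵀ * J F * mat g) * mat g⁻¹ := by rw [mat_isometry]
    _ = J F * (mat g)ᵀ * J F * (mat g * mat g⁻¹) := by simp only [Matrix.mul_assoc]
    _ = _ := by rw [h1, Matrix.mul_one]

/-- Inversion reflects a matrix in the antidiagonal; hence it preserves upper triangular elements.
-/
theorem mat_inv_apply (g : SO32 F) (i j : Fin 5) : mat g⁻¹ i j = mat g j.rev i.rev := by
  rw [mat_inv]
  have h : ∀ k l : Fin 5, J F k l = if k = l.rev then 1 else 0 := fun _ _ => rfl
  have h' : ∀ k l : Fin 5, J F k l = if l = k.rev then 1 else 0 := fun k l => by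
    rw [h]
    congr 1
    rw [eq_iff_iff]
    constructor <;> rintro rfl <;> simp
  simp [Matrix.mul_apply, Finset.sum_mul]
  simp_rw [h _ j, h' i]
  simp

theorem mat_mul_col (k g : SO32 F) (j : Fin 5) :
    (fun i => mat (k * g) i j) = mat k *ᵥ fun i => mat g i j := by
  ext i
  rw [mat_mul]
  rfl

theorem J_apply (i j : Fin 5) : J F i j = if i = j.rev then 1 else 0 := rfl

theorem ext_mat {g h : SO32 F} (H : mat g = mat h) : g = h := Subtype.ext (Subtype.ext H)

end Generators

end SplitSO5

end

noncomputable section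

namespace SplitSO5

/-! ### Normal form of primitive vectors under `K`. -/

section CompactGroup

variable {F : Type*} [Field F] [ValuativeRel F] [TopologicalSpace F]
  [IsNonarchimedeanLocalField F]

theorem mulVec_mem {k : SO32 F} (hk : k ∈ maxCompact F) {v : Fin 5 → F} (hv : ∀ i, v i ∈ 𝒪[F])
    (i : Fin 5) : (mat k *ᵥ v) i ∈ 𝒪[F] := by
  change ∑ j, mat k i j * v j ∈ 𝒪[F]
  exact sum_mem fun j _ => mul_mem ((mem_maxCompact_iff k).1 hk i j) (hv j)

theorem red_mulVec {k : SO32 F} (hk : k ∈ maxCompact F) {v : Fin 5 → F} (hv : ∀ i, v i ∈ 𝒪[F])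
    (i : Fin 5) : red ((mat k *ᵥ v) i) = ((mat k).map red *ᵥ fun j => red (v j)) i := by
  have h := (mem_maxCompact_iff k).1 hk
  change red (∑ j, mat k i j * v j) = ∑ j, red (mat k i j) * red (v j)
  rw [red_sum _ fun j _ => mul_mem (h i j) (hv j)]
  exact Finset.sum_congr rfl fun j _ => red_mul (h i j) (hv j)

theorem unip_mem {a t c : F} (ha : a ∈ 𝒪[F]) (ht : t ∈ 𝒪[F]) (hc : c ∈ 𝒪[F]) :
    unip a t c ∈ maxCompact F := by
  have h2 := two_mem (F := F)
  have h2t := mul_mem h2 ht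
  have h3 : a * c + 2 * t ^ 2 ∈ 𝒪[F] :=
    add_mem (mul_mem ha hc) (mul_mem h2 (pow_mem ht 2))
  rw [mem_maxCompact_iff]
  intro i j
  rw [mat_unip]
  fin_cases i <;> fin_cases j <;>
    first
    | exact one_mem _ | exact zero_mem _ | exact neg_mem hc | exact neg_mem h2t
    | exact neg_mem ha | exact neg_mem h3 | exact ha | exact h2t | exact hc

theorem lowUnip_mem {t : F} (ht : t ∈ 𝒪[F]) : lowUnip t ∈ maxCompact F := by
  have h2 := two_mem (F := F)
  have h2t := mul_mem h2 ht
  have h3 : 2 * t ^ 2 ∈ 𝒪[F] := mul_mem h2 (pow_mem ht 2)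
  rw [mem_maxCompact_iff]
  intro i j
  rw [mat_lowUnip]
  fin_cases i <;> fin_cases j <;>
    first
    | exact one_mem _ | exact zero_mem _ | exact neg_mem h2t
    | exact neg_mem h3 | exact h2t

theorem swapOuter_mem : swapOuter F ∈ maxCompact F := by
  rw [mem_maxCompact_iff]
  intro i j
  rw [mat_swapOuter]
  fin_cases i <;> fin_cases j <;>
    first | exact one_mem _ | exact zero_mem _ | exact neg_mem (one_mem _)

theorem swapPlanes_mem : swapPlanes F ∈ maxCompact F := by
  rw [mem_maxCompact_iff]
  intro i j
  rw [mat_swapPlanes]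
  fin_cases i <;> fin_cases j <;> first | exact one_mem _ | exact zero_mem _

theorem torusElt_mem {α : Fˣ} (h : red (α : F) ≠ 0) : torusElt α ∈ maxCompact F := by
  have h1 := mem_of_red h
  have h2 : ((α⁻¹ : Fˣ) : F) ∈ 𝒪[F] := by
    rw [Units.val_inv_eq_inv_val]
    exact inv_mem_of_red h
  rw [mem_maxCompact_iff]
  intro i j
  rw [mat_torusElt]
  fin_cases i <;> fin_cases j <;>
    first | exact one_mem _ | exact zero_mem _ | exact h1 | exact h2

/-- The two swaps bring a unit in any outer coordinate to the last place. If only the middle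
coordinate is a unit, `unip 0 1 0` first makes coordinate zero congruent to `-2 w 2`, a unit because
`2` is one. -/
theorem exists_last_unit (hF : ringChar 𝓀[F] ≠ 2) {w : Fin 5 → F} (hw : ∀ i, w i ∈ 𝒪[F])
    (hw' : ∃ i, red (w i) ≠ 0) : ∃ k ∈ maxCompact F, red ((mat k *ᵥ w) 4) ≠ 0 := by
  have hs := swapOuter_mem (F := F)
  have hp := swapPlanes_mem (F := F)
  by_cases h4 : red (w 4) = 0
  swap
  · exact ⟨1, one_mem _, by rwa [mat_one, Matrix.one_mulVec]⟩
  by_cases h0 : red (w 0) = 0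
  swap
  · exact ⟨_, hs, by rw [swapOuter_mulVec]; exact h0⟩
  by_cases h3 : red (w 3) = 0
  swap
  · exact ⟨_, hp, by rw [swapPlanes_mulVec]; exact h3⟩
  by_cases h1 : red (w 1) = 0
  swap
  · exact ⟨_, mul_mem hs hp, by rw [mat_mul_mulVec, swapOuter_mulVec, swapPlanes_mulVec]; exact h1⟩
  have h2 : red (w 2) ≠ 0 := by
    obtain ⟨i, hi⟩ := hw'
    fin_cases i <;> simp_all
  refine ⟨_, mul_mem hs (unip_mem (zero_mem _) (one_mem _) (zero_mem _)), ?_⟩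
  rw [mat_mul_mulVec, swapOuter_mulVec, unip_mulVec]
  have e : w 0 - 0 * w 1 - 2 * 1 * w 2 - 0 * w 3 - (0 * 0 + 2 * 1 ^ 2) * w 4
      = w 0 - 2 * w 2 - 2 * w 4 := by ring
  change red (w 0 - 0 * w 1 - 2 * 1 * w 2 - 0 * w 3 - (0 * 0 + 2 * 1 ^ 2) * w 4) ≠ 0
  have m2 := mul_mem two_mem (hw 2)
  have m4 := mul_mem two_mem (hw 4)
  rw [e, red_sub (sub_mem (hw 0) m2) m4, red_sub (hw 0) m2, red_mul two_mem (hw 2),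
    red_mul two_mem (hw 4), h0, h4, mul_zero, sub_zero, zero_sub]
  exact neg_ne_zero.2 (mul_ne_zero (red_two_ne_zero hF) h2)

/-- The group `K` moves a primitive vector to a vector which depends on its length only. -/
theorem exists_normal_form (hF : ringChar 𝓀[F] ≠ 2) {w : Fin 5 → F} (hw : ∀ i, w i ∈ 𝒪[F])
    (hw' : ∃ i, red (w i) ≠ 0) :
    ∃ k ∈ maxCompact F, mat k *ᵥ w = ![Q w w / 2, 0, 0, 0, 1] := by
  obtain ⟨k, hk, h4⟩ := exists_last_unit hF hw hw'
  have hv := mulVec_mem hk hw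
  have hQ : Q (mat k *ᵥ w) (mat k *ᵥ w) = Q w w := Q_smul k w
  set v := mat k *ᵥ w with hvdef
  have h20 : (2 : F) ≠ 0 := ne_zero_of_red (red_two_ne_zero hF)
  have h40 := ne_zero_of_red h4
  have hi := inv_mem_of_red h4
  have h2i := inv_mem_of_red (red_two_ne_zero hF)
  -- As `v 4` is a unit, the unipotent parameters that clear the three middle coordinates are
  -- integral. The torus element then turns the last coordinate into `1`, and the invariance of the
  -- length fixes the first.
  refine ⟨torusElt (Units.mk0 _ h40) * unip (-(v 1 * (v 4)⁻¹)) (-(v 2 * (v 4)⁻¹ * 2⁻¹))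
    (-(v 3 * (v 4)⁻¹)) * k, mul_mem (mul_mem (torusElt_mem h4) (unip_mem ?_ ?_ ?_)) hk, ?_⟩
  · exact neg_mem (mul_mem (hv 1) hi)
  · exact neg_mem (mul_mem (mul_mem (hv 2) hi) h2i)
  · exact neg_mem (mul_mem (hv 3) hi)
  · rw [mat_mul_mulVec, mat_mul_mulVec, torusElt_mulVec, unip_mulVec, ← hvdef, ← hQ, Q_self]
    ext i
    fin_cases i <;> simp <;> field_simp <;> ring

end CompactGroup

/-! ### The Iwasawa decomposition. -/

section Iwasawa

variable {F : Type*} [Field F] [ValuativeRel F] [TopologicalSpace F]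
  [IsNonarchimedeanLocalField F]

/-- The first column is isotropic, so the normal form of its primitive multiple is the last basis
vector, which `swapOuter` makes the first. -/
theorem exists_first_col (hF : ringChar 𝓀[F] ≠ 2) (g : SO32 F) :
    ∃ k ∈ maxCompact F, ∃ c : F, c ≠ 0 ∧ (fun i => mat (k * g) i 0) = ![c, 0, 0, 0, 0] := by
  have h0 : (fun i => mat g i 0) ≠ 0 := by
    intro h
    have h1 := col_orthogonality g 0 4
    have h2 : ∀ i, mat g i 0 = 0 := fun i => congrFun h i
    simp [h2, J, Fin.rev] at h1
  obtain ⟨c, hc, hw, hw'⟩ := exists_primitive_smul _ h0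
  obtain ⟨k, hk, h⟩ := exists_normal_form hF hw hw'
  refine ⟨swapOuter F * k, mul_mem swapOuter_mem hk, c⁻¹, inv_ne_zero hc, ?_⟩
  have hQ : Q (fun i => c * mat g i 0) (fun i => c * mat g i 0) = 0 := by
    have h1 := col_orthogonality g 0 0
    simp only [J, Matrix.of_apply, Fin.rev_zero] at h1
    rw [if_neg (by decide)] at h1
    rw [Q_self]
    linear_combination c ^ 2 * h1
  rw [hQ] at h
  have e : (fun i => mat g i 0) = c⁻¹ • fun i => c * mat g i 0 := by
    ext i
    simp [hc]
  rw [mat_mul_col, e, Matrix.mulVec_smul, mat_mul_mulVec, h, swapOuter_mulVec]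
  ext i
  fin_cases i <;> simp

/-- Only elements fixing the first basis vector may be used. If `|u 3| ≤ |u 1|`, the relation `(u
2)² = -2 u 1 u 3` makes `u 2 / u 1` integral, and `lowUnip` clears coordinates two and three
together. Otherwise coordinates one and three are interchanged first. -/
theorem exists_second_col {u : Fin 5 → F} (hF : ringChar 𝓀[F] ≠ 2)
    (h4 : u 4 = 0) (hQ : 2 * u 1 * u 3 + u 2 ^ 2 = 0) (h0 : ¬ (u 1 = 0 ∧ u 2 = 0 ∧ u 3 = 0)) :
    ∃ k ∈ maxCompact F, mat k *ᵥ ![1, 0, 0, 0, 0] = ![1, 0, 0, 0, 0] ∧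
      ∃ b : F, b ≠ 0 ∧ mat k *ᵥ u = ![u 0, b, 0, 0, 0] := by
  have h20 : (2 : F) ≠ 0 := ne_zero_of_red (red_two_ne_zero hF)
  have v2 : valuation F 2 = 1 := (red_ne_zero_iff two_mem).1 (red_two_ne_zero hF)
  have key : ∀ u : Fin 5 → F, u 4 = 0 → 2 * u 1 * u 3 + u 2 ^ 2 = 0 → u 1 ≠ 0 →
      valuation F (u 3) ≤ valuation F (u 1) →
      ∃ k ∈ maxCompact F, mat k *ᵥ ![1, 0, 0, 0, 0] = ![1, 0, 0, 0, 0] ∧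
      ∃ b : F, b ≠ 0 ∧ mat k *ᵥ u = ![u 0, b, 0, 0, 0] := by
    intro u h4 hQ h1 hle
    have hval : valuation F (u 2 / u 1) ≤ 1 := by
      have e1 : (u 2 / u 1) ^ 2 = -(2 * (u 3 / u 1)) := by
        field_simp
        linear_combination hQ
      have e2 : valuation F (u 2 / u 1) ^ 2 ≤ 1 := by
        rw [← map_pow, e1, Valuation.map_neg, map_mul, v2, one_mul, map_div₀]
        exact div_le_one_of_le₀ hle zero_le
      exact (pow_le_one_iff two_ne_zero).1 e2
    have hm : u 2 / u 1 ∈ 𝒪[F] := (Valuation.mem_integer_iff _ _).2 hval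
    refine ⟨lowUnip (-(u 2 / u 1 * 2⁻¹)), lowUnip_mem (neg_mem (mul_mem hm
      (inv_mem_of_red (red_two_ne_zero hF)))), ?_, u 1, h1, ?_⟩
    · rw [lowUnip_mulVec]
      ext i
      fin_cases i <;> simp
    · rw [lowUnip_mulVec]
      have e3 : u 3 = -(u 2 ^ 2) / (2 * u 1) := by
        field_simp
        linear_combination hQ
      ext i
      fin_cases i <;> simp [h4, e3] <;> field_simp <;> ring
  have h13 : ¬ (u 1 = 0 ∧ u 3 = 0) := by
    rintro ⟨h1, h3⟩
    refine h0 ⟨h1, ?_, h3⟩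
    rw [h1, h3] at hQ
    simpa using hQ
  rcases le_total (valuation F (u 3)) (valuation F (u 1)) with h | h
  · refine key u h4 hQ (fun h1 => h13 ⟨h1, ?_⟩) h
    rw [h1, map_zero, le_zero_iff] at h
    simpa using h
  · set s := swapPlanes F * swapOuter F * swapPlanes F with hs
    have hsm : s ∈ maxCompact F := mul_mem (mul_mem swapPlanes_mem swapOuter_mem) swapPlanes_mem
    have hsv : ∀ v, mat s *ᵥ v = ![v 0, v 3, -v 2, v 1, v 4] := by
      intro v
      rw [hs, mat_mul_mulVec, mat_mul_mulVec, swapPlanes_mulVec, swapOuter_mulVec,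
        swapPlanes_mulVec]
      ext i
      fin_cases i <;> rfl
    obtain ⟨k, hk, hk1, b, hb, hk2⟩ := key (mat s *ᵥ u) (by rw [hsv]; exact h4)
      (by rw [hsv]; simp; linear_combination hQ)
      (by
        rw [hsv]
        intro h3
        change u 3 = 0 at h3
        refine h13 ⟨?_, h3⟩
        rw [h3, map_zero, le_zero_iff] at h
        simpa using h) (by rw [hsv]; exact h)
    refine ⟨k * s, mul_mem hk hsm, ?_, b, hb, ?_⟩
    · rw [mat_mul_mulVec, hsv]
      simpa using hk1
    · rw [mat_mul_mulVec, hk2, hsv]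
      rfl

/-- The Iwasawa decomposition, for `G = K B`. -/
theorem exists_mul_upper (hF : ringChar 𝓀[F] ≠ 2) (g : SO32 F) :
    ∃ k ∈ maxCompact F, (mat (k * g)).BlockTriangular id := by
  obtain ⟨k₁, hk₁, c, hc, h1⟩ := exists_first_col hF g
  set g₁ := k₁ * g with hg₁
  have c0 : ∀ i, mat g₁ i 0 = (![c, 0, 0, 0, 0] : Fin 5 → F) i := fun i => congrFun h1 i
  -- Once the first column is a multiple of the first basis vector, orthogonality of the other
  -- columns to it clears the last row off the diagonal.
  have o : ∀ (g : SO32 F) (c : F), c ≠ 0 → (∀ i, mat g i 0 = (![c, 0, 0, 0, 0] : Fin 5 → F) i) →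
      ∀ j, j ≠ 4 → mat g 4 j = 0 := by
    intro g c hc c0 j hj
    have h := col_orthogonality g 0 j
    rw [J_apply, if_neg (by
      intro e
      exact hj (by rw [← Fin.rev_rev j, ← e]; rfl))] at h
    simp [c0, hc] at h
    exact h
  have h41 : mat g₁ 4 1 = 0 := o g₁ c hc c0 1 (by decide)
  have h43 : mat g₁ 4 3 = 0 := o g₁ c hc c0 3 (by decide)
  obtain ⟨k₂, hk₂, hk1, b, hb, hk2⟩ := exists_second_col (u := fun i => mat g₁ i 1) hF h41
    (by
      have h := col_orthogonality g₁ 1 1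
      rw [J_apply, if_neg (by decide), h41] at h
      linear_combination h)
    (by
      rintro ⟨e1, e2, e3⟩
      have h := col_orthogonality g₁ 1 3
      rw [J_apply, if_pos (by decide), e1, e2, e3, h41, h43] at h
      simp at h)
  refine ⟨k₂ * k₁, mul_mem hk₂ hk₁, ?_⟩
  rw [mul_assoc, ← hg₁]
  have d0 : ∀ i, mat (k₂ * g₁) i 0 = (![c, 0, 0, 0, 0] : Fin 5 → F) i := by
    intro i
    have h := congrFun (mat_mul_col k₂ g₁ 0) i
    have e : (![c, 0, 0, 0, 0] : Fin 5 → F) = c • ![1, 0, 0, 0, 0] := by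
      ext i
      fin_cases i <;> simp
    rw [h1, e, Matrix.mulVec_smul, hk1, ← e] at h
    exact h
  have d1 : ∀ i, mat (k₂ * g₁) i 1 = (![mat g₁ 0 1, b, 0, 0, 0] : Fin 5 → F) i := by
    intro i
    have h := congrFun (mat_mul_col k₂ g₁ 1) i
    rw [hk2] at h
    exact h
  have d4 := o _ c hc d0
  have d32 : mat (k₂ * g₁) 3 2 = 0 := by
    have h := col_orthogonality (k₂ * g₁) 1 2
    rw [J_apply, if_neg (by decide)] at h
    simp [d1, d4, hb] at h
    exact h
  intro i j hij
  have hc : ∀ i j : Fin 5, id j < id i → (j = 0 ∧ i ≠ 0) ∨ (j = 1 ∧ (i = 2 ∨ i = 3 ∨ i = 4)) ∨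
      (i = 4 ∧ j ≠ 4) ∨ (i = 3 ∧ j = 2) := by decide
  rcases hc i j hij with ⟨rfl, hi⟩ | ⟨rfl, rfl | rfl | rfl⟩ | ⟨rfl, hj⟩ | ⟨rfl, rfl⟩
  · rw [d0]
    fin_cases i <;> first | rfl | exact absurd rfl hi
  · rw [d1]
    rfl
  · rw [d1]
    rfl
  · rw [d1]
    rfl
  · exact d4 _ hj
  · exact d32

end Iwasawa

end SplitSO5

end

noncomputable section

namespace SplitSO5

/-! ### The diagonal torus and the Weyl group. -/

section Diagonal

variable {F : Type*} [Field F]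

/-- The element `diag(α, β, 1, β⁻¹, α⁻¹)`. -/
def diagElt (α β : Fˣ) : SO32 F := torusElt α * (swapPlanes F * torusElt β * swapPlanes F)

theorem mat_diagElt (α β : Fˣ) :
    mat (diagElt α β) = Matrix.diagonal ![(α : F), β, 1, (β : F)⁻¹, (α : F)⁻¹] := by
  rw [diagElt, mat_mul, mat_mul, mat_mul, mat_torusElt, mat_torusElt, mat_swapPlanes]
  ext i j
  rw [Matrix.diagonal_mul, Matrix.mul_apply, Fin.sum_univ_five]
  simp only [Matrix.mul_diagonal]
  fin_cases i <;> fin_cases j <;> simp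

theorem torusElt_eq_diagElt (α : Fˣ) : torusElt α = diagElt α 1 := by
  apply ext_mat
  rw [mat_diagElt, mat_torusElt]
  simp

/-- With `swapOuter_mul_diagElt` this gives the Weyl group action on the torus: one swap exchanges
the two parameters, the other inverts the first. -/
theorem swapPlanes_mul_diagElt (α β : Fˣ) :
    swapPlanes F * diagElt α β = diagElt β α * swapPlanes F := by
  apply ext_mat
  rw [mat_mul, mat_mul, mat_diagElt, mat_diagElt, mat_swapPlanes]
  ext i j
  rw [Matrix.diagonal_mul, Matrix.mul_diagonal]
  fin_cases i <;> fin_cases j <;> simp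

theorem swapOuter_mul_diagElt (α β : Fˣ) :
    swapOuter F * diagElt α β = diagElt α⁻¹ β * swapOuter F := by
  apply ext_mat
  rw [mat_mul, mat_mul, mat_diagElt, mat_diagElt, mat_swapOuter]
  ext i j
  rw [Matrix.diagonal_mul, Matrix.mul_diagonal]
  fin_cases i <;> fin_cases j <;> simp

theorem diagElt_blockTriangular (α β : Fˣ) : (mat (diagElt α β)).BlockTriangular id := by
  rw [mat_diagElt]
  exact Matrix.blockTriangular_diagonal _

theorem unip_blockTriangular (a t c : F) : (mat (unip a t c)).BlockTriangular id := by
  rw [mat_unip]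
  intro i j hij
  fin_cases i <;> fin_cases j <;> first | rfl | (exfalso; revert hij; decide)

/-- The third parameter must vanish: conjugation moves the entries `-c` and `c` of `unip a t c`
below the diagonal. -/
theorem conj_unip_blockTriangular (a t : F) :
    (mat (swapPlanes F * unip a t 0 * swapPlanes F)).BlockTriangular id := by
  rw [mat_mul, mat_mul, mat_unip, mat_swapPlanes]
  intro i j hij
  fin_cases i <;> fin_cases j <;>
    first
    | (exfalso; revert hij; decide)
    | simp [Matrix.mul_apply, Fin.sum_univ_five]

theorem swapPlanes_mul_self : swapPlanes F * swapPlanes F = 1 := by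
  apply ext_mat
  rw [mat_mul, mat_one, mat_swapPlanes]
  ext i j
  fin_cases i <;> fin_cases j <;> simp [Matrix.mul_apply, Fin.sum_univ_five]

theorem torusElt_inv (α : Fˣ) : (torusElt α)⁻¹ = torusElt α⁻¹ := by
  rw [inv_eq_iff_mul_eq_one]
  apply ext_mat
  rw [mat_mul, mat_torusElt, mat_torusElt, mat_one, Matrix.diagonal_mul_diagonal,
    ← Matrix.diagonal_one]
  congr 1
  ext i
  fin_cases i <;> simp

end Diagonal

/-! ### The action of `K` on vectors over the residue field. -/

section Reduction

variable {F : Type*} [Field F] [ValuativeRel F] [TopologicalSpace F]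
  [IsNonarchimedeanLocalField F]

/-- The reduction of the matrix of an element of `K`. -/
def redMat (k : SO32 F) : Matrix (Fin 5) (Fin 5) 𝓀[F] := (mat k).map red

/-- The reduction of a vector. -/
def redVec (v : Fin 5 → F) : Fin 5 → 𝓀[F] := fun i => red (v i)

theorem redVec_mulVec {k : SO32 F} (hk : k ∈ maxCompact F) {v : Fin 5 → F}
    (hv : ∀ i, v i ∈ 𝒪[F]) : redVec (mat k *ᵥ v) = redMat k *ᵥ redVec v :=
  funext (red_mulVec hk hv)

theorem redMat_mul {k l : SO32 F} (hk : k ∈ maxCompact F) (hl : l ∈ maxCompact F) :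
    redMat (k * l) = redMat k * redMat l := by
  have h1 := (mem_maxCompact_iff k).1 hk
  have h2 := (mem_maxCompact_iff l).1 hl
  ext i j
  change red (∑ p, mat k i p * mat l p j) = ∑ p, red (mat k i p) * red (mat l p j)
  rw [red_sum _ fun p _ => mul_mem (h1 i p) (h2 p j)]
  exact Finset.sum_congr rfl fun p _ => red_mul (h1 i p) (h2 p j)

theorem redMat_one : redMat (1 : SO32 F) = 1 := by
  ext i j
  rw [redMat, mat_one, Matrix.map_apply, Matrix.one_apply, Matrix.one_apply]
  split_ifs
  · exact red_one
  · exact red_zero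

theorem redMat_inv_mul {k : SO32 F} (hk : k ∈ maxCompact F) : redMat k⁻¹ * redMat k = 1 := by
  rw [← redMat_mul (inv_mem hk) hk, inv_mul_cancel, redMat_one]

theorem redMat_mulVec_injective {k : SO32 F} (hk : k ∈ maxCompact F) {x y : Fin 5 → 𝓀[F]}
    (h : redMat k *ᵥ x = redMat k *ᵥ y) : x = y := by
  have := congrArg (redMat k⁻¹ *ᵥ ·) h
  simpa [Matrix.mulVec_mulVec, redMat_inv_mul hk] using this

theorem red_Q {v : Fin 5 → F} (hv : ∀ i, v i ∈ 𝒪[F]) : red (Q v v) = Q (redVec v) (redVec v) := by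
  have h2 := two_mem (F := F)
  rw [Q_self, Q_self]
  have m1 := mul_mem (mul_mem h2 (hv 0)) (hv 4)
  have m2 := mul_mem (mul_mem h2 (hv 1)) (hv 3)
  rw [red_add (add_mem m1 m2) (pow_mem (hv 2) 2), red_add m1 m2, red_pow (hv 2),
    red_mul (mul_mem h2 (hv 0)) (hv 4), red_mul (mul_mem h2 (hv 1)) (hv 3),
    red_mul h2 (hv 0), red_mul h2 (hv 1), red_two]
  rfl

theorem exists_lift (x : Fin 5 → 𝓀[F]) : ∃ w : Fin 5 → F, (∀ i, w i ∈ 𝒪[F]) ∧ redVec w = x := by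
  choose w hw hx using fun i => red_surjective (x i)
  exact ⟨w, hw, funext hx⟩

theorem exists_redMat_normal_form (hF : ringChar 𝓀[F] ≠ 2) {x : Fin 5 → 𝓀[F]} (hx : x ≠ 0) :
    ∃ k ∈ maxCompact F, redMat k *ᵥ x = ![Q x x / 2, 0, 0, 0, 1] := by
  obtain ⟨w, hw, rfl⟩ := exists_lift x
  obtain ⟨k, hk, h⟩ := exists_normal_form hF hw (Function.ne_iff.1 hx)
  refine ⟨k, hk, ?_⟩
  rw [← redVec_mulVec hk hw, h]
  have hQ : Q w w ∈ 𝒪[F] := by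
    rw [Q_self]
    have h2 := two_mem (F := F)
    exact add_mem (add_mem (mul_mem (mul_mem h2 (hw 0)) (hw 4))
      (mul_mem (mul_mem h2 (hw 1)) (hw 3))) (pow_mem (hw 2) 2)
  have e : red (Q w w / 2) = Q (redVec w) (redVec w) / 2 := by
    have h2 := red_two_ne_zero hF
    rw [div_eq_mul_inv, red_mul hQ (inv_mem_of_red h2), red_inv h2, red_Q hw, red_two,
      div_eq_mul_inv]
  funext i
  fin_cases i
  · exact e
  · exact red_zero
  · exact red_zero
  · exact red_zero
  · exact red_one

/-- The group `K` acts transitively on the nonzero vectors of given length modulo `ϖ`. -/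
theorem redMat_transitive (hF : ringChar 𝓀[F] ≠ 2) {x y : Fin 5 → 𝓀[F]} (hx : x ≠ 0) (hy : y ≠ 0)
    (h : Q x x = Q y y) : ∃ k ∈ maxCompact F, redMat k *ᵥ x = y := by
  obtain ⟨k, hk, h1⟩ := exists_redMat_normal_form hF hx
  obtain ⟨l, hl, h2⟩ := exists_redMat_normal_form hF hy
  refine ⟨l⁻¹ * k, mul_mem (inv_mem hl) hk, ?_⟩
  rw [redMat_mul (inv_mem hl) hk, ← Matrix.mulVec_mulVec, h1, h, ← h2, Matrix.mulVec_mulVec,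
    redMat_inv_mul hl, Matrix.one_mulVec]

end Reduction

/-! ### Levels on the sphere, `K`-orbits, and the effect of `torusElt ϖ` on the level. -/

section Levels

variable {F : Type*} [Field F] [ValuativeRel F] [TopologicalSpace F]
  [IsNonarchimedeanLocalField F]

/-- The point `s` of the sphere has norm `|ϖ| ^ (-m)`. -/
def IsLevel (ϖ : Fˣ) {C : SphereCase F} (m : ℕ) (s : Sphere C) : Prop :=
  (∀ i, ((ϖ : F) ^ m • s.1) i ∈ 𝒪[F]) ∧ redVec ((ϖ : F) ^ m • s.1) ≠ 0

theorem smul_val {C : SphereCase F} (g : SO32 F) (s : Sphere C) :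
    (g • s).1 = mat g *ᵥ s.1 := rfl

theorem redVec_smul {k : SO32 F} (hk : k ∈ maxCompact F) {ϖ : Fˣ} {C : SphereCase F} {m : ℕ}
    {s : Sphere C} (hs : IsLevel ϖ m s) :
    redVec ((ϖ : F) ^ m • (k • s).1) = redMat k *ᵥ redVec ((ϖ : F) ^ m • s.1) := by
  rw [smul_val, ← Matrix.mulVec_smul, redVec_mulVec hk hs.1]

theorem IsLevel.smul {k : SO32 F} (hk : k ∈ maxCompact F) {ϖ : Fˣ} {C : SphereCase F} {m : ℕ}
    {s : Sphere C} (hs : IsLevel ϖ m s) : IsLevel ϖ m (k • s) := by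
  refine ⟨?_, ?_⟩
  · rw [smul_val, ← Matrix.mulVec_smul]
    exact mulVec_mem hk hs.1
  · rw [redVec_smul hk hs]
    intro h
    refine hs.2 (redMat_mulVec_injective hk ?_)
    rw [h, Matrix.mulVec_zero]

theorem isLevel_unique {ϖ : Fˣ} (hϖ : IsUniformizer ϖ) {C : SphereCase F} {m n : ℕ}
    {s : Sphere C} (h1 : IsLevel ϖ m s) (h2 : IsLevel ϖ n s) : m = n := by
  have key : ∀ m n : ℕ, IsLevel ϖ m s → IsLevel ϖ n s → ¬ m < n := by
    intro m n h1 h2 hlt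
    refine h2.2 (funext fun i => ?_)
    obtain ⟨j, rfl⟩ := Nat.exists_eq_add_of_lt hlt
    have e : ((ϖ : F) ^ (m + j + 1) • s.1) i
        = (ϖ : F) * ((ϖ : F) ^ j * ((ϖ : F) ^ m • s.1) i) := by
      simp only [Pi.smul_apply, smul_eq_mul]
      ring
    change red (((ϖ : F) ^ (m + j + 1) • s.1) i) = 0
    rw [e, red_mul hϖ.mem (mul_mem (pow_mem hϖ.mem j) (h1.1 i)), hϖ.red, zero_mul]
  have h3 := key m n h1 h2
  have h4 := key n m h2 h1
  omega

theorem SphereCase.baseVec_mem (hF : ringChar 𝓀[F] ≠ 2) (C : SphereCase F) (i : Fin 5) :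
    C.baseVec i ∈ 𝒪[F] := by
  cases C with
  | split =>
    fin_cases i
    · change (1 / 2 : F) ∈ _
      rw [one_div]
      exact inv_mem_of_red (red_two_ne_zero hF)
    · exact zero_mem _
    · exact zero_mem _
    · exact zero_mem _
    · exact one_mem _
  | nonsplit θ hu _ =>
    fin_cases i
    · exact mul_mem two_mem (mem_of_valuation_one hu)
    · exact zero_mem _
    · exact zero_mem _
    · exact one_mem _
    · exact one_mem _

theorem SphereCase.baseVec_last (C : SphereCase F) : C.baseVec 4 = 1 := by
  cases C <;> rfl

/-- Both base vectors end with `1`, so the last coordinate of the scaled vector is exactly `1` and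
its other coordinates are integral. -/
theorem isLevel_base (hF : ringChar 𝓀[F] ≠ 2) {ϖ : Fˣ} (hϖ : IsUniformizer ϖ) (C : SphereCase F)
    (m : ℕ) : IsLevel ϖ m (torusElt (ϖ ^ m) • basePoint hF C) := by
  have hm := pow_mem hϖ.mem m
  have hb := C.baseVec_mem hF
  have e : (ϖ : F) ^ m • (torusElt (ϖ ^ m) • basePoint hF C).1 =
      ![(ϖ : F) ^ m * ((ϖ : F) ^ m * C.baseVec 0), (ϖ : F) ^ m * C.baseVec 1,
        (ϖ : F) ^ m * C.baseVec 2, (ϖ : F) ^ m * C.baseVec 3, 1] := by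
    rw [smul_val, torusElt_mulVec]
    change (ϖ : F) ^ m • ![((ϖ ^ m : Fˣ) : F) * C.baseVec 0, C.baseVec 1, C.baseVec 2, C.baseVec 3,
      ((ϖ ^ m : Fˣ) : F)⁻¹ * C.baseVec 4] = _
    rw [C.baseVec_last]
    ext i
    fin_cases i <;> simp
  refine ⟨?_, ?_⟩
  · rw [e]
    intro i
    fin_cases i
    · exact mul_mem hm (mul_mem hm (hb 0))
    · exact mul_mem hm (hb 1)
    · exact mul_mem hm (hb 2)
    · exact mul_mem hm (hb 3)
    · exact one_mem _
  · rw [e]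
    intro h
    have h4 := congrFun h 4
    change red (1 : F) = 0 at h4
    rw [red_one] at h4
    exact one_ne_zero h4

/-- The `K`-orbits on the sphere are the sets of vectors of given norm. -/
theorem mem_orbitK_iff (hF : ringChar 𝓀[F] ≠ 2) {ϖ : Fˣ} (hϖ : IsUniformizer ϖ) {C : SphereCase F}
    (m : ℕ) (s : Sphere C) : s ∈ orbitK hF ϖ C m ↔ IsLevel ϖ m s := by
  have hb := isLevel_base hF hϖ C m
  constructor
  · rintro ⟨k, rfl⟩
    exact hb.smul k.2
  · intro hs
    set b := torusElt (ϖ ^ m) • basePoint hF C with hbdef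
    have hQ : ∀ s : Sphere C, Q ((ϖ : F) ^ m • s.1) ((ϖ : F) ^ m • s.1)
        = ((ϖ : F) ^ m) ^ 2 * C.radius := by
      intro s
      have h : Q s.1 s.1 = C.radius := s.2
      rw [Q_self] at h ⊢
      simp only [Pi.smul_apply, smul_eq_mul]
      linear_combination ((ϖ : F) ^ m) ^ 2 * h
    -- Both vectors, scaled by `ϖ ^ m`, are primitive of the same length, so they have the same
    -- normal form.
    obtain ⟨k, hk, h1⟩ := exists_normal_form hF hs.1 (Function.ne_iff.1 hs.2)
    obtain ⟨l, hl, h2⟩ := exists_normal_form hF hb.1 (Function.ne_iff.1 hb.2)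
    rw [hQ, Matrix.mulVec_smul] at h1 h2
    have h3 : k • s = l • b := by
      apply Subtype.ext
      have h4 := h1.trans h2.symm
      exact smul_right_injective _ (pow_ne_zero m ϖ.ne_zero) h4
    refine ⟨⟨k⁻¹ * l, mul_mem (inv_mem hk) hl⟩, ?_⟩
    change (k⁻¹ * l) • b = s
    rw [mul_smul, ← h3, inv_smul_smul]

theorem torusElt_smul_val {C : SphereCase F} (ϖ : Fˣ) (s : Sphere C) :
    (torusElt ϖ • s).1 = ![(ϖ : F) * s.1 0, s.1 1, s.1 2, s.1 3, (ϖ : F)⁻¹ * s.1 4] := by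
  rw [smul_val, torusElt_mulVec]

/-- The torus element multiplies the first coordinate by `ϖ` and divides the last by `ϖ`. The level
goes up if the last coordinate of the reduced primitive vector is nonzero, stays if that one
vanishes but some middle one does not, and goes down if only the first survives. The next two level
lemmas treat the other cases. -/
theorem isLevel_torusElt_smul_up {ϖ : Fˣ} (hϖ : IsUniformizer ϖ) {C : SphereCase F} {m : ℕ}
    {s : Sphere C} (hs : IsLevel ϖ m s) (h : redVec ((ϖ : F) ^ m • s.1) 4 ≠ 0) :
    IsLevel ϖ (m + 1) (torusElt ϖ • s) := by
  have hw := hs.1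
  have hp := hϖ.mem
  have e : (ϖ : F) ^ (m + 1) • (torusElt ϖ • s).1 =
      ![(ϖ : F) * ((ϖ : F) * ((ϖ : F) ^ m • s.1) 0), ϖ * ((ϖ : F) ^ m • s.1) 1,
        ϖ * ((ϖ : F) ^ m • s.1) 2, ϖ * ((ϖ : F) ^ m • s.1) 3, ((ϖ : F) ^ m • s.1) 4] := by
    rw [torusElt_smul_val]
    have := ϖ.ne_zero
    ext i
    fin_cases i <;> simp [pow_succ] <;> field_simp
  refine ⟨?_, ?_⟩
  · rw [e]
    intro i
    fin_cases i
    · exact mul_mem hp (mul_mem hp (hw 0))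
    · exact mul_mem hp (hw 1)
    · exact mul_mem hp (hw 2)
    · exact mul_mem hp (hw 3)
    · exact hw 4
  · rw [e]
    exact fun h0 => h (congrFun h0 4)

theorem isLevel_torusElt_smul_same {ϖ : Fˣ} (hϖ : IsUniformizer ϖ) {C : SphereCase F} {m : ℕ}
    {s : Sphere C} (hs : IsLevel ϖ m s) (h : redVec ((ϖ : F) ^ m • s.1) 4 = 0)
    (h' : ¬ (redVec ((ϖ : F) ^ m • s.1) 1 = 0 ∧ redVec ((ϖ : F) ^ m • s.1) 2 = 0 ∧
      redVec ((ϖ : F) ^ m • s.1) 3 = 0)) :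
    IsLevel ϖ m (torusElt ϖ • s) := by
  have hw := hs.1
  have hp := hϖ.mem
  have e : (ϖ : F) ^ m • (torusElt ϖ • s).1 =
      ![(ϖ : F) * ((ϖ : F) ^ m • s.1) 0, ((ϖ : F) ^ m • s.1) 1,
        ((ϖ : F) ^ m • s.1) 2, ((ϖ : F) ^ m • s.1) 3, (ϖ : F)⁻¹ * ((ϖ : F) ^ m • s.1) 4] := by
    rw [torusElt_smul_val]
    have := ϖ.ne_zero
    ext i
    fin_cases i <;> simp <;> ring
  refine ⟨?_, ?_⟩
  · rw [e]
    intro i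
    fin_cases i
    · exact mul_mem hp (hw 0)
    · exact hw 1
    · exact hw 2
    · exact hw 3
    · exact hϖ.inv_mul_mem (hw 4) h
  · rw [e]
    exact fun h0 => h' ⟨congrFun h0 1, congrFun h0 2, congrFun h0 3⟩

/-- The last coordinate of a vector whose reduction is a multiple of the first basis vector. -/
theorem IsUniformizer.inv_sq_mul_mem (hF : ringChar 𝓀[F] ≠ 2) {ϖ : Fˣ} (hϖ : IsUniformizer ϖ)
    {a b x y z c : F} (ha : SplitSO5.red a ≠ 0) (hx : x ∈ 𝒪[F]) (hy : y ∈ 𝒪[F]) (hz : z ∈ 𝒪[F])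
    (hx0 : SplitSO5.red x = 0) (hy0 : SplitSO5.red y = 0) (hz0 : SplitSO5.red z = 0) (hc : c ∈ 𝒪[F])
    (h : 2 * a * b + 2 * x * z + y ^ 2 = ϖ ^ 2 * c) : (ϖ : F)⁻¹ * ((ϖ : F)⁻¹ * b) ∈ 𝒪[F] := by
  obtain ⟨x', hx', rfl⟩ := hϖ.exists_eq_mul hx hx0
  obtain ⟨y', hy', rfl⟩ := hϖ.exists_eq_mul hy hy0
  obtain ⟨z', hz', rfl⟩ := hϖ.exists_eq_mul hz hz0
  have h2 := red_two_ne_zero hF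
  -- The coefficient `2 a` of `b` is a unit and every other term of the relation is divisible by
  -- `ϖ²`.
  have e : (ϖ : F)⁻¹ * ((ϖ : F)⁻¹ * b) = 2⁻¹ * a⁻¹ * (c - 2 * x' * z' - y' ^ 2) := by
    have h1 := ne_zero_of_red ha
    have h3 := ne_zero_of_red h2
    have h4 := ϖ.ne_zero
    field_simp
    linear_combination h
  rw [e]
  exact mul_mem (mul_mem (inv_mem_of_red h2) (inv_mem_of_red ha))
    (sub_mem (sub_mem hc (mul_mem (mul_mem two_mem hx') hz')) (pow_mem hy' 2))

theorem SphereCase.radius_mem (C : SphereCase F) : C.radius ∈ 𝒪[F] := by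
  cases C with
  | split => exact one_mem _
  | nonsplit θ hu _ => exact mul_mem (ofNat_mem _ 4) (mem_of_valuation_one hu)

theorem isLevel_torusElt_smul_down (hF : ringChar 𝓀[F] ≠ 2) {ϖ : Fˣ} (hϖ : IsUniformizer ϖ)
    {C : SphereCase F} {m : ℕ} {s : Sphere C} (hs : IsLevel ϖ (m + 1) s)
    (h1 : redVec ((ϖ : F) ^ (m + 1) • s.1) 1 = 0) (h2 : redVec ((ϖ : F) ^ (m + 1) • s.1) 2 = 0)
    (h3 : redVec ((ϖ : F) ^ (m + 1) • s.1) 3 = 0) (h4 : redVec ((ϖ : F) ^ (m + 1) • s.1) 4 = 0) :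
    IsLevel ϖ m (torusElt ϖ • s) := by
  have hw := hs.1
  have hp := hϖ.mem
  have h0 : redVec ((ϖ : F) ^ (m + 1) • s.1) 0 ≠ 0 := by
    intro h0
    refine hs.2 (funext fun i => ?_)
    fin_cases i <;> assumption
  have e : (ϖ : F) ^ m • (torusElt ϖ • s).1 =
      ![((ϖ : F) ^ (m + 1) • s.1) 0, (ϖ : F)⁻¹ * ((ϖ : F) ^ (m + 1) • s.1) 1,
        (ϖ : F)⁻¹ * ((ϖ : F) ^ (m + 1) • s.1) 2, (ϖ : F)⁻¹ * ((ϖ : F) ^ (m + 1) • s.1) 3,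
        (ϖ : F)⁻¹ * ((ϖ : F)⁻¹ * ((ϖ : F) ^ (m + 1) • s.1) 4)] := by
    rw [torusElt_smul_val]
    have := ϖ.ne_zero
    ext i
    fin_cases i <;> simp [pow_succ] <;> field_simp
  refine ⟨?_, ?_⟩
  · rw [e]
    intro i
    fin_cases i
    · exact hw 0
    · exact hϖ.inv_mul_mem (hw 1) h1
    · exact hϖ.inv_mul_mem (hw 2) h2
    · exact hϖ.inv_mul_mem (hw 3) h3
    -- The scaled vector has length divisible by `ϖ²`, which forces its last coordinate to be
    -- divisible by `ϖ²` and not only by `ϖ`.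
    · refine hϖ.inv_sq_mul_mem hF (a := ((ϖ : F) ^ (m + 1) • s.1) 0)
        (c := ((ϖ : F) ^ m) ^ 2 * C.radius) h0 (hw 1) (hw 2) (hw 3) h1 h2 h3
        (mul_mem (pow_mem (pow_mem hp m) 2) C.radius_mem) ?_
      have h : Q s.1 s.1 = C.radius := s.2
      rw [Q_self] at h
      simp only [Pi.smul_apply, smul_eq_mul]
      linear_combination ((ϖ : F) ^ (m + 1)) ^ 2 * h
  · rw [e]
    exact fun h => h0 (congrFun h 0)

end Levels

end SplitSO5

end

noncomputable section

namespace SplitSO5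

/-! ### Cosets in `K d K` and Schubert cells of isotropic lines. -/

section Cells

variable {F : Type*} [Field F] [ValuativeRel F] [TopologicalSpace F]
  [IsNonarchimedeanLocalField F]

/-- Conjugation divides the first row and the last column by `ϖ`, hence their common corner by `ϖ²`.
If the last column reduces to a multiple of the last basis vector, orthogonality makes the first row
vanish off the diagonal modulo `ϖ`, and isotropy of the last column supplies `ϖ²` in the corner. -/
theorem conj_torusElt_mem (hF : ringChar 𝓀[F] ≠ 2) {ϖ : Fˣ} (hϖ : IsUniformizer ϖ) {k : SO32 F}
    (hk : k ∈ maxCompact F) (h : ∀ i, i ≠ 4 → red (mat k i 4) = 0) :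
    (torusElt ϖ)⁻¹ * k * torusElt ϖ ∈ maxCompact F := by
  have hm := (mem_maxCompact_iff k).1 hk
  have hp := hϖ.mem
  have o04 := congrArg red (col_orthogonality k 0 4)
  have a1 := h 1 (by decide)
  have a2 := h 2 (by decide)
  have a3 := h 3 (by decide)
  have a0 := h 0 (by decide)
  have hsum : ∀ j, red (mat k 0 4 * mat k 4 j + mat k 1 4 * mat k 3 j + mat k 2 4 * mat k 2 j +
      mat k 3 4 * mat k 1 j + mat k 4 4 * mat k 0 j) = red (mat k 4 4) * red (mat k 0 j) := by
    intro j
    have m : ∀ a b, mat k a 4 * mat k b j ∈ 𝒪[F] := fun a b => mul_mem (hm _ _) (hm _ _)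
    rw [red_add (add_mem (add_mem (add_mem (m _ _) (m _ _)) (m _ _)) (m _ _)) (m _ _),
      red_add (add_mem (add_mem (m _ _) (m _ _)) (m _ _)) (m _ _),
      red_add (add_mem (m _ _) (m _ _)) (m _ _), red_add (m _ _) (m _ _),
      red_mul (hm _ _) (hm _ _), red_mul (hm _ _) (hm _ _), red_mul (hm _ _) (hm _ _),
      red_mul (hm _ _) (hm _ _), red_mul (hm _ _) (hm _ _), a0, a1, a2, a3]
    ring
  have h44 : red (mat k 4 4) ≠ 0 := by
    intro h44
    have h1 := hsum 0
    rw [col_orthogonality, h44, zero_mul, J_apply, if_pos (by decide), red_one] at h1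
    exact one_ne_zero h1
  have h0 : ∀ j, j ≠ 0 → red (mat k 0 j) = 0 := by
    intro j hj
    have h1 := hsum j
    rw [col_orthogonality, J_apply, if_neg (by
      intro e
      exact hj (by rw [← Fin.rev_rev j, ← e]; rfl)), red_zero] at h1
    exact (mul_eq_zero.1 h1.symm).resolve_left h44
  have h04 : (ϖ : F)⁻¹ * ((ϖ : F)⁻¹ * mat k 0 4) ∈ 𝒪[F] := by
    refine hϖ.inv_sq_mul_mem hF (c := 0) h44 (hm 1 4) (hm 2 4) (hm 3 4) a1 a2 a3 (zero_mem _) ?_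
    have h1 := col_orthogonality k 4 4
    rw [J_apply, if_neg (by decide)] at h1
    linear_combination h1
  rw [mem_maxCompact_iff, torusElt_inv, mat_mul, mat_mul, mat_torusElt, mat_torusElt]
  intro i j
  rw [Matrix.mul_diagonal, Matrix.diagonal_mul]
  fin_cases i <;> fin_cases j <;> simp
  · rw [mul_comm, mul_inv_cancel_left₀ ϖ.ne_zero]
    exact hm 0 0
  · exact hϖ.inv_mul_mem (hm 0 1) (h0 1 (by decide))
  · exact hϖ.inv_mul_mem (hm 0 2) (h0 2 (by decide))
  · exact hϖ.inv_mul_mem (hm 0 3) (h0 3 (by decide))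
  · rw [mul_comm]
    exact h04
  · exact mul_mem (hm 1 0) hp
  · exact hm 1 1
  · exact hm 1 2
  · exact hm 1 3
  · rw [mul_comm]
    exact hϖ.inv_mul_mem (hm 1 4) a1
  · exact mul_mem (hm 2 0) hp
  · exact hm 2 1
  · exact hm 2 2
  · exact hm 2 3
  · rw [mul_comm]
    exact hϖ.inv_mul_mem (hm 2 4) a2
  · exact mul_mem (hm 3 0) hp
  · exact hm 3 1
  · exact hm 3 2
  · exact hm 3 3
  · rw [mul_comm]
    exact hϖ.inv_mul_mem (hm 3 4) a3
  · exact mul_mem (mul_mem hp (hm 4 0)) hp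
  · exact mul_mem hp (hm 4 1)
  · exact mul_mem hp (hm 4 2)
  · exact mul_mem hp (hm 4 3)
  · rw [mul_comm, inv_mul_cancel_left₀ ϖ.ne_zero]
    exact hm 4 4

/-- The reduction of the last column. -/
def redCol (k : SO32 F) : Fin 5 → 𝓀[F] := redVec fun i => mat k i 4

theorem redCol_mul {k l : SO32 F} (hk : k ∈ maxCompact F) (hl : l ∈ maxCompact F) :
    redCol (k * l) = redMat k *ᵥ redCol l := by
  rw [redCol, mat_mul_col, redVec_mulVec hk fun i => (mem_maxCompact_iff l).1 hl i 4]
  rfl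

theorem redCol_one_apply (i : Fin 5) : redCol (1 : SO32 F) i = if i = 4 then 1 else 0 := by
  change red (mat 1 i 4) = _
  rw [mat_one, Matrix.one_apply]
  split_ifs
  · exact red_one
  · exact red_zero

theorem redCol_ne_zero {k : SO32 F} (hk : k ∈ maxCompact F) : redCol k ≠ 0 := by
  intro h
  have h1 := redCol_mul (inv_mem hk) hk
  rw [inv_mul_cancel, h, Matrix.mulVec_zero] at h1
  have h2 := congrFun h1 4
  rw [redCol_one_apply, if_pos rfl] at h2
  exact one_ne_zero h2

theorem Q_redCol {k : SO32 F} (hk : k ∈ maxCompact F) : Q (redCol k) (redCol k) = 0 := by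
  rw [redCol, ← red_Q fun i => (mem_maxCompact_iff k).1 hk i 4, Q_self]
  have h1 := col_orthogonality k 4 4
  rw [J_apply, if_neg (by decide)] at h1
  rw [← red_zero, ← h1]
  congr 1
  ring

/-- The coset `k d K` thus depends only on the line spanned by the reduced last column of `k`. -/
theorem coset_eq_of_redCol (hF : ringChar 𝓀[F] ≠ 2) {ϖ : Fˣ} (hϖ : IsUniformizer ϖ)
    {k l : SO32 F} (hk : k ∈ maxCompact F) (hl : l ∈ maxCompact F) {u : 𝓀[F]}
    (h : redCol k = u • redCol l) :
    ∃ k' ∈ maxCompact F, k * torusElt ϖ = l * torusElt ϖ * k' := by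
  have h1 : redCol (l⁻¹ * k) = u • redCol (1 : SO32 F) := by
    rw [redCol_mul (inv_mem hl) hk, h, Matrix.mulVec_smul, ← redCol_mul (inv_mem hl) hl,
      inv_mul_cancel]
  refine ⟨_, conj_torusElt_mem hF hϖ (mul_mem (inv_mem hl) hk) fun i hi => ?_, by group⟩
  have h2 := congrFun h1 i
  rw [Pi.smul_apply, redCol_one_apply, if_neg hi, smul_zero] at h2
  exact h2

/-- Here `k d K = b w d K = b D K`; for `b` upper triangular and `D` diagonal this is an Iwasawa
decomposition. -/
theorem exists_weyl_decomposition (hF : ringChar 𝓀[F] ≠ 2) {ϖ : Fˣ} (hϖ : IsUniformizer ϖ)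
    {k b w D : SO32 F} (hk : k ∈ maxCompact F) (hb : b ∈ maxCompact F) (hw : w ∈ maxCompact F)
    (hD : w * torusElt ϖ = D * w) {u : 𝓀[F]} (h : redCol k = u • redCol (b * w)) :
    ∃ k' ∈ maxCompact F, k * torusElt ϖ = b * D * k' := by
  obtain ⟨k', hk', e⟩ := coset_eq_of_redCol hF hϖ hk (mul_mem hb hw) h
  refine ⟨w * k', mul_mem hw hk', ?_⟩
  rw [e, mul_assoc b w, hD]
  group

/-- The isotropic lines over the residue field fall into four Schubert cells according to the last
nonzero coordinate. An upper triangular element of `K`, built from lifts of the coordinates, moves a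
coordinate line to a given line of its cell. Each cell thereby receives one diagonal element from
the Weyl orbit of `d`. -/
theorem cell_open (hF : ringChar 𝓀[F] ≠ 2) {ϖ : Fˣ} (hϖ : IsUniformizer ϖ) {k : SO32 F}
    (hk : k ∈ maxCompact F) (h4 : redCol k 4 ≠ 0) :
    ∃ b ∈ maxCompact F, (mat b).BlockTriangular id ∧ ∃ k' ∈ maxCompact F,
      k * torusElt ϖ = b * diagElt ϖ 1 * k' := by
  have hQ := Q_redCol hk
  rw [Q_self] at hQ
  obtain ⟨a, ha, ea⟩ := red_surjective (redCol k 1 / redCol k 4)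
  obtain ⟨t, ht, et⟩ := red_surjective (redCol k 2 / redCol k 4 / 2)
  obtain ⟨c, hc, ec⟩ := red_surjective (redCol k 3 / redCol k 4)
  have h2 := residue_two_ne_zero hF
  refine ⟨unip a t c, unip_mem ha ht hc, unip_blockTriangular _ _ _,
    exists_weyl_decomposition hF hϖ hk (unip_mem ha ht hc) (one_mem _) (u := redCol k 4)
      (by rw [one_mul, mul_one, torusElt_eq_diagElt]) ?_⟩
  have e : (fun i => mat (unip a t c * 1) i 4) = ![-(a * c + 2 * t ^ 2), a, 2 * t, c, 1] := by
    rw [mul_one, mat_unip]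
    ext i
    fin_cases i <;> rfl
  have m2 : (2 : F) * t ^ 2 ∈ 𝒪[F] := mul_mem two_mem (pow_mem ht 2)
  have r0 : red (-(a * c + 2 * t ^ 2)) = -(red a * red c + 2 * red t ^ 2) := by
    rw [red_neg (add_mem (mul_mem ha hc) m2), red_add (mul_mem ha hc) m2, red_mul ha hc,
      red_mul two_mem (pow_mem ht 2), red_pow ht, red_two]
  have r2 : red (2 * t) = 2 * red t := by rw [red_mul two_mem ht, red_two]
  funext i
  rw [Pi.smul_apply, redCol, redCol, e]
  change redCol k i = redCol k 4 * red (![-(a * c + 2 * t ^ 2), a, 2 * t, c, 1] i)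
  fin_cases i
  · change redCol k 0 = redCol k 4 * red (-(a * c + 2 * t ^ 2))
    rw [r0, ea, et, ec]
    field_simp
    linear_combination hQ
  · change redCol k 1 = redCol k 4 * red a
    rw [ea]
    field_simp
  · change redCol k 2 = redCol k 4 * red (2 * t)
    rw [r2, et]
    field_simp
  · change redCol k 3 = redCol k 4 * red c
    rw [ec]
    field_simp
  · change redCol k 4 = redCol k 4 * red 1
    rw [red_one, mul_one]

theorem cell_second (hF : ringChar 𝓀[F] ≠ 2) {ϖ : Fˣ} (hϖ : IsUniformizer ϖ) {k : SO32 F}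
    (hk : k ∈ maxCompact F) (h4 : redCol k 4 = 0) (h3 : redCol k 3 ≠ 0) :
    ∃ b ∈ maxCompact F, (mat b).BlockTriangular id ∧ ∃ k' ∈ maxCompact F,
      k * torusElt ϖ = b * diagElt 1 ϖ * k' := by
  have hQ := Q_redCol hk
  rw [Q_self] at hQ
  obtain ⟨a, ha, ea⟩ := red_surjective (redCol k 0 / redCol k 3)
  obtain ⟨t, ht, et⟩ := red_surjective (redCol k 2 / redCol k 3 / 2)
  have h2 := residue_two_ne_zero hF
  have hs := swapPlanes_mem (F := F)
  have hb : swapPlanes F * unip a t 0 * swapPlanes F ∈ maxCompact F :=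
    mul_mem (mul_mem hs (unip_mem ha ht (zero_mem _))) hs
  refine ⟨_, hb, conj_unip_blockTriangular _ _,
    exists_weyl_decomposition hF hϖ hk hb hs (u := redCol k 3)
      (by rw [torusElt_eq_diagElt, swapPlanes_mul_diagElt]) ?_⟩
  have e : (fun i => mat (swapPlanes F * unip a t 0 * swapPlanes F * swapPlanes F) i 4)
      = ![a, -(2 * t ^ 2), 2 * t, 1, 0] := by
    rw [mul_assoc, swapPlanes_mul_self, mul_one, mat_mul_col, swapPlanes_mulVec, mat_unip]
    ext i
    fin_cases i <;> simp
  have m2 : (2 : F) * t ^ 2 ∈ 𝒪[F] := mul_mem two_mem (pow_mem ht 2)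
  have r1 : red (-(2 * t ^ 2)) = -(2 * red t ^ 2) := by
    rw [red_neg m2, red_mul two_mem (pow_mem ht 2), red_pow ht, red_two]
  have r2 : red (2 * t) = 2 * red t := by rw [red_mul two_mem ht, red_two]
  funext i
  rw [Pi.smul_apply, redCol, redCol, e]
  change redCol k i = redCol k 3 * red (![a, -(2 * t ^ 2), 2 * t, 1, 0] i)
  fin_cases i
  · change redCol k 0 = redCol k 3 * red a
    rw [ea]
    field_simp
  · change redCol k 1 = redCol k 3 * red (-(2 * t ^ 2))
    rw [h4] at hQ
    rw [r1, et]
    field_simp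
    linear_combination hQ
  · change redCol k 2 = redCol k 3 * red (2 * t)
    rw [r2, et]
    field_simp
  · change redCol k 3 = redCol k 3 * red 1
    rw [red_one, mul_one]
  · change redCol k 4 = redCol k 3 * red 0
    rw [red_zero, mul_zero, h4]

theorem redCol_two_eq_zero {k : SO32 F} (hk : k ∈ maxCompact F) (h4 : redCol k 4 = 0)
    (h3 : redCol k 3 = 0) : redCol k 2 = 0 := by
  have hQ := Q_redCol hk
  rw [Q_self, h4, h3] at hQ
  simpa using hQ

theorem cell_third (hF : ringChar 𝓀[F] ≠ 2) {ϖ : Fˣ} (hϖ : IsUniformizer ϖ) {k : SO32 F}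
    (hk : k ∈ maxCompact F) (h4 : redCol k 4 = 0) (h3 : redCol k 3 = 0) (h1 : redCol k 1 ≠ 0) :
    ∃ b ∈ maxCompact F, (mat b).BlockTriangular id ∧ ∃ k' ∈ maxCompact F,
      k * torusElt ϖ = b * diagElt 1 ϖ⁻¹ * k' := by
  have h2 := redCol_two_eq_zero hk h4 h3
  obtain ⟨c, hc, ec⟩ := red_surjective (-(redCol k 0 / redCol k 1))
  have hb : unip 0 0 c ∈ maxCompact F := unip_mem (zero_mem _) (zero_mem _) hc
  refine ⟨_, hb, unip_blockTriangular _ _ _,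
    exists_weyl_decomposition hF hϖ hk hb (mul_mem swapPlanes_mem swapOuter_mem) (u := redCol k 1)
      (by rw [torusElt_eq_diagElt, mul_assoc, swapOuter_mul_diagElt, ← mul_assoc,
        swapPlanes_mul_diagElt, mul_assoc]) ?_⟩
  have e : (fun i => mat (unip 0 0 c * (swapPlanes F * swapOuter F)) i 4) = ![-c, 1, 0, 0, 0] := by
    rw [mat_mul_col, mat_mul_col, unip_mulVec, swapPlanes_mulVec, mat_swapOuter]
    ext i
    fin_cases i <;> simp
  funext i
  rw [Pi.smul_apply, redCol, redCol, e]
  change redCol k i = redCol k 1 * red (![-c, 1, 0, 0, 0] i)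
  fin_cases i
  · change redCol k 0 = redCol k 1 * red (-c)
    rw [red_neg hc, ec]
    field_simp
  · change redCol k 1 = redCol k 1 * red 1
    rw [red_one, mul_one]
  · change redCol k 2 = redCol k 1 * red 0
    rw [red_zero, mul_zero, h2]
  · change redCol k 3 = redCol k 1 * red 0
    rw [red_zero, mul_zero, h3]
  · change redCol k 4 = redCol k 1 * red 0
    rw [red_zero, mul_zero, h4]

theorem cell_closed (hF : ringChar 𝓀[F] ≠ 2) {ϖ : Fˣ} (hϖ : IsUniformizer ϖ) {k : SO32 F}
    (hk : k ∈ maxCompact F) (h4 : redCol k 4 = 0) (h3 : redCol k 3 = 0) (h1 : redCol k 1 = 0) :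
    ∃ b ∈ maxCompact F, (mat b).BlockTriangular id ∧ ∃ k' ∈ maxCompact F,
      k * torusElt ϖ = b * diagElt ϖ⁻¹ 1 * k' := by
  have h2 := redCol_two_eq_zero hk h4 h3
  refine ⟨1, one_mem _, Matrix.blockTriangular_one,
    exists_weyl_decomposition hF hϖ hk (one_mem _) swapOuter_mem (u := redCol k 0)
      (by rw [torusElt_eq_diagElt, swapOuter_mul_diagElt]) ?_⟩
  have e : (fun i => mat (1 * swapOuter F) i 4) = ![1, 0, 0, 0, 0] := by
    rw [one_mul, mat_swapOuter]
    ext i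
    fin_cases i <;> rfl
  funext i
  rw [Pi.smul_apply, redCol, redCol, e]
  change redCol k i = redCol k 0 * red (![1, 0, 0, 0, 0] i)
  fin_cases i
  · change redCol k 0 = redCol k 0 * red 1
    rw [red_one, mul_one]
  · change redCol k 1 = redCol k 0 * red 0
    rw [red_zero, mul_zero, h1]
  · change redCol k 2 = redCol k 0 * red 0
    rw [red_zero, mul_zero, h2]
  · change redCol k 3 = redCol k 0 * red 0
    rw [red_zero, mul_zero, h3]
  · change redCol k 4 = redCol k 0 * red 0
    rw [red_zero, mul_zero, h4]

end Cells

end SplitSO5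

end

noncomputable section

namespace SplitSO5

/-! ### Counting vectors of given length over a finite field. -/

section Counting

variable {k : Type*} [Field k]

/-- The vectors of length `c` with nonzero last coordinate. -/
def openCell (c : k) : Set (Fin 5 → k) := {x | Q x x = c ∧ x 4 ≠ 0}

/-- The vectors of length `c` with last coordinate zero. -/
def hyperCell (c : k) : Set (Fin 5 → k) := {x | Q x x = c ∧ x 4 = 0}

/-- The vectors of length `c` whose last nonzero coordinate is the fourth. -/
def secondCell (c : k) : Set (Fin 5 → k) := {x | Q x x = c ∧ x 4 = 0 ∧ x 3 ≠ 0}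

variable (k) in
/-- The vectors whose coordinates except the first two are zero, the second one not being zero. -/
def thirdCell : Set (Fin 5 → k) := {x | x 4 = 0 ∧ x 3 = 0 ∧ x 2 = 0 ∧ x 1 ≠ 0}

variable (k) in
/-- The nonzero multiples of the first basis vector. -/
def closedCell : Set (Fin 5 → k) := {x | x 4 = 0 ∧ x 3 = 0 ∧ x 2 = 0 ∧ x 1 = 0 ∧ x 0 ≠ 0}

/-- The vectors of length `c` whose last two coordinates are zero. -/
def rootCell (c : k) : Set (Fin 5 → k) := {x | x 4 = 0 ∧ x 3 = 0 ∧ x 2 ^ 2 = c}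

/-- A nonzero last coordinate makes the equation linear in the first one, so the three middle
coordinates are free. -/
theorem card_openCell [Finite k] (h2 : (2 : k) ≠ 0) (c : k) :
    Nat.card (openCell c) = (Nat.card k - 1) * Nat.card k ^ 3 := by
  let e : openCell c ≃ kˣ × k × k × k :=
    { toFun := fun x => (Units.mk0 (x.1 4) x.2.2, x.1 1, x.1 2, x.1 3)
      invFun := fun y => ⟨![(c - 2 * y.2.1 * y.2.2.2 - y.2.2.1 ^ 2) / (2 * y.1), y.2.1, y.2.2.1,
        y.2.2.2, y.1], by
          have h1 := y.1.ne_zero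
          rw [openCell, Set.mem_ofPred_eq, Q_self]
          refine ⟨?_, h1⟩
          simp
          field_simp
          ring⟩
      left_inv := fun x => by
        have h1 := x.2.2
        have h3 := x.2.1
        rw [Q_self] at h3
        apply Subtype.ext
        funext i
        fin_cases i
        · change (c - 2 * x.1 1 * x.1 3 - x.1 2 ^ 2) / (2 * x.1 4) = x.1 0
          rw [div_eq_iff (mul_ne_zero h2 h1)]
          linear_combination -h3
        all_goals rfl
      right_inv := fun y => by
        refine Prod.ext (Units.ext rfl) rfl }
  rw [Nat.card_congr e, Nat.card_prod, Nat.card_prod, Nat.card_prod, Nat.card_units]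
  ring

theorem card_secondCell [Finite k] (h2 : (2 : k) ≠ 0) (c : k) :
    Nat.card (secondCell c) = (Nat.card k - 1) * Nat.card k ^ 2 := by
  let e : secondCell c ≃ kˣ × k × k :=
    { toFun := fun x => (Units.mk0 (x.1 3) x.2.2.2, x.1 0, x.1 2)
      invFun := fun y => ⟨![y.2.1, (c - y.2.2 ^ 2) / (2 * y.1), y.2.2, y.1, 0], by
          have h1 := y.1.ne_zero
          rw [secondCell, Set.mem_ofPred_eq, Q_self]
          refine ⟨?_, rfl, h1⟩
          simp
          field_simp
          ring⟩
      left_inv := fun x => by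
        have h1 := x.2.2.2
        have h3 := x.2.1
        rw [Q_self, x.2.2.1] at h3
        apply Subtype.ext
        funext i
        fin_cases i
        · rfl
        · change (c - x.1 2 ^ 2) / (2 * x.1 3) = x.1 1
          rw [div_eq_iff (mul_ne_zero h2 h1)]
          linear_combination -h3
        · rfl
        · rfl
        · exact x.2.2.1.symm
      right_inv := fun y => by
        refine Prod.ext (Units.ext rfl) rfl }
  rw [Nat.card_congr e, Nat.card_prod, Nat.card_prod, Nat.card_units]
  ring

variable (k) in
theorem card_thirdCell [Finite k] :
    Nat.card (thirdCell k) = (Nat.card k - 1) * Nat.card k := by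
  let e : thirdCell k ≃ kˣ × k :=
    { toFun := fun x => (Units.mk0 (x.1 1) x.2.2.2.2, x.1 0)
      invFun := fun y => ⟨![y.2, y.1, 0, 0, 0], rfl, rfl, rfl, y.1.ne_zero⟩
      left_inv := fun x => by
        apply Subtype.ext
        funext i
        fin_cases i
        · rfl
        · rfl
        · exact x.2.2.2.1.symm
        · exact x.2.2.1.symm
        · exact x.2.1.symm
      right_inv := fun y => by
        refine Prod.ext (Units.ext rfl) rfl }
  rw [Nat.card_congr e, Nat.card_prod, Nat.card_units]

variable (k) in
theorem card_closedCell [Finite k] : Nat.card (closedCell k) = Nat.card k - 1 := by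
  let e : closedCell k ≃ kˣ :=
    { toFun := fun x => Units.mk0 (x.1 0) x.2.2.2.2.2
      invFun := fun y => ⟨![y, 0, 0, 0, 0], rfl, rfl, rfl, rfl, y.ne_zero⟩
      left_inv := fun x => by
        apply Subtype.ext
        funext i
        fin_cases i
        · rfl
        · exact x.2.2.2.2.1.symm
        · exact x.2.2.2.1.symm
        · exact x.2.2.1.symm
        · exact x.2.1.symm
      right_inv := fun y => Units.ext rfl }
  rw [Nat.card_congr e, Nat.card_units]

theorem card_rootCell (c : k) :
    Nat.card (rootCell c) = Nat.card k ^ 2 * Nat.card {y : k // y ^ 2 = c} := by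
  let e : rootCell c ≃ k × k × {y : k // y ^ 2 = c} :=
    { toFun := fun x => (x.1 0, x.1 1, ⟨x.1 2, x.2.2.2⟩)
      invFun := fun y => ⟨![y.1, y.2.1, y.2.2.1, 0, 0], rfl, rfl, y.2.2.2⟩
      left_inv := fun x => by
        apply Subtype.ext
        funext i
        fin_cases i
        · rfl
        · rfl
        · rfl
        · exact x.2.2.1.symm
        · exact x.2.1.symm
      right_inv := fun y => rfl }
  rw [Nat.card_congr e, Nat.card_prod, Nat.card_prod]
  ring

theorem card_sq_roots_of_not_isSquare {c : k} (hc : ¬ IsSquare c) :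
    Nat.card {y : k // y ^ 2 = c} = 0 := by
  have : IsEmpty {y : k // y ^ 2 = c} := ⟨fun y => hc ⟨y.1, (y.2.symm.trans (sq y.1))⟩⟩
  exact Nat.card_of_isEmpty

theorem card_sq_roots_one (h2 : (2 : k) ≠ 0) : Nat.card {y : k // y ^ 2 = 1} = 2 := by
  have h : {y : k | y ^ 2 = 1} = {1, -1} := by
    ext y
    simp
  have h1 : (1 : k) ≠ -1 := by
    intro e
    apply h2
    linear_combination e
  calc Nat.card {y : k // y ^ 2 = 1} = {y : k | y ^ 2 = 1}.ncard := rfl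
    _ = 2 := by rw [h, Set.ncard_pair h1]

theorem disjoint_openCell_hyperCell (c c' : k) : Disjoint (openCell c) (hyperCell c') :=
  Set.disjoint_left.2 fun _ hx hx' => hx.2 hx'.2

/-- If the fourth coordinate vanishes too, the equation becomes `x 2 ^ 2 = c`. Here alone the count
depends on whether `c` is a square. -/
theorem hyperCell_eq (c : k) : hyperCell c = secondCell c ∪ rootCell c := by
  ext x
  simp only [hyperCell, secondCell, rootCell, Set.mem_union, Set.mem_ofPred_eq, Q_self]
  constructor
  · rintro ⟨h, h4⟩
    by_cases h3 : x 3 = 0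
    · right
      refine ⟨h4, h3, ?_⟩
      rw [h4, h3] at h
      linear_combination h
    · exact Or.inl ⟨h, h4, h3⟩
  · rintro (⟨h, h4, -⟩ | ⟨h4, h3, h⟩)
    · exact ⟨h, h4⟩
    · refine ⟨?_, h4⟩
      rw [h4, h3]
      linear_combination h

theorem card_hyperCell [Finite k] (h2 : (2 : k) ≠ 0) (c : k) : Nat.card (hyperCell c) =
    (Nat.card k - 1) * Nat.card k ^ 2 + Nat.card k ^ 2 * Nat.card {y : k // y ^ 2 = c} := by
  have hd : Disjoint (secondCell c) (rootCell c) :=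
    Set.disjoint_left.2 fun _ hx hx' => hx.2.2 hx'.2.1
  have h := Set.ncard_union_eq hd (Set.toFinite _) (Set.toFinite _)
  rw [← hyperCell_eq] at h
  change Nat.card (hyperCell c) = Nat.card (secondCell c) + Nat.card (rootCell c) at h
  rw [h, card_secondCell h2, card_rootCell]

end Counting

end SplitSO5

end

noncomputable section

namespace SplitSO5

/-! ### Measures of fibres, and open fibres of reduction. -/

section Fibres

variable {Y V : Type*} [MeasurableSpace Y]

theorem measurableSet_inter_preimage {E : Set Y} {p : Y → V}
    (hm : ∀ v, MeasurableSet (E ∩ p ⁻¹' {v})) {A : Set V} (hA : A.Finite) :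
    MeasurableSet (E ∩ p ⁻¹' A) := by
  have h : E ∩ p ⁻¹' A = ⋃ v ∈ A, E ∩ p ⁻¹' {v} := by
    ext y
    simp
  rw [h]
  exact MeasurableSet.biUnion hA.countable fun v _ => hm v

/-- If the fibres over a finite set have equal measure, preimages are measured by counting. -/
theorem exists_measure_inter_preimage (μ : Measure Y) {E : Set Y} {p : Y → V}
    (hm : ∀ v, MeasurableSet (E ∩ p ⁻¹' {v})) {W : Set V} (hfinW : W.Finite)
    (hW : ∀ v ∈ W, ∀ w ∈ W, μ (E ∩ p ⁻¹' {v}) = μ (E ∩ p ⁻¹' {w})) :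
    ∃ c, ∀ A ⊆ W, μ (E ∩ p ⁻¹' A) = Nat.card A * c := by
  classical
  rcases W.eq_empty_or_nonempty with rfl | ⟨w, hw⟩
  · refine ⟨0, fun A hA => ?_⟩
    rw [Set.subset_empty_iff.1 hA]
    simp
  · refine ⟨μ (E ∩ p ⁻¹' {w}), fun A hA => ?_⟩
    have hfin := hfinW.subset hA
    have h : E ∩ p ⁻¹' A = ⋃ v ∈ hfin.toFinset, E ∩ p ⁻¹' {v} := by
      ext y
      simp
    rw [h, measure_biUnion_finset]
    · rw [Finset.sum_congr rfl fun v hv => hW v (hA (hfin.mem_toFinset.1 hv)) w hw,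
        Finset.sum_const, nsmul_eq_mul]
      congr 2
      exact (Nat.card_eq_card_finite_toFinset hfin).symm
    · intro v _ w _ hvw
      refine Set.disjoint_left.2 fun y hy hy' => hvw ?_
      exact hy.2.symm.trans hy'.2
    · exact fun v _ => hm v

/-- The integral of a function with finitely many values. -/
theorem setIntegral_of_partition {ι : Type*} [Fintype ι] (μ : Measure Y) {E : Set Y}
    {s : ι → Set Y} (hs : ∀ j, MeasurableSet (s j)) (hE : E = ⋃ j, s j)
    (hd : Pairwise (Function.onFun Disjoint s)) (hfin : μ E ≠ ⊤) {ψ : Y → ℂ} {a : ι → ℂ}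
    (ha : ∀ j, ∀ y ∈ s j, ψ y = a j) :
    IntegrableOn ψ E μ ∧ ∫ y in E, ψ y ∂μ = ∑ j, (μ.real (s j) : ℂ) * a j := by
  have hlt : ∀ j, μ (s j) ≠ ⊤ := fun j =>
    ne_top_of_le_ne_top hfin (measure_mono (hE ▸ Set.subset_iUnion s j))
  have hint : ∀ j, IntegrableOn ψ (s j) μ := fun j =>
    (integrableOn_const (hlt j)).congr_fun (fun y hy => (ha j y hy).symm) (hs j)
  subst hE
  refine ⟨integrableOn_finite_iUnion.2 hint, ?_⟩
  rw [integral_iUnion_fintype hs hd hint]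
  refine Finset.sum_congr rfl fun j _ => ?_
  rw [setIntegral_congr_fun (hs j) (ha j), setIntegral_const, Complex.real_smul]

end Fibres

section Openness

variable {F : Type*} [Field F] [ValuativeRel F] [TopologicalSpace F]
  [IsNonarchimedeanLocalField F]

theorem isOpen_redVec_fibre (x : Fin 5 → 𝓀[F]) :
    IsOpen {v : Fin 5 → F | (∀ i, v i ∈ 𝒪[F]) ∧ redVec v = x} := by
  have h : {v : Fin 5 → F | (∀ i, v i ∈ 𝒪[F]) ∧ redVec v = x} =
      ⋂ i, (fun v => v i) ⁻¹' {y : F | y ∈ 𝒪[F] ∧ red y = x i} := by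
    ext v
    simp only [Set.mem_ofPred_eq, Set.mem_iInter, Set.mem_preimage, forall_and]
    exact and_congr_right fun _ => funext_iff
  rw [h]
  exact isOpen_iInter_of_finite fun i => (isOpen_red_fibre (x i)).preimage (continuous_apply i)

theorem continuous_mat : Continuous fun g : SO32 F => mat g :=
  continuous_subtype_val.comp continuous_subtype_val

theorem continuous_mat_mulVec (v : Fin 5 → F) : Continuous fun g : SO32 F => mat g *ᵥ v :=
  continuous_mat.matrix_mulVec continuous_const

theorem isOpen_maxCompact_inter_fibre {v : Fin 5 → F} (hv : ∀ i, v i ∈ 𝒪[F]) (x : Fin 5 → 𝓀[F]) :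
    IsOpen ((maxCompact F : Set (SO32 F)) ∩ (fun g => redVec (mat g *ᵥ v)) ⁻¹' {x}) := by
  have h : (maxCompact F : Set (SO32 F)) ∩ (fun g => redVec (mat g *ᵥ v)) ⁻¹' {x} =
      (maxCompact F : Set (SO32 F)) ∩
        (fun g => mat g *ᵥ v) ⁻¹' {v : Fin 5 → F | (∀ i, v i ∈ 𝒪[F]) ∧ redVec v = x} := by
    ext g
    constructor
    · rintro ⟨h1, h2⟩
      exact ⟨h1, mulVec_mem h1 hv, h2⟩
    · rintro ⟨h1, h2⟩
      exact ⟨h1, h2.2⟩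
  rw [h]
  exact isOpen_maxCompact.inter ((isOpen_redVec_fibre x).preimage (continuous_mat_mulVec v))

theorem isOpen_level_inter_fibre (ϖ : Fˣ) (C : SphereCase F) (m : ℕ) (x : Fin 5 → 𝓀[F]) :
    IsOpen ({s : Sphere C | IsLevel ϖ m s} ∩
      (fun s => redVec ((ϖ : F) ^ m • s.1)) ⁻¹' {x}) := by
  -- A level requires a nonzero reduction, so the fibre over zero is empty; over other vectors the
  -- condition is automatic.
  by_cases hx : x = 0
  · convert isOpen_empty
    ext s
    simp only [Set.mem_inter_iff, Set.mem_ofPred_eq, Set.mem_preimage, Set.mem_singleton_iff,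
      Set.mem_empty_iff_false, iff_false]
    rintro ⟨h1, h2⟩
    exact h1.2 (h2.trans hx)
  · have h : {s : Sphere C | IsLevel ϖ m s} ∩ (fun s => redVec ((ϖ : F) ^ m • s.1)) ⁻¹' {x} =
        (fun s : Sphere C => (ϖ : F) ^ m • s.1) ⁻¹'
          {v : Fin 5 → F | (∀ i, v i ∈ 𝒪[F]) ∧ redVec v = x} := by
      ext s
      constructor
      · rintro ⟨h1, h2⟩
        exact ⟨h1.1, h2⟩
      · rintro ⟨h1, h2⟩
        exact ⟨⟨h1, fun h0 => hx (h2.symm.trans h0)⟩, h2⟩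
    rw [h]
    have hc : Continuous fun s : Sphere C => s.1 := continuous_subtype_val
    exact (isOpen_redVec_fibre x).preimage (hc.const_smul ((ϖ : F) ^ m))

end Openness

/-! ### Equidistribution of reductions. -/

section Equidistribution

variable {F : Type*} [Field F] [ValuativeRel F] [TopologicalSpace F]
  [IsNonarchimedeanLocalField F]

/-- The nonzero vectors of length `c`. -/
def quadric {k : Type*} [Field k] (c : k) : Set (Fin 5 → k) := {x | x ≠ 0 ∧ Q x x = c}

theorem Q_redMat_mulVec {k : SO32 F} (hk : k ∈ maxCompact F) (x : Fin 5 → 𝓀[F]) :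
    Q (redMat k *ᵥ x) (redMat k *ᵥ x) = Q x x := by
  obtain ⟨v, hv, rfl⟩ := exists_lift x
  rw [← redVec_mulVec hk hv, ← red_Q (mulVec_mem hk hv), Q_smul, red_Q hv]

theorem redVec_mulVec_mem_quadric {k : SO32 F} (hk : k ∈ maxCompact F) {v : Fin 5 → F}
    (hv : ∀ i, v i ∈ 𝒪[F]) (hv0 : redVec v ≠ 0) :
    redVec (mat k *ᵥ v) ∈ quadric (Q (redVec v) (redVec v)) := by
  rw [redVec_mulVec hk hv]
  refine ⟨fun h => hv0 (redMat_mulVec_injective hk ?_), Q_redMat_mulVec hk _⟩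
  rw [h, Matrix.mulVec_zero]

/-- The reduction of `k v`, for `k ∈ K` and a primitive vector `v`, is equidistributed. -/
theorem exists_measure_maxCompact (hF : ringChar 𝓀[F] ≠ 2) (dg : Measure (SO32 F))
    [dg.IsHaarMeasure] {v : Fin 5 → F} (hv : ∀ i, v i ∈ 𝒪[F]) (c : 𝓀[F]) :
    ∃ u, ∀ A ⊆ quadric c,
      dg ((maxCompact F : Set (SO32 F)) ∩ (fun g => redVec (mat g *ᵥ v)) ⁻¹' A)
        = Nat.card A * u := by
  refine exists_measure_inter_preimage dg
    (fun x => (isOpen_maxCompact_inter_fibre hv x).measurableSet) (Set.toFinite _) fun x hx y hy => ?_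
  -- Translation by an `l ∈ K` that carries one reduced vector to the other identifies the two
  -- fibres, and the measure is left invariant.
  obtain ⟨l, hl, hxy⟩ := redMat_transitive hF hy.1 hx.1 (hy.2.trans hx.2.symm)
  rw [← measure_preimage_mul dg l]
  congr 1
  ext g
  simp only [Set.mem_inter_iff, Set.mem_preimage, Set.mem_singleton_iff, SetLike.mem_coe]
  rw [(maxCompact F).mul_mem_cancel_left hl]
  refine and_congr_right fun hg => ?_
  rw [mat_mul_mulVec, redVec_mulVec hl (mulVec_mem hg hv), ← hxy]
  exact ⟨fun h => redMat_mulVec_injective hl h, fun h => by rw [h]⟩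

/-- The reduction of the vectors of given norm on the sphere is equidistributed. -/
theorem exists_measure_level (hF : ringChar 𝓀[F] ≠ 2) (ϖ : Fˣ) {C : SphereCase F}
    (ds : Measure (Sphere C)) [SMulInvariantMeasure (SO32 F) (Sphere C) ds] (m : ℕ) (c : 𝓀[F]) :
    ∃ u, ∀ A ⊆ quadric c,
      ds ({s : Sphere C | IsLevel ϖ m s} ∩ (fun s => redVec ((ϖ : F) ^ m • s.1)) ⁻¹' A)
        = Nat.card A * u := by
  refine exists_measure_inter_preimage ds
    (fun x => (isOpen_level_inter_fibre ϖ C m x).measurableSet) (Set.toFinite _) fun x hx y hy => ?_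
  obtain ⟨l, hl, hxy⟩ := redMat_transitive hF hy.1 hx.1 (hy.2.trans hx.2.symm)
  rw [← measure_preimage_smul ds l]
  congr 1
  ext s
  simp only [Set.mem_inter_iff, Set.mem_preimage, Set.mem_singleton_iff, Set.mem_ofPred_eq]
  constructor
  · rintro ⟨h1, h2⟩
    have h3 : IsLevel ϖ m s := by
      have := h1.smul (inv_mem hl)
      rwa [inv_smul_smul] at this
    refine ⟨h3, redMat_mulVec_injective hl ?_⟩
    rw [← redVec_smul hl h3, h2, hxy]
  · rintro ⟨h1, h2⟩
    refine ⟨h1.smul hl, ?_⟩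
    rw [redVec_smul hl h1, h2, hxy]

end Equidistribution

end SplitSO5

end

noncomputable section

namespace SplitSO5

/-! ### Compactness of `K` and the Hecke operator of `K d K`. -/

section Hecke

variable {F : Type*} [Field F] [ValuativeRel F] [TopologicalSpace F]
  [IsNonarchimedeanLocalField F]

/-- This transfers compactness: `K` is the preimage of the compact set of integral matrices. -/
theorem isClosedEmbedding_mat : Topology.IsClosedEmbedding fun g : SO32 F => mat g := by
  have h1 : Topology.IsEmbedding fun g : SO32 F => mat g :=
    Topology.IsEmbedding.subtypeVal.comp Topology.IsEmbedding.subtypeVal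
  refine ⟨h1, ?_⟩
  have h2 : Set.range (fun g : SO32 F => mat g) =
      {M | M.det = 1} ∩ {M | Mᵀ * J F * M = J F} := by
    ext M
    constructor
    · rintro ⟨g, rfl⟩
      exact ⟨g.1.2, g.2⟩
    · rintro ⟨h1, h2⟩
      exact ⟨ofMat M h1 h2, rfl⟩
  have : T2Space (Matrix (Fin 5) (Fin 5) F) := inferInstanceAs (T2Space (Fin 5 → Fin 5 → F))
  rw [h2]
  refine (isClosed_eq ?_ continuous_const).inter (isClosed_eq ?_ continuous_const)
  · exact continuous_id.matrix_det
  · exact (continuous_id.matrix_transpose.matrix_mul continuous_const).matrix_mul continuous_id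

instance : T2Space (SO32 F) := by
  have : T2Space (Matrix (Fin 5) (Fin 5) F) := inferInstanceAs (T2Space (Fin 5 → Fin 5 → F))
  exact isClosedEmbedding_mat.isEmbedding.t2Space

theorem isCompact_maxCompact : IsCompact (maxCompact F : Set (SO32 F)) := by
  have h1 : IsCompact (𝒪[F] : Set F) := IsNonarchimedeanLocalField.isCompact_closedBall F 1
  have h2 : IsCompact (Set.pi Set.univ fun _ : Fin 5 => Set.pi Set.univ fun _ : Fin 5 =>
      (𝒪[F] : Set F)) := isCompact_univ_pi fun _ => isCompact_univ_pi fun _ => h1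
  have h3 := isClosedEmbedding_mat.isCompact_preimage h2
  convert h3
  ext g
  rw [SetLike.mem_coe, mem_maxCompact_iff]
  exact ⟨fun h i _ j _ => h i j, fun h i j => h i trivial j trivial⟩

/-- The double coset of `diag(ϖ, 1, 1, 1, ϖ⁻¹)`. -/
def doubleCoset (ϖ : Fˣ) : Set (SO32 F) :=
  {g | ∃ k ∈ maxCompact F, ∃ k' ∈ maxCompact F, g = k * torusElt ϖ * k'}

theorem mul_mem_doubleCoset_iff {ϖ : Fˣ} {k k' g : SO32 F} (hk : k ∈ maxCompact F)
    (hk' : k' ∈ maxCompact F) : k * g * k' ∈ doubleCoset ϖ ↔ g ∈ doubleCoset ϖ := by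
  constructor
  · rintro ⟨l, hl, l', hl', h⟩
    refine ⟨k⁻¹ * l, mul_mem (inv_mem hk) hl, l' * k'⁻¹, mul_mem hl' (inv_mem hk'), ?_⟩
    calc g = k⁻¹ * (k * g * k') * k'⁻¹ := by group
      _ = _ := by rw [h]; group
  · rintro ⟨l, hl, l', hl', rfl⟩
    exact ⟨k * l, mul_mem hk hl, l' * k', mul_mem hl' hk', by group⟩

theorem isCompact_doubleCoset (ϖ : Fˣ) : IsCompact (doubleCoset ϖ) := by
  have h := (isCompact_maxCompact (F := F)).prod (isCompact_maxCompact (F := F))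
  have h1 := h.image (f := fun p : SO32 F × SO32 F => p.1 * torusElt ϖ * p.2) (by fun_prop)
  convert h1
  ext g
  constructor
  · rintro ⟨k, hk, k', hk', rfl⟩
    exact ⟨(k, k'), ⟨hk, hk'⟩, rfl⟩
  · rintro ⟨⟨k, k'⟩, ⟨hk, hk'⟩, rfl⟩
    exact ⟨k, hk, k', hk', rfl⟩

/-- A function which is left invariant under `K` is locally constant. -/
theorem isLocallyConstant_of_left_invariant {X : Type*} {ψ : SO32 F → X}
    (h : ∀ k ∈ maxCompact F, ∀ g, ψ (k * g) = ψ g) : IsLocallyConstant ψ := by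
  rw [IsLocallyConstant.iff_exists_open]
  intro g
  refine ⟨(fun x => x * g⁻¹) ⁻¹' (maxCompact F : Set (SO32 F)),
    isOpen_maxCompact.preimage (continuous_mul_const _), by simp [one_mem], fun x hx => ?_⟩
  rw [← h _ hx g, inv_mul_cancel_right]

/-- A function which is right invariant under `K` is locally constant. -/
theorem isLocallyConstant_of_right_invariant {X : Type*} {ψ : SO32 F → X}
    (h : ∀ k ∈ maxCompact F, ∀ g, ψ (g * k) = ψ g) : IsLocallyConstant ψ := by
  rw [IsLocallyConstant.iff_exists_open]
  intro g
  refine ⟨(fun x => g⁻¹ * x) ⁻¹' (maxCompact F : Set (SO32 F)),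
    isOpen_maxCompact.preimage (continuous_const_mul _), by simp [one_mem], fun x hx => ?_⟩
  rw [← h _ hx g, mul_inv_cancel_left]

/-- The characteristic function of the double coset. -/
def heckeFun (ϖ : Fˣ) : SO32 F → ℂ := (doubleCoset ϖ).indicator fun _ => 1

theorem heckeFun_biinvariant (ϖ : Fˣ) {k k' : SO32 F} (hk : k ∈ maxCompact F)
    (hk' : k' ∈ maxCompact F) (g : SO32 F) : heckeFun ϖ (k * g * k') = heckeFun ϖ g := by
  classical
  rw [heckeFun, Set.indicator_apply, Set.indicator_apply]
  simp only [mul_mem_doubleCoset_iff hk hk']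

theorem isSpherical_heckeFun (ϖ : Fˣ) : IsSpherical (heckeFun (F := F) ϖ) where
  locallyConstant := isLocallyConstant_of_left_invariant fun k hk g => by
    simpa using heckeFun_biinvariant ϖ hk (one_mem _) g
  compactSupport := HasCompactSupport.intro (isCompact_doubleCoset ϖ) fun _ hx =>
    Set.indicator_of_notMem hx _
  biinvariant _ hk _ hk' g := heckeFun_biinvariant ϖ hk hk' g

theorem integral_heckeFun_mul (ϖ : Fˣ) (dg : Measure (SO32 F)) (ψ : SO32 F → ℂ) :
    ∫ g, heckeFun ϖ g * ψ g ∂dg = ∫ g in doubleCoset ϖ, ψ g ∂dg := by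
  rw [← integral_indicator (isCompact_doubleCoset ϖ).measurableSet]
  congr 1
  ext g
  by_cases hg : g ∈ doubleCoset ϖ <;> simp [heckeFun, hg]

/-- The left cosets of `K` in the double coset. -/
def cosets (ϖ : Fˣ) : Set (SO32 F ⧸ maxCompact F) :=
  {c | ∃ k ∈ maxCompact F, ((k * torusElt ϖ : SO32 F) : SO32 F ⧸ maxCompact F) = c}

theorem mk_eq_of_redCol (hF : ringChar 𝓀[F] ≠ 2) {ϖ : Fˣ} (hϖ : IsUniformizer ϖ) {k l : SO32 F}
    (hk : k ∈ maxCompact F) (hl : l ∈ maxCompact F) (h : redCol k = redCol l) :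
    ((k * torusElt ϖ : SO32 F) : SO32 F ⧸ maxCompact F) = (l * torusElt ϖ : SO32 F) := by
  obtain ⟨k', hk', e⟩ := coset_eq_of_redCol hF hϖ hk hl (u := 1) (by rw [h, one_smul])
  rw [e]
  exact QuotientGroup.mk_mul_of_mem _ hk'

/-- A coset is determined by the reduced last column of a representative, and there are finitely
many such columns. -/
theorem finite_cosets (hF : ringChar 𝓀[F] ≠ 2) {ϖ : Fˣ} (hϖ : IsUniformizer ϖ) :
    (cosets (F := F) ϖ).Finite := by
  have h : ∀ c : cosets (F := F) ϖ, ∃ k ∈ maxCompact F,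
    ((k * torusElt ϖ : SO32 F) : SO32 F ⧸ maxCompact F) = c.1 := fun c => c.2
  choose r hr hrc using h
  refine Set.finite_coe_iff.1 ?_
  exact Finite.of_injective (fun c => redCol (r c)) fun c c' hcc => Subtype.ext (by
    rw [← hrc c, ← hrc c']
    exact mk_eq_of_redCol hF hϖ (hr c) (hr c') hcc)

theorem mem_doubleCoset_iff {ϖ : Fˣ} {g : SO32 F} :
    g ∈ doubleCoset ϖ ↔ (g : SO32 F ⧸ maxCompact F) ∈ cosets ϖ := by
  constructor
  · rintro ⟨k, hk, k', hk', rfl⟩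
    exact ⟨k, hk, (QuotientGroup.mk_mul_of_mem _ hk').symm⟩
  · rintro ⟨k, hk, h⟩
    exact ⟨k, hk, _, QuotientGroup.eq.1 h, by group⟩

theorem isOpen_coset (c : SO32 F ⧸ maxCompact F) :
    IsOpen {g : SO32 F | (g : SO32 F ⧸ maxCompact F) = c} := by
  obtain ⟨a, rfl⟩ := QuotientGroup.mk_surjective c
  have h : {g : SO32 F | (g : SO32 F ⧸ maxCompact F) = a} =
      (fun g => a⁻¹ * g) ⁻¹' (maxCompact F : Set (SO32 F)) := by
    ext g
    exact eq_comm.trans QuotientGroup.eq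
  rw [h]
  exact isOpen_maxCompact.preimage (continuous_const_mul _)

theorem setIntegral_coset (dg : Measure (SO32 F)) [dg.IsHaarMeasure] (ψ : SO32 F → ℂ)
    (a : SO32 F) : ∫ g in {g : SO32 F | (g : SO32 F ⧸ maxCompact F) = a}, ψ g ∂dg =
      ∫ g in (maxCompact F : Set (SO32 F)), ψ (a * g) ∂dg := by
  rw [← integral_indicator (isOpen_coset _).measurableSet,
    ← integral_indicator isOpen_maxCompact.measurableSet,
    ← integral_mul_left_eq_self _ a]
  congr 1
  ext g
  have h : a * g ∈ {g : SO32 F | (g : SO32 F ⧸ maxCompact F) = a} ↔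
      g ∈ (maxCompact F : Set (SO32 F)) := by
    rw [Set.mem_ofPred_eq, eq_comm, QuotientGroup.eq, inv_mul_cancel_left]
    rfl
  by_cases hg : g ∈ (maxCompact F : Set (SO32 F))
  · rw [Set.indicator_of_mem hg, Set.indicator_of_mem (h.2 hg)]
  · rw [Set.indicator_of_notMem hg, Set.indicator_of_notMem (mt h.1 hg)]

theorem setIntegral_doubleCoset {ϖ : Fˣ} (dg : Measure (SO32 F)) [dg.IsHaarMeasure] [Fintype (cosets (F := F) ϖ)]
    {ψ : SO32 F → ℂ} (hψ : Continuous ψ) {r : cosets (F := F) ϖ → SO32 F}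
    (hr : ∀ c, ((r c : SO32 F) : SO32 F ⧸ maxCompact F) = c.1) :
    ∫ g in doubleCoset ϖ, ψ g ∂dg =
      ∑ c, ∫ g in (maxCompact F : Set (SO32 F)), ψ (r c * g) ∂dg := by
  have hU : doubleCoset ϖ = ⋃ c : cosets (F := F) ϖ,
      {g : SO32 F | (g : SO32 F ⧸ maxCompact F) = c.1} := by
    ext g
    rw [mem_doubleCoset_iff]
    simp
  have hi := hψ.continuousOn.integrableOn_compact (μ := dg) (isCompact_doubleCoset ϖ)
  rw [hU, integral_iUnion_fintype]
  · refine Finset.sum_congr rfl fun c _ => ?_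
    rw [← setIntegral_coset, hr]
  · exact fun c => (isOpen_coset _).measurableSet
  · intro c c' hcc
    refine Set.disjoint_left.2 fun g hg hg' => hcc (Subtype.ext ?_)
    exact hg.symm.trans hg'
  · intro c
    refine hi.mono_set ?_
    rw [hU]
    exact Set.subset_iUnion (fun c : cosets (F := F) ϖ =>
      {g : SO32 F | (g : SO32 F ⧸ maxCompact F) = c.1}) c

/-- Representatives have the form `k d`; left invariance removes `k`, so all cosets contribute the
same integral over `K`. -/
theorem integral_heckeFun_left_invariant (hF : ringChar 𝓀[F] ≠ 2) {ϖ : Fˣ}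
    (hϖ : IsUniformizer ϖ) (dg : Measure (SO32 F)) [dg.IsHaarMeasure] {ψ : SO32 F → ℂ}
    (hψ : ∀ k ∈ maxCompact F, ∀ g, ψ (k * g) = ψ g) :
    ∫ g, heckeFun ϖ g * ψ g ∂dg = Nat.card (cosets (F := F) ϖ) *
      ∫ g in (maxCompact F : Set (SO32 F)), ψ (torusElt ϖ * g) ∂dg := by
  have := (finite_cosets hF hϖ).fintype
  have h : ∀ c : cosets (F := F) ϖ, ∃ k ∈ maxCompact F,
    ((k * torusElt ϖ : SO32 F) : SO32 F ⧸ maxCompact F) = c.1 := fun c => c.2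
  choose r hr hrc using h
  rw [integral_heckeFun_mul, setIntegral_doubleCoset dg
    (isLocallyConstant_of_left_invariant hψ).continuous hrc]
  simp only [mul_assoc, hψ _ (hr _), Finset.sum_const, nsmul_eq_mul, Nat.card_eq_fintype_card,
    Finset.card_univ]

/-- The integral is the sum of `ψ` over the cosets. Since `K` permutes them transitively, the cosets
`k d K` are equidistributed for `k ∈ K`, and the sum is their number times a mean over `K`. -/
theorem integral_heckeFun_right_invariant (hF : ringChar 𝓀[F] ≠ 2) {ϖ : Fˣ}
    (hϖ : IsUniformizer ϖ) (dg : Measure (SO32 F)) [dg.IsHaarMeasure]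
    (hdg : dg (maxCompact F : Set (SO32 F)) = 1) {ψ : SO32 F → ℂ}
    (hψ : ∀ k ∈ maxCompact F, ∀ g, ψ (g * k) = ψ g) :
    ∫ g, heckeFun ϖ g * ψ g ∂dg = Nat.card (cosets (F := F) ϖ) *
      ∫ g in (maxCompact F : Set (SO32 F)), ψ (g * torusElt ϖ) ∂dg := by
  have hfin := finite_cosets (F := F) hF hϖ
  have := hfin.fintype
  have h : ∀ c : cosets (F := F) ϖ, ∃ k ∈ maxCompact F,
    ((k * torusElt ϖ : SO32 F) : SO32 F ⧸ maxCompact F) = c.1 := fun c => c.2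
  choose r hr hrc using h
  set p : SO32 F → SO32 F ⧸ maxCompact F := fun k => (k * torusElt ϖ : SO32 F) with hp
  have hm : ∀ v, MeasurableSet ((maxCompact F : Set (SO32 F)) ∩ p ⁻¹' {v}) := fun v =>
    (isOpen_maxCompact.inter ((isOpen_coset v).preimage
      (continuous_mul_const (torusElt ϖ)))).measurableSet
  obtain ⟨u, hu⟩ := exists_measure_inter_preimage dg hm hfin (by
    rintro _ ⟨k, hk, rfl⟩ _ ⟨l, hl, rfl⟩
    have hlk : l * k⁻¹ ∈ maxCompact F := mul_mem hl (inv_mem hk)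
    rw [← measure_preimage_mul dg (l * k⁻¹)
      ((maxCompact F : Set (SO32 F)) ∩ p ⁻¹' {((l * torusElt ϖ : SO32 F) : SO32 F ⧸ maxCompact F)})]
    congr 1
    ext g
    simp only [Set.mem_inter_iff, Set.mem_preimage, Set.mem_singleton_iff, SetLike.mem_coe, hp]
    rw [(maxCompact F).mul_mem_cancel_left hlk, QuotientGroup.eq, QuotientGroup.eq]
    have e : (l * k⁻¹ * g * torusElt ϖ)⁻¹ * (l * torusElt ϖ)
        = (g * torusElt ϖ)⁻¹ * (k * torusElt ϖ) := by group
    rw [e])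
  have hcover : (maxCompact F : Set (SO32 F)) =
      ⋃ c : cosets (F := F) ϖ, (maxCompact F : Set (SO32 F)) ∩ p ⁻¹' {c.1} := by
    ext k
    simp only [Set.mem_iUnion, Set.mem_inter_iff, Set.mem_preimage, Set.mem_singleton_iff,
      exists_and_left, iff_self_and]
    exact fun hk => ⟨⟨p k, k, hk, rfl⟩, rfl⟩
  have hone := hu (cosets ϖ) subset_rfl
  have hall : (maxCompact F : Set (SO32 F)) ∩ p ⁻¹' (cosets ϖ) = maxCompact F :=
    Set.inter_eq_left.2 fun k hk => ⟨k, hk, rfl⟩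
  rw [hall, hdg] at hone
  have hsum := (setIntegral_of_partition dg (fun c : cosets (F := F) ϖ => hm c.1) hcover (by
      intro c c' hcc
      refine Set.disjoint_left.2 fun g hg hg' => hcc (Subtype.ext ?_)
      exact hg.2.symm.trans hg'.2) (by rw [hdg]; exact ENNReal.one_ne_top)
    (ψ := fun g => ψ (g * torusElt ϖ)) (a := fun c => ψ (r c * torusElt ϖ)) (by
      rintro c k ⟨-, hk⟩
      have e : ((r c * torusElt ϖ : SO32 F) : SO32 F ⧸ maxCompact F) = (k * torusElt ϖ : SO32 F) :=
        (hrc c).trans hk.symm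
      have h1 := hψ _ (QuotientGroup.eq.1 e) (r c * torusElt ϖ)
      rwa [mul_inv_cancel_left] at h1)).2
  have hmeas : ∀ c : cosets (F := F) ϖ,
      dg.real ((maxCompact F : Set (SO32 F)) ∩ p ⁻¹' {c.1}) = u.toReal := by
    intro c
    have h1 := hu {c.1} (Set.singleton_subset_iff.2 c.2)
    rw [Nat.card_unique, Nat.cast_one, one_mul] at h1
    rw [Measure.real, h1]
  -- The total mass of `K` is one, so each coset corresponds to the share `1 / card` of `K`.
  have hone' : (Nat.card (cosets (F := F) ϖ) : ℝ) * u.toReal = 1 := by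
    have h1 := congrArg ENNReal.toReal hone
    rw [ENNReal.toReal_mul, ENNReal.toReal_one, ENNReal.toReal_natCast] at h1
    exact h1.symm
  rw [integral_heckeFun_mul, setIntegral_doubleCoset dg
    (isLocallyConstant_of_right_invariant hψ).continuous hrc, hsum]
  simp only [hmeas]
  rw [← Finset.mul_sum, ← mul_assoc]
  have hone'' : (Nat.card (cosets (F := F) ϖ) : ℂ) * (u.toReal : ℂ) = 1 := by
    exact_mod_cast hone'
  rw [hone'', one_mul]
  refine Finset.sum_congr rfl fun c _ => ?_
  rw [setIntegral_congr_fun isOpen_maxCompact.measurableSet fun g hg => hψ g hg (r c * torusElt ϖ),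
    setIntegral_const, Measure.real, hdg, ENNReal.toReal_one, one_smul]

theorem card_cosets_ne_zero (hF : ringChar 𝓀[F] ≠ 2) {ϖ : Fˣ} (hϖ : IsUniformizer ϖ) :
    (Nat.card (cosets (F := F) ϖ) : ℂ) ≠ 0 := by
  have := (finite_cosets (F := F) hF hϖ).to_subtype
  have : Nonempty (cosets (F := F) ϖ) := ⟨⟨_, 1, one_mem _, rfl⟩⟩
  exact_mod_cast Nat.card_pos.ne'

end Hecke

end SplitSO5

end

noncomputable section

namespace SplitSO5

/-! ### The character of the Borel subgroup. -/

section BorelCharacter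

variable {F : Type*} [Field F] [ValuativeRel F] [TopologicalSpace F]
  [IsNonarchimedeanLocalField F]

theorem blockTriangular_inv {b : SO32 F} (hb : (mat b).BlockTriangular id) :
    (mat b⁻¹).BlockTriangular id := by
  intro i j hij
  rw [mat_inv_apply]
  exact hb (Fin.rev_lt_rev.2 hij)

theorem blockTriangular_mul {b c : SO32 F} (hb : (mat b).BlockTriangular id)
    (hc : (mat c).BlockTriangular id) : (mat (b * c)).BlockTriangular id := by
  rw [mat_mul]
  exact hb.mul hc

theorem mat_mul_diag {b c : SO32 F} (hb : (mat b).BlockTriangular id)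
    (hc : (mat c).BlockTriangular id) (i : Fin 5) :
    mat (b * c) i i = mat b i i * mat c i i := by
  rw [mat_mul, Matrix.mul_apply]
  refine Finset.sum_eq_single i (fun j _ hj => ?_) (fun h => absurd (Finset.mem_univ i) h)
  rcases lt_or_gt_of_ne hj with h | h
  · rw [hb h, zero_mul]
  · rw [hc h, mul_zero]

theorem mat_diag_mul_inv {b : SO32 F} (hb : (mat b).BlockTriangular id) (i : Fin 5) :
    mat b i i * mat b⁻¹ i i = 1 := by
  rw [← mat_mul_diag hb (blockTriangular_inv hb), mul_inv_cancel, mat_one, Matrix.one_apply_eq]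

theorem mat_diag_ne_zero {b : SO32 F} (hb : (mat b).BlockTriangular id) (i : Fin 5) :
    mat b i i ≠ 0 := left_ne_zero_of_mul_eq_one (mat_diag_mul_inv hb i)

theorem nabs_div (x y : F) : nabs (x / y) = nabs x / nabs y := by
  rw [div_eq_mul_inv, nabs_mul, nabs_inv, div_eq_mul_inv]

/-- Complex powers are multiplicative here because the bases are positive reals, the diagonal
entries of a triangular element being nonzero. -/
theorem borelChar_mul (ζ ζ' : ℂ) {b c : SO32 F} (hb : (mat b).BlockTriangular id)
    (hc : (mat c).BlockTriangular id) :
    borelChar ζ ζ' (b * c) = borelChar ζ ζ' b * borelChar ζ ζ' c := by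
  have key : ∀ (x y : ℝ) (s : ℂ), 0 < x → 0 < y →
      (((x * y : ℝ) : ℂ)) ^ s = (x : ℂ) ^ s * (y : ℂ) ^ s := by
    intro x y s hx hy
    rw [Complex.ofReal_mul, Complex.mul_cpow_ofReal_nonneg hx.le hy.le]
  have p : ∀ {b : SO32 F}, (mat b).BlockTriangular id → ∀ i, 0 < nabs (mat b i i) :=
    fun hb i => nabs_pos (mat_diag_ne_zero hb i)
  have b0 := p hb 0
  have b1 := p hb 1
  have c0 := p hc 0
  have c1 := p hc 1
  unfold borelChar
  rw [mat_mul_diag hb hc, mat_mul_diag hb hc]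
  simp only [nabs_mul, nabs_div]
  have e1 : (nabs (mat b 0 0) * nabs (mat c 0 0)) ^ 3 * (nabs (mat b 1 1) * nabs (mat c 1 1)) =
      (nabs (mat b 0 0) ^ 3 * nabs (mat b 1 1)) * (nabs (mat c 0 0) ^ 3 * nabs (mat c 1 1)) := by
    ring
  have e2 : nabs (mat b 0 0) * nabs (mat c 0 0) / (nabs (mat b 1 1) * nabs (mat c 1 1)) =
      (nabs (mat b 0 0) / nabs (mat b 1 1)) * (nabs (mat c 0 0) / nabs (mat c 1 1)) := by
    field_simp
  rw [e1, e2, key (nabs (mat b 0 0) ^ 3 * nabs (mat b 1 1)) _ _ (by positivity) (by positivity),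
    key (nabs (mat b 0 0) / nabs (mat b 1 1)) _ _ (by positivity) (by positivity),
    key (nabs (mat b 1 1)) _ _ (by positivity) (by positivity)]
  ring

/-- The diagonal entries of `b` and `b⁻¹` are integral and mutually inverse, hence units. This makes
`sphVec` independent of the chosen Iwasawa decomposition. -/
theorem borelChar_of_mem (ζ ζ' : ℂ) {b : SO32 F} (hb : (mat b).BlockTriangular id)
    (hk : b ∈ maxCompact F) : borelChar ζ ζ' b = 1 := by
  have h1 : ∀ i, nabs (mat b i i) = 1 := by
    intro i
    refine nabs_of_valuation_one ?_
    have h := mat_diag_mul_inv hb i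
    have m1 := (mem_maxCompact_iff b).1 hk i i
    have m2 := (mem_maxCompact_iff _).1 (inv_mem hk) i i
    refine (red_ne_zero_iff m1).1 fun h0 => ?_
    have h2 := congrArg red h
    rw [red_mul m1 m2, h0, zero_mul, red_one] at h2
    exact zero_ne_one h2
  unfold borelChar
  simp [nabs_div, h1]

end BorelCharacter

/-! ### The spherical vector and the Satake transform as its eigenvalue. -/

section SphericalVector

variable {F : Type*} [Field F] [ValuativeRel F] [TopologicalSpace F]
  [IsNonarchimedeanLocalField F]

/-- The Iwasawa decomposition `G = B K`. -/
theorem exists_iwasawa (hF : ringChar 𝓀[F] ≠ 2) (g : SO32 F) :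
    ∃ b : SO32 F, (mat b).BlockTriangular id ∧ b⁻¹ * g ∈ maxCompact F := by
  obtain ⟨k, hk, h⟩ := exists_mul_upper hF g⁻¹
  refine ⟨(k * g⁻¹)⁻¹, blockTriangular_inv h, ?_⟩
  rw [inv_inv, inv_mul_cancel_right]
  exact hk

/-- The spherical vector of the induced representation with value `1` at `1`. -/
def sphVec (hF : ringChar 𝓀[F] ≠ 2) (ζ ζ' : ℂ) (g : SO32 F) : ℂ :=
  borelChar ζ ζ' (exists_iwasawa hF g).choose

theorem sphVec_eq (hF : ringChar 𝓀[F] ≠ 2) (ζ ζ' : ℂ) {g b : SO32 F}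
    (hb : (mat b).BlockTriangular id) (hk : b⁻¹ * g ∈ maxCompact F) :
    sphVec hF ζ ζ' g = borelChar ζ ζ' b := by
  obtain ⟨hc, hl⟩ := (exists_iwasawa hF g).choose_spec
  set c := (exists_iwasawa hF g).choose with hcdef
  have h1 : c = b * (b⁻¹ * c) := by group
  have h2 : b⁻¹ * c ∈ maxCompact F := by
    have e : b⁻¹ * c = b⁻¹ * g * (c⁻¹ * g)⁻¹ := by group
    rw [e]
    exact mul_mem hk (inv_mem hl)
  have h3 := blockTriangular_mul (blockTriangular_inv hb) hc
  change borelChar ζ ζ' c = _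
  rw [h1, borelChar_mul ζ ζ' hb h3, borelChar_of_mem ζ ζ' h3 h2, mul_one]

theorem sphVec_mul_right (hF : ringChar 𝓀[F] ≠ 2) (ζ ζ' : ℂ) {k : SO32 F}
    (hk : k ∈ maxCompact F) (g : SO32 F) : sphVec hF ζ ζ' (g * k) = sphVec hF ζ ζ' g := by
  obtain ⟨b, hb, h⟩ := exists_iwasawa hF g
  rw [sphVec_eq hF ζ ζ' hb h]
  refine sphVec_eq hF ζ ζ' hb ?_
  rw [← mul_assoc]
  exact mul_mem h hk

theorem sphVec_mul_left (hF : ringChar 𝓀[F] ≠ 2) (ζ ζ' : ℂ) {b : SO32 F}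
    (hb : (mat b).BlockTriangular id) (g : SO32 F) :
    sphVec hF ζ ζ' (b * g) = borelChar ζ ζ' b * sphVec hF ζ ζ' g := by
  obtain ⟨c, hc, h⟩ := exists_iwasawa hF g
  rw [sphVec_eq hF ζ ζ' hc h, ← borelChar_mul ζ ζ' hb hc]
  refine sphVec_eq hF ζ ζ' (blockTriangular_mul hb hc) ?_
  have e : (b * c)⁻¹ * (b * g) = c⁻¹ * g := by group
  rwa [e]

theorem sphVec_one (hF : ringChar 𝓀[F] ≠ 2) (ζ ζ' : ℂ) : sphVec (F := F) hF ζ ζ' 1 = 1 := by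
  have h1 : (mat (1 : SO32 F)).BlockTriangular id := Matrix.blockTriangular_one
  rw [sphVec_eq hF ζ ζ' h1 (by simp [one_mem]), borelChar_of_mem ζ ζ' h1 (one_mem _)]

theorem sphVec_mem (hF : ringChar 𝓀[F] ≠ 2) (ζ ζ' : ℂ) :
    sphVec hF ζ ζ' ∈ inducedSpace F ζ ζ' :=
  ⟨isLocallyConstant_of_right_invariant fun _ hk g => sphVec_mul_right hF ζ ζ' hk g,
    fun _ g hb => sphVec_mul_left hF ζ ζ' hb g⟩

/-- By the Iwasawa decomposition the `K`-fixed vectors form a line; the image of every `π(f)` lies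
in it. -/
theorem eq_smul_sphVec (hF : ringChar 𝓀[F] ≠ 2) {ζ ζ' : ℂ} {φ : SO32 F → ℂ}
    (hφ : φ ∈ inducedSpace F ζ ζ') (hK : ∀ k ∈ maxCompact F, ∀ g, φ (g * k) = φ g) :
    φ = φ 1 • sphVec hF ζ ζ' := by
  ext g
  obtain ⟨b, hb, h⟩ := exists_iwasawa hF g
  have h1 : φ g = φ (b * 1) := by
    rw [← hK _ h (b * 1)]
    congr 1
    group
  rw [h1, hφ.2 b 1 hb, Pi.smul_apply, sphVec_eq hF ζ ζ' hb h, smul_eq_mul, mul_comm]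

theorem heckeOp_apply (dg : Measure (SO32 F)) [dg.IsHaarMeasure] {f : SO32 F → ℂ}
    (hf : IsSpherical f) (ζ ζ' : ℂ) (φ : inducedSpace F ζ ζ') (h : SO32 F) :
    (heckeOp dg hf ζ ζ' φ).1 h = ∫ g, f g * φ.1 (h * g) ∂dg := rfl

theorem heckeOp_mul_right (dg : Measure (SO32 F)) [dg.IsHaarMeasure] {f : SO32 F → ℂ}
    (hf : IsSpherical f) (ζ ζ' : ℂ) (φ : inducedSpace F ζ ζ') {k : SO32 F}
    (hk : k ∈ maxCompact F) (h : SO32 F) :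
    (heckeOp dg hf ζ ζ' φ).1 (h * k) = (heckeOp dg hf ζ ζ' φ).1 h := by
  rw [heckeOp_apply, heckeOp_apply, ← integral_mul_left_eq_self (fun g => f g * φ.1 (h * g)) k]
  congr 1
  ext g
  have h1 := hf.biinvariant k hk 1 (one_mem _) g
  rw [mul_one] at h1
  rw [h1, mul_assoc]

theorem finiteRankTrace_of_range_le {V : Type*} [AddCommGroup V] [Module ℂ V] {A : V →ₗ[ℂ] V}
    {v : V} (hv : v ≠ 0) (hA : ∀ w, ∃ c : ℂ, A w = c • v) {l : ℂ} (hl : A v = l • v) :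
    finiteRankTrace A = l := by
  have hB : A.restrict (p := LinearMap.range A) (q := LinearMap.range A)
      (fun v _ => LinearMap.mem_range_self A v) = l • LinearMap.id := by
    ext ⟨w, x, rfl⟩
    obtain ⟨c, hc⟩ := hA x
    simp only [LinearMap.coe_restrict_apply, LinearMap.smul_apply, LinearMap.id_apply,
      Submodule.coe_smul]
    rw [hc, map_smul, hl, smul_comm]
  have hle : LinearMap.range A ≤ ℂ ∙ v := by
    rintro _ ⟨x, rfl⟩
    obtain ⟨c, hc⟩ := hA x
    rw [hc]
    exact Submodule.smul_mem _ _ (Submodule.mem_span_singleton_self v)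
  have : FiniteDimensional ℂ (LinearMap.range A) := Submodule.finiteDimensional_of_le hle
  rw [finiteRankTrace, hB, map_smul, LinearMap.trace_id, smul_eq_mul]
  -- If `l = 0`, the range may be zero or a line, but the restricted operator vanishes on it, so its
  -- dimension does not matter.
  by_cases h0 : l = 0
  · rw [h0, zero_mul]
  · have hr : LinearMap.range A = ℂ ∙ v := by
      apply le_antisymm hle
      rw [Submodule.span_singleton_le_iff_mem]
      exact ⟨l⁻¹ • v, by rw [map_smul, hl, smul_smul, inv_mul_cancel₀ h0, one_smul]⟩
    rw [hr, finrank_span_singleton hv, Nat.cast_one, mul_one]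

/-- The Satake transform is the eigenvalue on the spherical vector. -/
theorem satake_eq_integral (hF : ringChar 𝓀[F] ≠ 2) (dg : Measure (SO32 F)) [dg.IsHaarMeasure]
    {f : SO32 F → ℂ} (hf : IsSpherical f) (ζ ζ' : ℂ) :
    satake dg hf ζ ζ' = ∫ g, f g * sphVec hF ζ ζ' g ∂dg := by
  set φ : inducedSpace F ζ ζ' := ⟨_, sphVec_mem hF ζ ζ'⟩ with hφ
  have hA : ∀ ψ, heckeOp dg hf ζ ζ' ψ = (heckeOp dg hf ζ ζ' ψ).1 1 • φ := fun ψ =>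
    Subtype.ext (eq_smul_sphVec hF (heckeOp dg hf ζ ζ' ψ).2 fun k hk g =>
      heckeOp_mul_right dg hf ζ ζ' ψ hk g)
  have h0 : φ ≠ 0 := by
    intro h
    have h1 : sphVec hF ζ ζ' (1 : SO32 F) = 0 := congrFun (congrArg Subtype.val h) 1
    rw [sphVec_one] at h1
    exact one_ne_zero h1
  rw [satake, finiteRankTrace_of_range_le h0 (fun ψ => ⟨_, hA ψ⟩) (hA φ), heckeOp_apply]
  simp only [one_mul, hφ]

end SphericalVector

/-! ### Cells of the isotropic cone and values of the spherical vector. -/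

section SatakeValue

variable {F : Type*} [Field F] [ValuativeRel F] [TopologicalSpace F]
  [IsNonarchimedeanLocalField F]

theorem sphVec_of_cell (hF : ringChar 𝓀[F] ≠ 2) (ζ ζ' : ℂ) {g D : SO32 F}
    (hD : (mat D).BlockTriangular id)
    (h : ∃ b ∈ maxCompact F, (mat b).BlockTriangular id ∧ ∃ k' ∈ maxCompact F, g = b * D * k') :
    sphVec hF ζ ζ' g = borelChar ζ ζ' D := by
  obtain ⟨b, hbK, hb, k', hk', rfl⟩ := h
  rw [sphVec_mul_right hF ζ ζ' hk', sphVec_mul_left hF ζ ζ' hb, borelChar_of_mem ζ ζ' hb hbK,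
    one_mul, sphVec_eq hF ζ ζ' hD (by simp [one_mem])]

theorem borelChar_diagElt (ζ ζ' : ℂ) (α β : Fˣ) : borelChar ζ ζ' (diagElt α β) =
    ((nabs (α : F) ^ 3 * nabs (β : F) : ℝ) : ℂ) ^ (1 / 2 : ℂ) *
      ((nabs (α : F) / nabs (β : F) : ℝ) : ℂ) ^ ζ * ((nabs (β : F) : ℝ) : ℂ) ^ ζ' := by
  rw [borelChar, mat_diagElt, ← nabs_div]
  rfl

/-- Viewing the last column as the image of the last basis vector makes equidistribution available
for `redCol`. -/
theorem redVec_mulVec_single (g : SO32 F) : redVec (mat g *ᵥ Pi.single 4 1) = redCol g := by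
  rw [Matrix.mulVec_single_one]
  rfl

theorem quadric_zero {k : Type*} [Field k] : quadric (0 : k) =
    openCell 0 ∪ (secondCell 0 ∪ (thirdCell k ∪ closedCell k)) := by
  ext x
  simp only [quadric, openCell, secondCell, thirdCell, closedCell, Set.mem_union,
    Set.mem_ofPred_eq, Q_self]
  constructor
  · rintro ⟨h0, hQ⟩
    by_cases h4 : x 4 = 0
    swap
    · exact Or.inl ⟨hQ, h4⟩
    by_cases h3 : x 3 = 0
    swap
    · exact Or.inr (Or.inl ⟨hQ, h4, h3⟩)
    have h2 : x 2 = 0 := by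
      rw [h4, h3] at hQ
      simpa using hQ
    by_cases h1 : x 1 = 0
    swap
    · exact Or.inr (Or.inr (Or.inl ⟨h4, h3, h2, h1⟩))
    refine Or.inr (Or.inr (Or.inr ⟨h4, h3, h2, h1, fun h => h0 (funext fun i => ?_)⟩))
    fin_cases i <;> assumption
  · rintro (⟨hQ, h⟩ | ⟨hQ, -, h⟩ | ⟨h4, h3, h2, h⟩ | ⟨h4, h3, h2, h1, h⟩)
    · exact ⟨fun e => h (congrFun e 4), hQ⟩
    · exact ⟨fun e => h (congrFun e 3), hQ⟩
    · exact ⟨fun e => h (congrFun e 1), by rw [h4, h3, h2]; ring⟩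
    · exact ⟨fun e => h (congrFun e 0), by rw [h4, h3, h2]; ring⟩

/-- The cells of the isotropic cone. -/
def coneCell (k : Type*) [Field k] : Fin 4 → Set (Fin 5 → k) :=
  ![openCell 0, secondCell 0, thirdCell k, closedCell k]

theorem coneCell_subset {k : Type*} [Field k] (j : Fin 4) : coneCell k j ⊆ quadric (0 : k) := by
  rw [quadric_zero]
  intro x hx
  fin_cases j
  · exact Or.inl hx
  · exact Or.inr (Or.inl hx)
  · exact Or.inr (Or.inr (Or.inl hx))
  · exact Or.inr (Or.inr (Or.inr hx))

theorem iUnion_coneCell {k : Type*} [Field k] : ⋃ j, coneCell k j = quadric (0 : k) := by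
  refine subset_antisymm (Set.iUnion_subset coneCell_subset) ?_
  rw [quadric_zero]
  rintro x (h | h | h | h)
  · exact Set.mem_iUnion_of_mem 0 h
  · exact Set.mem_iUnion_of_mem 1 h
  · exact Set.mem_iUnion_of_mem 2 h
  · exact Set.mem_iUnion_of_mem 3 h

theorem pairwise_disjoint_coneCell {k : Type*} [Field k] :
    Pairwise (Function.onFun Disjoint (coneCell k)) := by
  have key : ∀ i j : Fin 4, i < j → Disjoint (coneCell k i) (coneCell k j) := by
    intro i j hij
    refine Set.disjoint_left.2 fun x hx hx' => ?_
    fin_cases i <;> fin_cases j <;> first | (exfalso; revert hij; decide) | skip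
    · exact hx.2 hx'.2.1
    · exact hx.2 hx'.1
    · exact hx.2 hx'.1
    · exact hx.2.2 hx'.2.1
    · exact hx.2.2 hx'.2.1
    · exact hx.2.2.2 hx'.2.2.2.1
  intro i j hij
  rcases lt_or_gt_of_ne hij with h | h
  · exact key i j h
  · exact (key j i h).symm

theorem card_coneCell {k : Type*} [Field k] [Finite k] (h2 : (2 : k) ≠ 0) (j : Fin 4) :
    (Nat.card (coneCell k j) : ℝ) = ((Nat.card k : ℝ) - 1) * (Nat.card k : ℝ) ^ (3 - (j : ℕ)) := by
  have h1 : 1 ≤ Nat.card k := Nat.card_pos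
  fin_cases j
  · change (Nat.card (openCell (0 : k)) : ℝ) = _
    rw [card_openCell h2]
    push_cast [h1]
    rfl
  · change (Nat.card (secondCell (0 : k)) : ℝ) = _
    rw [card_secondCell h2]
    push_cast [h1]
    rfl
  · change (Nat.card (thirdCell k) : ℝ) = _
    rw [card_thirdCell]
    push_cast [h1]
    simp
  · change (Nat.card (closedCell k) : ℝ) = _
    rw [card_closedCell]
    push_cast [h1]
    simp

end SatakeValue

end SplitSO5

end

noncomputable section

namespace SplitSO5

/-! ### Integrals over `K` by counting cells, and the Satake transform of `heckeFun`. -/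

section CellIntegrals

variable {F : Type*} [Field F] [ValuativeRel F] [TopologicalSpace F]
  [IsNonarchimedeanLocalField F]

/-- The integral over `K` of a function which depends on the cell of the reduction of `k v`. -/
theorem setIntegral_maxCompact_of_cells (hF : ringChar 𝓀[F] ≠ 2) (dg : Measure (SO32 F))
    [dg.IsHaarMeasure] (hdg : dg (maxCompact F : Set (SO32 F)) = 1) {v : Fin 5 → F}
    (hv : ∀ i, v i ∈ 𝒪[F]) (hv0 : redVec v ≠ 0) {ι : Type*} [Fintype ι]
    {cell : ι → Set (Fin 5 → 𝓀[F])}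
    (hcover : ⋃ j, cell j = quadric (Q (redVec v) (redVec v)))
    (hd : Pairwise (Function.onFun Disjoint cell)) {ψ : SO32 F → ℂ} {a : ι → ℂ}
    (ha : ∀ j, ∀ k ∈ maxCompact F, redVec (mat k *ᵥ v) ∈ cell j → ψ k = a j) :
    (∑ j, (Nat.card (cell j) : ℂ)) * ∫ k in (maxCompact F : Set (SO32 F)), ψ k ∂dg =
      ∑ j, (Nat.card (cell j) : ℂ) * a j := by
  set p : SO32 F → Fin 5 → 𝓀[F] := fun g => redVec (mat g *ᵥ v) with hp
  obtain ⟨u, hu⟩ := exists_measure_maxCompact hF dg hv (Q (redVec v) (redVec v))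
  have hsub : ∀ j, cell j ⊆ quadric (Q (redVec v) (redVec v)) := fun j =>
    hcover ▸ Set.subset_iUnion cell j
  have hm : ∀ j, MeasurableSet ((maxCompact F : Set (SO32 F)) ∩ p ⁻¹' cell j) := fun j =>
    measurableSet_inter_preimage
      (fun x => (isOpen_maxCompact_inter_fibre hv x).measurableSet) (Set.toFinite _)
  have hK : (maxCompact F : Set (SO32 F)) =
      ⋃ j, (maxCompact F : Set (SO32 F)) ∩ p ⁻¹' cell j := by
    rw [← Set.inter_iUnion, ← Set.preimage_iUnion, hcover, eq_comm, Set.inter_eq_left]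
    exact fun k hk => redVec_mulVec_mem_quadric hk hv hv0
  have hdis : Pairwise (Function.onFun Disjoint
      fun j => (maxCompact F : Set (SO32 F)) ∩ p ⁻¹' cell j) := fun i j hij =>
    ((hd hij).preimage p).mono Set.inter_subset_right Set.inter_subset_right
  have hreal : ∀ j, dg.real ((maxCompact F : Set (SO32 F)) ∩ p ⁻¹' cell j)
      = Nat.card (cell j) * u.toReal := by
    intro j
    rw [Measure.real, hu _ (hsub j), ENNReal.toReal_mul, ENNReal.toReal_natCast]
  have hfin : dg (maxCompact F : Set (SO32 F)) ≠ ⊤ := by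
    rw [hdg]
    exact ENNReal.one_ne_top
  -- The constant function `1` and `vol(K) = 1` show that `u` times the number of vectors is one;
  -- this eliminates `u` from the formula for `ψ`.
  have h1 := (setIntegral_of_partition dg hm hK hdis hfin (ψ := fun _ => (1 : ℂ))
    (a := fun _ => 1) fun _ _ _ => rfl).2
  have h2 := (setIntegral_of_partition dg hm hK hdis hfin (ψ := ψ) (a := a)
    fun j k hk => ha j k hk.1 hk.2).2
  rw [setIntegral_const, Measure.real, hdg, ENNReal.toReal_one, one_smul] at h1
  simp only [hreal, mul_one] at h1 h2
  push_cast at h1 h2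
  rw [← Finset.sum_mul] at h1
  rw [h2, Finset.mul_sum]
  refine Finset.sum_congr rfl fun j _ => ?_
  linear_combination -((Nat.card (cell j) : ℂ) * a j) * h1

end CellIntegrals

section SatakeValue

variable {F : Type*} [Field F] [ValuativeRel F] [TopologicalSpace F]
  [IsNonarchimedeanLocalField F]

theorem ofReal_zpow_cpow {q : ℝ} (hq : 0 < q) (n : ℤ) (s : ℂ) :
    ((q ^ n : ℝ) : ℂ) ^ s = ((q : ℂ) ^ s) ^ n := by
  have h1 : ((q ^ n : ℝ) : ℂ) ≠ 0 := by
    exact_mod_cast (zpow_pos hq n).ne'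
  have h2 : (q : ℂ) ≠ 0 := by exact_mod_cast hq.ne'
  rw [Complex.cpow_def_of_ne_zero h1, Complex.cpow_def_of_ne_zero h2,
    ← Complex.ofReal_log (zpow_pos hq n).le, ← Complex.ofReal_log hq.le, Real.log_zpow,
    ← Complex.exp_int_mul]
  congr 1
  push_cast
  ring

variable (F) in
theorem residueCard_cast_ne_zero : (residueCard F : ℂ) ≠ 0 := by
  have := one_lt_residueCard F
  exact_mod_cast (by omega : residueCard F ≠ 0)

/-- The values of the spherical vector on the cells. -/
def cellValue (Y X : ℂ) : Fin 4 → ℂ := ![(Y ^ 3 * X)⁻¹, (Y ^ 2)⁻¹, Y ^ 2, Y ^ 3 * X]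

/-- For `ζ' = 1/2 + ζ` the powers `|β| ^ ζ` cancel and the character becomes `|α| ^ (3/2 + ζ) |β|`.
The two cells on which only `β` is nontrivial therefore receive values free of `ζ`. -/
theorem borelChar_diagElt_zpow {ϖ : Fˣ} (hϖ : IsUniformizer ϖ) (ζ : ℂ) (a b : ℤ) :
    borelChar ζ (1 / 2 + ζ) (diagElt (ϖ ^ a) (ϖ ^ b)) =
      (((residueCard F : ℂ) ^ (1 / 2 : ℂ)) ^ (-(3 * a + 2 * b))) *
        ((residueCard F : ℂ) ^ ζ) ^ (-a) := by
  have h0 : (0 : ℝ) < residueCard F := by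
    have := one_lt_residueCard F
    exact_mod_cast (by omega : 0 < residueCard F)
  have hz : ∀ n : ℤ, nabs (((ϖ ^ n : Fˣ) : F)) = (residueCard F : ℝ) ^ (-n) := by
    intro n
    have h1 : ∀ n : ℕ, nabs ((ϖ : F) ^ n) = ((residueCard F : ℝ)⁻¹) ^ n := by
      intro n
      induction n with
      | zero => rw [pow_zero, pow_zero, nabs_one]
      | succ n ih => rw [pow_succ, pow_succ, nabs_mul, ih, hϖ.nabs]
    rw [Units.val_zpow_eq_zpow_val]
    cases n with
    | ofNat n => rw [Int.ofNat_eq_natCast, zpow_natCast, h1, zpow_neg, zpow_natCast, inv_pow]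
    | negSucc n =>
      rw [zpow_negSucc, nabs_inv, h1, inv_pow, inv_inv, Int.neg_negSucc, zpow_natCast]
  have e1 : ((residueCard F : ℝ) ^ (-a)) ^ 3 * (residueCard F : ℝ) ^ (-b) =
      (residueCard F : ℝ) ^ (-(3 * a + b)) := by
    rw [← zpow_natCast, ← zpow_mul, ← zpow_add₀ h0.ne']
    congr 1
    push_cast
    ring
  have e2 : (residueCard F : ℝ) ^ (-a) / (residueCard F : ℝ) ^ (-b) =
      (residueCard F : ℝ) ^ (b - a) := by
    rw [← zpow_sub₀ h0.ne']
    congr 1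
    ring
  have hq := residueCard_cast_ne_zero F
  have hX : (residueCard F : ℂ) ^ ζ ≠ 0 := by simp [Complex.cpow_eq_zero_iff, hq]
  have hY : (residueCard F : ℂ) ^ (1 / 2 : ℂ) ≠ 0 := by
    rw [Ne, Complex.cpow_eq_zero_iff]
    exact fun h => hq h.1
  rw [borelChar_diagElt, hz, hz, e1, e2, ofReal_zpow_cpow h0, ofReal_zpow_cpow h0,
    ofReal_zpow_cpow h0, Complex.ofReal_natCast, Complex.cpow_add _ _ hq, mul_zpow]
  have e3 : -(3 * a + 2 * b) = -(3 * a + b) + -b := by ring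
  have e4 : -a = (b - a) + -b := by ring
  rw [e3, zpow_add₀ hY, e4, zpow_add₀ hX]
  ring

theorem sphVec_on_cell (hF : ringChar 𝓀[F] ≠ 2) {ϖ : Fˣ} (hϖ : IsUniformizer ϖ) (ζ : ℂ)
    (j : Fin 4) {k : SO32 F} (hk : k ∈ maxCompact F) (h : redCol k ∈ coneCell 𝓀[F] j) :
    sphVec hF ζ (1 / 2 + ζ) (k * torusElt ϖ) =
      cellValue ((residueCard F : ℂ) ^ (1 / 2 : ℂ)) ((residueCard F : ℂ) ^ ζ) j := by
  have hv := borelChar_diagElt_zpow hϖ ζ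
  fin_cases j
  · rw [sphVec_of_cell hF _ _ (diagElt_blockTriangular _ _) (cell_open hF hϖ hk h.2)]
    have h1 := hv 1 0
    rw [zpow_one, zpow_zero] at h1
    rw [h1]
    simp only [cellValue]
    norm_num
    ring
  · rw [sphVec_of_cell hF _ _ (diagElt_blockTriangular _ _) (cell_second hF hϖ hk h.2.1 h.2.2)]
    have h1 := hv 0 1
    rw [zpow_one, zpow_zero] at h1
    rw [h1]
    simp only [cellValue]
    norm_num
  · rw [sphVec_of_cell hF _ _ (diagElt_blockTriangular _ _)
      (cell_third hF hϖ hk h.1 h.2.1 h.2.2.2)]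
    have h1 := hv 0 (-1)
    rw [zpow_neg_one, zpow_zero] at h1
    rw [h1]
    simp only [cellValue]
    norm_num
  · rw [sphVec_of_cell hF _ _ (diagElt_blockTriangular _ _)
      (cell_closed hF hϖ hk h.1 h.2.1 h.2.2.2.1)]
    have h1 := hv (-1) 0
    rw [zpow_neg_one, zpow_zero] at h1
    rw [h1]
    simp only [cellValue]
    norm_num

theorem card_coneCell_complex (hF : ringChar 𝓀[F] ≠ 2) (j : Fin 4) :
    (Nat.card (coneCell 𝓀[F] j) : ℂ) =
      ((residueCard F : ℂ) - 1) * (residueCard F : ℂ) ^ (3 - (j : ℕ)) := by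
  have h := card_coneCell (residue_two_ne_zero hF) j
  have h1 := congrArg (fun x : ℝ => (x : ℂ)) h
  push_cast at h1
  exact h1

theorem sum_card_coneCell (hF : ringChar 𝓀[F] ≠ 2) :
    ∑ j, (Nat.card (coneCell 𝓀[F] j) : ℂ) = (residueCard F : ℂ) ^ 4 - 1 := by
  simp only [card_coneCell_complex hF, Fin.sum_univ_four]
  norm_num
  ring

theorem integers_single (i : Fin 5) : (Pi.single 4 1 : Fin 5 → F) i ∈ 𝒪[F] := by
  rw [Pi.single_apply]
  split_ifs
  · exact one_mem _
  · exact zero_mem _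

theorem redVec_single : redVec (Pi.single 4 1 : Fin 5 → F) = redCol (1 : SO32 F) := by
  rw [← redVec_mulVec_single, mat_one, Matrix.one_mulVec]

/-- The cell sizes `(q - 1) q ^ (3 - j)` are paired with the entries of `cellValue`: the outer cells
give `Y³ (X + X⁻¹)` and the middle ones `q + q²`. The number of cosets stays unevaluated, as it also
occurs on the other side of the eigenvalue equation. -/
theorem satake_heckeFun (hF : ringChar 𝓀[F] ≠ 2) {ϖ : Fˣ} (hϖ : IsUniformizer ϖ)
    (dg : Measure (SO32 F)) [dg.IsHaarMeasure] (hdg : dg (maxCompact F : Set (SO32 F)) = 1)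
    (ζ : ℂ) {q Y X : ℂ} (hq : q = (residueCard F : ℂ)) (hY : Y = q ^ (1 / 2 : ℂ))
    (hX : X = q ^ ζ) :
    (q ^ 4 - 1) * satake dg (isSpherical_heckeFun (F := F) ϖ) ζ (1 / 2 + ζ) =
      Nat.card (cosets (F := F) ϖ) * ((q - 1) * (Y ^ 3 * (X + X⁻¹) + q + q ^ 2)) := by
  have hq0 : q ≠ 0 := hq ▸ residueCard_cast_ne_zero F
  have hX0 : X ≠ 0 := by
    rw [hX, Ne, Complex.cpow_eq_zero_iff]
    exact fun h => hq0 h.1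
  have hY2 : Y ^ 2 = q := by
    rw [hY, ← Complex.cpow_nat_mul]
    norm_num
  have hY0 : Y ≠ 0 := by
    rintro rfl
    rw [← hY2] at hq0
    simp at hq0
  rw [satake_eq_integral hF, integral_heckeFun_right_invariant hF hϖ dg hdg
    fun k hk g => sphVec_mul_right hF ζ _ hk g]
  have h := setIntegral_maxCompact_of_cells hF dg hdg (v := Pi.single 4 1) integers_single
    (by rw [redVec_single]; exact redCol_ne_zero (one_mem _)) (cell := coneCell 𝓀[F])
    (by rw [redVec_single, Q_redCol (one_mem _)]; exact iUnion_coneCell)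
    pairwise_disjoint_coneCell
    (ψ := fun g => sphVec hF ζ (1 / 2 + ζ) (g * torusElt ϖ)) (a := cellValue Y X)
    (fun j k hk hj => by
      rw [redVec_mulVec_single] at hj
      rw [hY, hX, hq]
      exact sphVec_on_cell hF hϖ ζ j hk hj)
  rw [sum_card_coneCell hF, ← hq] at h
  rw [mul_left_comm, h]
  congr 1
  have c0 : cellValue Y X 0 = (Y ^ 3 * X)⁻¹ := rfl
  have c1 : cellValue Y X 1 = (Y ^ 2)⁻¹ := rfl
  have c2 : cellValue Y X 2 = Y ^ 2 := rfl
  have c3 : cellValue Y X 3 = Y ^ 3 * X := rfl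
  simp only [card_coneCell_complex hF, Fin.sum_univ_four, ← hq, c0, c1, c2, c3]
  norm_num
  have e3 : q ^ 3 = Y ^ 6 := by
    rw [← hY2]
    ring
  have e1 : q * Y ^ 2 = q ^ 2 := by
    rw [hY2]
    ring
  have e2 : q ^ 2 * (Y ^ 2)⁻¹ = q := by
    rw [hY2]
    field_simp
  have e4 : q ^ 3 * (X⁻¹ * (Y ^ 3)⁻¹) = Y ^ 3 * X⁻¹ := by
    rw [e3]
    field_simp
  linear_combination (q - 1) * e4 + (q - 1) * e2 + (q - 1) * e1

end SatakeValue

end SplitSO5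

end

noncomputable section

namespace SplitSO5

/-! ### Cells of the reduced sphere. -/

section SphereCells

variable {F : Type*} [Field F] [ValuativeRel F] [TopologicalSpace F]
  [IsNonarchimedeanLocalField F]

theorem red_nonsplit_radius {θ : F} (hu : valuation F θ = 1) : red (4 * θ) = 2 ^ 2 * red θ := by
  have e : (4 : F) * θ = 2 ^ 2 * θ := by norm_num
  rw [e, red_mul (pow_mem two_mem 2) (mem_of_valuation_one hu), red_pow two_mem, red_two]

theorem red_radius_ne_zero (hF : ringChar 𝓀[F] ≠ 2) (C : SphereCase F) : red C.radius ≠ 0 := by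
  cases C with
  | split =>
    change red (1 : F) ≠ 0
    rw [red_one]
    exact one_ne_zero
  | nonsplit θ hu _ =>
    change red (4 * θ) ≠ 0
    rw [red_nonsplit_radius hu]
    exact mul_ne_zero (pow_ne_zero 2 (residue_two_ne_zero hF))
      ((red_ne_zero_iff (mem_of_valuation_one hu)).2 hu)

/-- The reduced radius is `1`, or four times the reduction of `θ`, which Hensel's lemma shows to be
a nonsquare. The sign of the case enters the counts only through this number. -/
theorem card_roots_radius (hF : ringChar 𝓀[F] ≠ 2) (C : SphereCase F) :
    (Nat.card {y : 𝓀[F] // y ^ 2 = red C.radius} : ℂ) = 1 + C.sign := by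
  have h2 := residue_two_ne_zero hF
  cases C with
  | split =>
    change (Nat.card {y : 𝓀[F] // y ^ 2 = red (1 : F)} : ℂ) = 1 + 1
    rw [red_one, card_sq_roots_one h2]
    norm_num
  | nonsplit θ hu hθ =>
    change (Nat.card {y : 𝓀[F] // y ^ 2 = red (4 * θ)} : ℂ) = 1 + -1
    rw [red_nonsplit_radius hu, card_sq_roots_of_not_isSquare, Nat.cast_zero, add_neg_cancel]
    rintro ⟨y, hy⟩
    refine hθ (isSquare_of_isSquare_red hF
      ((red_ne_zero_iff (mem_of_valuation_one hu)).2 hu) ⟨y / 2, ?_⟩)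
    field_simp
    linear_combination hy

theorem Q_redVec_level {ϖ : Fˣ} {C : SphereCase F} {m : ℕ} {s : Sphere C} (hs : IsLevel ϖ m s) :
    Q (redVec ((ϖ : F) ^ m • s.1)) (redVec ((ϖ : F) ^ m • s.1)) =
      red (((ϖ : F) ^ m) ^ 2 * C.radius) := by
  rw [← red_Q hs.1]
  congr 1
  have h : Q s.1 s.1 = C.radius := s.2
  rw [Q_self] at h ⊢
  simp only [Pi.smul_apply, smul_eq_mul]
  linear_combination ((ϖ : F) ^ m) ^ 2 * h

theorem Q_redVec_level_zero {ϖ : Fˣ} {C : SphereCase F} {s : Sphere C} (hs : IsLevel ϖ 0 s) :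
    Q (redVec ((ϖ : F) ^ 0 • s.1)) (redVec ((ϖ : F) ^ 0 • s.1)) = red C.radius := by
  rw [Q_redVec_level hs]
  simp

theorem Q_redVec_level_succ {ϖ : Fˣ} (hϖ : IsUniformizer ϖ) {C : SphereCase F} {m : ℕ}
    {s : Sphere C} (hs : IsLevel ϖ (m + 1) s) :
    Q (redVec ((ϖ : F) ^ (m + 1) • s.1)) (redVec ((ϖ : F) ^ (m + 1) • s.1)) = 0 := by
  have hp := hϖ.mem
  rw [Q_redVec_level hs, red_mul (pow_mem (pow_mem hp _) 2) C.radius_mem,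
    red_pow (pow_mem hp _), red_pow hp, hϖ.red]
  simp

/-- The cells of the vectors of given nonzero length. -/
def sphereCell {k : Type*} [Field k] (c : k) : Fin 2 → Set (Fin 5 → k) :=
  ![openCell c, hyperCell c]

theorem iUnion_sphereCell {k : Type*} [Field k] {c : k} (hc : c ≠ 0) :
    ⋃ j, sphereCell c j = quadric c := by
  have h0 : ∀ x : Fin 5 → k, Q x x = c → x ≠ 0 := by
    rintro x hx rfl
    apply hc
    rw [← hx, Q_self]
    simp
  ext x
  rw [Set.mem_iUnion]
  constructor
  · rintro ⟨j, hj⟩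
    fin_cases j
    · exact ⟨h0 x hj.1, hj.1⟩
    · exact ⟨h0 x hj.1, hj.1⟩
  · rintro ⟨-, hx⟩
    by_cases h4 : x 4 = 0
    · exact ⟨1, hx, h4⟩
    · exact ⟨0, hx, h4⟩

theorem pairwise_disjoint_sphereCell {k : Type*} [Field k] (c : k) :
    Pairwise (Function.onFun Disjoint (sphereCell c)) := by
  intro i j hij
  fin_cases i <;> fin_cases j
  · exact absurd rfl hij
  · exact disjoint_openCell_hyperCell c c
  · exact (disjoint_openCell_hyperCell c c).symm
  · exact absurd rfl hij

theorem residueCard_pos : 1 ≤ Nat.card 𝓀[F] := (one_lt_residueCard F).le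

theorem card_openCell_complex (hF : ringChar 𝓀[F] ≠ 2) (c : 𝓀[F]) :
    (Nat.card (openCell c) : ℂ) = ((residueCard F : ℂ) - 1) * (residueCard F : ℂ) ^ 3 := by
  rw [card_openCell (residue_two_ne_zero hF), Nat.cast_mul, Nat.cast_sub residueCard_pos]
  push_cast
  rfl

theorem card_hyperCell_complex (hF : ringChar 𝓀[F] ≠ 2) (C : SphereCase F) :
    (Nat.card (hyperCell (red C.radius)) : ℂ) =
      (residueCard F : ℂ) ^ 3 + C.sign * (residueCard F : ℂ) ^ 2 := by
  rw [card_hyperCell (residue_two_ne_zero hF), Nat.cast_add, Nat.cast_mul, Nat.cast_mul,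
    Nat.cast_sub residueCard_pos, card_roots_radius hF]
  change ((residueCard F : ℂ) - (1 : ℕ)) * ((residueCard F ^ 2 : ℕ) : ℂ) +
    ((residueCard F ^ 2 : ℕ) : ℂ) * (1 + C.sign) = _
  push_cast
  ring

end SphereCells

/-! ### Recurrence for the values of the eigenfunction. -/

section Eigenfunction

variable {F : Type*} [Field F] [ValuativeRel F] [TopologicalSpace F]
  [IsNonarchimedeanLocalField F]

theorem torusElt_one : torusElt (1 : Fˣ) = 1 := by
  apply ext_mat
  rw [mat_torusElt, mat_one, ← Matrix.diagonal_one]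
  congr 1
  ext i
  fin_cases i <;> simp

theorem IsSphericalEigenfunction.eq_of_isLevel {hF : ringChar 𝓀[F] ≠ 2} {ϖ : Fˣ}
    (hϖ : IsUniformizer ϖ) {C : SphereCase F} {dg : Measure (SO32 F)} [dg.IsHaarMeasure] {ζ : ℂ}
    {T : Sphere C → ℂ} (hT : IsSphericalEigenfunction hF C dg ζ T) {m : ℕ} {s : Sphere C}
    (hs : IsLevel ϖ m s) : T s = T (torusElt (ϖ ^ m) • basePoint hF C) := by
  obtain ⟨k, rfl⟩ := (mem_orbitK_iff hF hϖ m s).2 hs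
  exact hT.invariant k.1 k.2 _

theorem IsSphericalEigenfunction.hecke {hF : ringChar 𝓀[F] ≠ 2} {ϖ : Fˣ}
    (hϖ : IsUniformizer ϖ) {C : SphereCase F} {dg : Measure (SO32 F)} [dg.IsHaarMeasure] {ζ : ℂ}
    {T : Sphere C → ℂ} (hT : IsSphericalEigenfunction hF C dg ζ T) (s : Sphere C) :
    Nat.card (cosets (F := F) ϖ) *
        ∫ k in (maxCompact F : Set (SO32 F)), T (torusElt ϖ • k • s) ∂dg =
      satake dg (isSpherical_heckeFun (F := F) ϖ) ζ (1 / 2 + ζ) * T s := by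
  rw [← hT.eigen, integral_heckeFun_left_invariant hF hϖ dg (ψ := fun g => T (g • s))
    fun k hk g => by rw [mul_smul, hT.invariant k hk]]
  simp only [mul_smul]

theorem residueCard_sub_one_ne_zero : (residueCard F : ℂ) - 1 ≠ 0 := by
  have h := one_lt_residueCard F
  intro h2
  have h3 : residueCard F = 1 := by exact_mod_cast sub_eq_zero.1 h2
  omega

/-- Both sides of the eigenvalue equation contain the number of cosets, which is nonzero and
cancels. -/
theorem IsSphericalEigenfunction.setIntegral {hF : ringChar 𝓀[F] ≠ 2} {ϖ : Fˣ}
    (hϖ : IsUniformizer ϖ) {C : SphereCase F} {dg : Measure (SO32 F)} [dg.IsHaarMeasure]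
    (hdg : dg (maxCompact F : Set (SO32 F)) = 1) {ζ : ℂ}
    {T : Sphere C → ℂ} (hT : IsSphericalEigenfunction hF C dg ζ T) (s : Sphere C)
    {q Y X : ℂ} (hq : q = (residueCard F : ℂ)) (hY : Y = q ^ (1 / 2 : ℂ)) (hX : X = q ^ ζ) :
    (q ^ 4 - 1) * ∫ k in (maxCompact F : Set (SO32 F)), T (torusElt ϖ • k • s) ∂dg =
      (q - 1) * (Y ^ 3 * (X + X⁻¹) + q + q ^ 2) * T s := by
  have h1 := hT.hecke hϖ s
  have h2 := satake_heckeFun hF hϖ dg hdg ζ hq hY hX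
  refine mul_left_cancel₀ (card_cosets_ne_zero (F := F) hF hϖ) ?_
  linear_combination (q ^ 4 - 1) * h1 + T s * h2

/-- The first of the recurrence relations for the values of the eigenfunction. -/
theorem IsSphericalEigenfunction.recurrence_zero {hF : ringChar 𝓀[F] ≠ 2} {ϖ : Fˣ}
    (hϖ : IsUniformizer ϖ) {C : SphereCase F} {dg : Measure (SO32 F)} [dg.IsHaarMeasure]
    (hdg : dg (maxCompact F : Set (SO32 F)) = 1) {ζ : ℂ}
    {T : Sphere C → ℂ} (hT : IsSphericalEigenfunction hF C dg ζ T)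
    {q Y X : ℂ} (hq : q = (residueCard F : ℂ)) (hY : Y = q ^ (1 / 2 : ℂ)) (hX : X = q ^ ζ) :
    (q ^ 4 + C.sign * q ^ 2) * (q - 1) * (Y ^ 3 * (X + X⁻¹) + q + q ^ 2) = (q ^ 4 - 1) *
      ((q - 1) * q ^ 3 * T (torusElt (ϖ ^ 1) • basePoint hF C) + (q ^ 3 + C.sign * q ^ 2)) := by
  have hb := isLevel_base hF hϖ C 0
  set s := torusElt (ϖ ^ 0) • basePoint hF C with hs
  have hTs : T s = 1 := by
    rw [hs, ← hT.normalized, pow_zero]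
    congr 1
    rw [torusElt_one, one_smul]
  have hQ := Q_redVec_level_zero hb
  have h1 := setIntegral_maxCompact_of_cells hF dg hdg hb.1 hb.2
    (cell := sphereCell (red C.radius))
    (by rw [hQ]; exact iUnion_sphereCell (red_radius_ne_zero hF C))
    (pairwise_disjoint_sphereCell _) (ψ := fun k => T (torusElt ϖ • k • s))
    (a := ![T (torusElt (ϖ ^ 1) • basePoint hF C), 1]) (by
      intro j k hk hj
      have hlev := hb.smul hk
      have hr : redVec (mat k *ᵥ ((ϖ : F) ^ 0 • s.1)) = redVec ((ϖ : F) ^ 0 • (k • s).1) := by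
        rw [Matrix.mulVec_smul]; rfl
      rw [hr] at hj
      fin_cases j
      · exact hT.eq_of_isLevel hϖ (isLevel_torusElt_smul_up hϖ hlev hj.2)
      -- At level zero the level cannot go down: a vector with only its first coordinate nonzero has
      -- length zero, whereas the reduced radius is nonzero.
      · change T (torusElt ϖ • k • s) = 1
        rw [← hTs, hs]
        refine hT.eq_of_isLevel hϖ (isLevel_torusElt_smul_same hϖ hlev hj.2 ?_)
        rintro ⟨e1, e2, e3⟩
        refine red_radius_ne_zero hF C ?_
        rw [← hj.1, Q_self, e2, e3, hj.2]
        ring)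
  rw [Fin.sum_univ_two, Fin.sum_univ_two] at h1
  change ((Nat.card (openCell (red C.radius)) : ℂ) + (Nat.card (hyperCell (red C.radius)) : ℂ)) * _
    = (Nat.card (openCell (red C.radius)) : ℂ) * T (torusElt (ϖ ^ 1) • basePoint hF C) +
      (Nat.card (hyperCell (red C.radius)) : ℂ) * 1 at h1
  rw [card_openCell_complex hF, card_hyperCell_complex hF, ← hq] at h1
  have h2 := hT.setIntegral hϖ hdg s hq hY hX
  rw [hTs] at h2
  linear_combination (q ^ 4 - 1) * h1 - (q ^ 4 + C.sign * q ^ 2) * h2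

/-- The recurrence relations for the values of the eigenfunction. -/
theorem IsSphericalEigenfunction.recurrence_succ {hF : ringChar 𝓀[F] ≠ 2} {ϖ : Fˣ}
    (hϖ : IsUniformizer ϖ) {C : SphereCase F} {dg : Measure (SO32 F)} [dg.IsHaarMeasure]
    (hdg : dg (maxCompact F : Set (SO32 F)) = 1) {ζ : ℂ}
    {T : Sphere C → ℂ} (hT : IsSphericalEigenfunction hF C dg ζ T)
    {q Y X : ℂ} (hq : q = (residueCard F : ℂ)) (hY : Y = q ^ (1 / 2 : ℂ)) (hX : X = q ^ ζ)
    (m : ℕ) :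
    Y ^ 3 * (X + X⁻¹) * T (torusElt (ϖ ^ (m + 1)) • basePoint hF C) =
      q ^ 3 * T (torusElt (ϖ ^ (m + 2)) • basePoint hF C) +
        T (torusElt (ϖ ^ m) • basePoint hF C) := by
  have hb := isLevel_base hF hϖ C (m + 1)
  set s := torusElt (ϖ ^ (m + 1)) • basePoint hF C with hs
  have hQ := Q_redVec_level_succ hϖ hb
  set t₂ := T (torusElt (ϖ ^ (m + 2)) • basePoint hF C) with ht₂
  set t₀ := T (torusElt (ϖ ^ m) • basePoint hF C) with ht₀
  have h1 := setIntegral_maxCompact_of_cells hF dg hdg hb.1 hb.2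
    (cell := coneCell 𝓀[F]) (by rw [hQ]; exact iUnion_coneCell)
    pairwise_disjoint_coneCell (ψ := fun k => T (torusElt ϖ • k • s))
    -- The open cell raises the level, the two middle cells keep it, and the closed cell lowers it.
    (a := ![t₂, T s, T s, t₀]) (by
      intro j k hk hj
      have hlev := hb.smul hk
      have hr : redVec (mat k *ᵥ ((ϖ : F) ^ (m + 1) • s.1))
          = redVec ((ϖ : F) ^ (m + 1) • (k • s).1) := by
        rw [Matrix.mulVec_smul]; rfl
      rw [hr] at hj
      fin_cases j
      · exact hT.eq_of_isLevel hϖ (isLevel_torusElt_smul_up hϖ hlev hj.2)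
      · exact hT.eq_of_isLevel hϖ (isLevel_torusElt_smul_same hϖ hlev hj.2.1
          fun h => hj.2.2 h.2.2)
      · exact hT.eq_of_isLevel hϖ (isLevel_torusElt_smul_same hϖ hlev hj.1
          fun h => hj.2.2.2 h.1)
      · exact hT.eq_of_isLevel hϖ (isLevel_torusElt_smul_down hF hϖ hlev hj.2.2.2.1 hj.2.2.1
          hj.2.1 hj.1))
  rw [sum_card_coneCell hF, Fin.sum_univ_four] at h1
  simp only [card_coneCell_complex hF, ← hq] at h1
  change _ = (q - 1) * q ^ 3 * t₂ + (q - 1) * q ^ 2 * T s + (q - 1) * q ^ 1 * T s +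
    (q - 1) * q ^ 0 * t₀ at h1
  have h2 := hT.setIntegral hϖ hdg s hq hY hX
  have hne : q - 1 ≠ 0 := hq ▸ residueCard_sub_one_ne_zero
  refine mul_left_cancel₀ hne ?_
  -- The middle cells contribute `(q - 1) (q² + q) T s`, exactly the part of the eigenvalue free of
  -- `X`, so only three terms remain.
  linear_combination h1 - h2

end Eigenfunction

/-! ### Volumes of the `K`-orbits. -/

section Volumes

variable {F : Type*} [Field F] [ValuativeRel F] [TopologicalSpace F]
  [IsNonarchimedeanLocalField F]

theorem isLevel_smul_iff {k : SO32 F} (hk : k ∈ maxCompact F) {ϖ : Fˣ} {C : SphereCase F} {m : ℕ}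
    {s : Sphere C} : IsLevel ϖ m (k • s) ↔ IsLevel ϖ m s := by
  refine ⟨fun h => ?_, fun h => h.smul hk⟩
  have := h.smul (inv_mem hk)
  rwa [inv_smul_smul] at this

/-- The length modulo `ϖ` of the vectors of the `m`-th orbit, scaled to be primitive. -/
def levelLength (ϖ : Fˣ) (C : SphereCase F) (m : ℕ) : 𝓀[F] :=
  red (((ϖ : F) ^ m) ^ 2 * C.radius)

/-- The converse holds since a point has only one level: outside the open cell `d` keeps or lowers
it. In `isLevel_down_iff` the roles are exchanged. -/
theorem isLevel_up_iff (hF : ringChar 𝓀[F] ≠ 2) {ϖ : Fˣ} (hϖ : IsUniformizer ϖ)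
    {C : SphereCase F} {m : ℕ} {s : Sphere C} (hs : IsLevel ϖ m s) :
    IsLevel ϖ (m + 1) (torusElt ϖ • s) ↔
      redVec ((ϖ : F) ^ m • s.1) ∈ openCell (levelLength ϖ C m) := by
  refine ⟨fun h => ⟨Q_redVec_level hs, fun h4 => ?_⟩, fun h => isLevel_torusElt_smul_up hϖ hs h.2⟩
  by_cases hmid : redVec ((ϖ : F) ^ m • s.1) 1 = 0 ∧ redVec ((ϖ : F) ^ m • s.1) 2 = 0 ∧
      redVec ((ϖ : F) ^ m • s.1) 3 = 0
  · obtain ⟨h1, h2, h3⟩ := hmid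
    cases m with
    | zero =>
      refine red_radius_ne_zero hF C ?_
      rw [← Q_redVec_level_zero hs, Q_self, h2, h3, h4]
      ring
    | succ m =>
      have := isLevel_unique hϖ h (isLevel_torusElt_smul_down hF hϖ hs h1 h2 h3 h4)
      omega
  · have := isLevel_unique hϖ h (isLevel_torusElt_smul_same hϖ hs h4 hmid)
    omega

theorem isLevel_down_iff (hF : ringChar 𝓀[F] ≠ 2) {ϖ : Fˣ} (hϖ : IsUniformizer ϖ)
    {C : SphereCase F} {m : ℕ} {s : Sphere C} (hs : IsLevel ϖ (m + 1) s) :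
    IsLevel ϖ m (torusElt ϖ • s) ↔ redVec ((ϖ : F) ^ (m + 1) • s.1) ∈ closedCell 𝓀[F] := by
  refine ⟨fun h => ?_, fun h => isLevel_torusElt_smul_down hF hϖ hs h.2.2.2.1 h.2.2.1 h.2.1 h.1⟩
  have h4 : redVec ((ϖ : F) ^ (m + 1) • s.1) 4 = 0 := by
    by_contra h4
    have := isLevel_unique hϖ h (isLevel_torusElt_smul_up hϖ hs h4)
    omega
  have hmid : redVec ((ϖ : F) ^ (m + 1) • s.1) 1 = 0 ∧ redVec ((ϖ : F) ^ (m + 1) • s.1) 2 = 0 ∧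
      redVec ((ϖ : F) ^ (m + 1) • s.1) 3 = 0 := by
    by_contra hmid
    have := isLevel_unique hϖ h (isLevel_torusElt_smul_same hϖ hs h4 hmid)
    omega
  obtain ⟨h1, h2, h3⟩ := hmid
  refine ⟨h4, h3, h2, h1, fun h0 => hs.2 (funext fun i => ?_)⟩
  fin_cases i <;> assumption

/-- The element `swapOuter * d` carries the points of level `m` that `d` raises onto the points of
level `m + 1` that `d` lowers, because `d * swapOuter * d = swapOuter` returns to level `m`.
Invariance of `ds` does the rest. -/
theorem measure_up_eq_measure_down (hF : ringChar 𝓀[F] ≠ 2) {ϖ : Fˣ} (hϖ : IsUniformizer ϖ)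
    {C : SphereCase F} (ds : Measure (Sphere C)) [SMulInvariantMeasure (SO32 F) (Sphere C) ds]
    (m : ℕ) :
    ds ({s : Sphere C | IsLevel ϖ m s} ∩
        (fun s => redVec ((ϖ : F) ^ m • s.1)) ⁻¹' openCell (levelLength ϖ C m)) =
      ds ({s : Sphere C | IsLevel ϖ (m + 1) s} ∩
        (fun s => redVec ((ϖ : F) ^ (m + 1) • s.1)) ⁻¹' closedCell 𝓀[F]) := by
  rw [← measure_preimage_smul ds (swapOuter F * torusElt ϖ)
    ({s : Sphere C | IsLevel ϖ (m + 1) s} ∩ _)]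
  congr 1
  ext s
  have hw := swapOuter_mem (F := F)
  have e : torusElt ϖ * (swapOuter F * torusElt ϖ) = swapOuter F := by
    rw [torusElt_eq_diagElt, swapOuter_mul_diagElt, ← torusElt_eq_diagElt, ← torusElt_eq_diagElt,
      ← torusElt_inv, mul_inv_cancel_left]
  have h1 : IsLevel ϖ (m + 1) ((swapOuter F * torusElt ϖ) • s) ↔
      IsLevel ϖ (m + 1) (torusElt ϖ • s) := by
    rw [mul_smul, isLevel_smul_iff hw]
  have h2 : IsLevel ϖ m (torusElt ϖ • (swapOuter F * torusElt ϖ) • s) ↔ IsLevel ϖ m s := by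
    rw [← mul_smul, e, isLevel_smul_iff hw]
  constructor
  · rintro ⟨h3, h4⟩
    have h5 := h1.2 ((isLevel_up_iff hF hϖ h3).2 h4)
    exact ⟨h5, (isLevel_down_iff hF hϖ h5).1 (h2.2 h3)⟩
  · rintro ⟨h3, h4⟩
    have h5 := h2.1 ((isLevel_down_iff hF hϖ h3).2 h4)
    exact ⟨h5, (isLevel_up_iff hF hϖ h5).1 (h1.1 h3)⟩

theorem orbitK_eq (hF : ringChar 𝓀[F] ≠ 2) {ϖ : Fˣ} (hϖ : IsUniformizer ϖ) (C : SphereCase F)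
    (m : ℕ) : orbitK hF ϖ C m = {s : Sphere C | IsLevel ϖ m s} :=
  Set.ext fun s => mem_orbitK_iff hF hϖ m s

theorem level_inter_quadric {ϖ : Fˣ} {C : SphereCase F} (m : ℕ) :
    {s : Sphere C | IsLevel ϖ m s} ∩
      (fun s => redVec ((ϖ : F) ^ m • s.1)) ⁻¹' quadric (levelLength ϖ C m) =
      {s : Sphere C | IsLevel ϖ m s} :=
  Set.inter_eq_left.2 fun _ hs => ⟨hs.2, Q_redVec_level hs⟩

theorem measurableSet_orbitK (hF : ringChar 𝓀[F] ≠ 2) {ϖ : Fˣ} (hϖ : IsUniformizer ϖ)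
    (C : SphereCase F) (m : ℕ) : MeasurableSet (orbitK hF ϖ C m) := by
  rw [orbitK_eq hF hϖ, ← level_inter_quadric]
  exact measurableSet_inter_preimage
    (fun x => (isOpen_level_inter_fibre ϖ C m x).measurableSet) (Set.toFinite _)

theorem levelLength_succ {ϖ : Fˣ} (hϖ : IsUniformizer ϖ) (C : SphereCase F) (m : ℕ) :
    levelLength ϖ C (m + 1) = 0 := by
  have hp := hϖ.mem
  rw [levelLength, red_mul (pow_mem (pow_mem hp _) 2) C.radius_mem,
    red_pow (pow_mem hp _), red_pow hp, hϖ.red]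
  simp

theorem levelLength_zero (ϖ : Fˣ) (C : SphereCase F) : levelLength ϖ C 0 = red C.radius := by
  simp [levelLength]

theorem openCell_subset_quadric {k : Type*} [Field k] (c : k) : openCell c ⊆ quadric c :=
  fun _ hx => ⟨fun h => hx.2 (congrFun h 4), hx.1⟩

theorem sum_ncard_eq {V ι : Type*} [Finite V] [Fintype ι] {cell : ι → Set V}
    (hd : Pairwise (Function.onFun Disjoint cell)) :
    Nat.card (⋃ j, cell j : Set V) = ∑ j, Nat.card (cell j) := by
  rw [Nat.card_congr (Set.unionEqSigmaOfDisjoint hd), Nat.card_sigma]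

/-- The volumes of the `K`-orbits. -/
theorem exists_volumes (hF : ringChar 𝓀[F] ≠ 2) {ϖ : Fˣ} (hϖ : IsUniformizer ϖ)
    {C : SphereCase F} (ds : Measure (Sphere C)) [SMulInvariantMeasure (SO32 F) (Sphere C) ds]
    (hds : ds (orbitK hF ϖ C 0) = 1) {q : ℂ} (hq : q = (residueCard F : ℂ)) :
    (∀ m, ds (orbitK hF ϖ C m) ≠ ⊤) ∧ ∃ u : ℕ → ℂ, (q ^ 4 + C.sign * q ^ 2) * u 0 = 1 ∧
      (∀ m, u (m + 1) = q ^ 3 * u m) ∧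
      ∀ m, (ds.real (orbitK hF ϖ C (m + 1)) : ℂ) = (q ^ 4 - 1) * u (m + 1) := by
  -- `u m` is the common mass of the fibres over single reduced vectors at level `m`.
  choose u hu using fun m => exists_measure_level hF ϖ ds m (levelLength ϖ C m)
  have hvol : ∀ m, ds (orbitK hF ϖ C m) = Nat.card (quadric (levelLength ϖ C m)) * u m := by
    intro m
    rw [← hu m _ subset_rfl, level_inter_quadric, orbitK_eq hF hϖ]
  -- The open cell has `q³` times as many vectors as the closed one, so this equality of masses will
  -- give `u (m + 1) = q³ u m`.
  have hstep : ∀ m, (Nat.card (openCell (levelLength ϖ C m)) : ENNReal) * u m =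
      Nat.card (closedCell 𝓀[F]) * u (m + 1) := by
    intro m
    have hsub : closedCell 𝓀[F] ⊆ quadric (levelLength ϖ C (m + 1)) := by
      rw [levelLength_succ hϖ]
      exact coneCell_subset 3
    rw [← hu m _ (openCell_subset_quadric _), ← hu (m + 1) _ hsub,
      measure_up_eq_measure_down hF hϖ]
  have hclosed : (Nat.card (closedCell 𝓀[F]) : ENNReal) ≠ 0 := by
    have h := card_closedCell 𝓀[F]
    have h1 := one_lt_residueCard F
    change 1 < Nat.card 𝓀[F] at h1
    rw [h]
    exact_mod_cast (by omega : Nat.card 𝓀[F] - 1 ≠ 0)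
  have hfin : ∀ m, u m ≠ ⊤ := by
    intro m
    induction m with
    | zero =>
      intro h
      have h0 := hvol 0
      rw [hds, h] at h0
      -- An infinite `u 0` contradicts the volume one of the zeroth orbit; the count zero is treated
      -- apart because `0 * ⊤ = 0`.
      rcases eq_or_ne (Nat.card (quadric (levelLength ϖ C 0)) : ENNReal) 0 with h1 | h1
      · rw [h1, zero_mul] at h0
        exact one_ne_zero h0
      · rw [ENNReal.mul_top h1] at h0
        exact ENNReal.one_ne_top h0
    | succ m ih =>
      intro h
      have h0 := hstep m
      rw [h, ENNReal.mul_top hclosed] at h0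
      exact ENNReal.mul_ne_top (ENNReal.natCast_ne_top _) ih h0
  refine ⟨fun m => ?_, fun m => ((u m).toReal : ℂ), ?_, fun m => ?_, fun m => ?_⟩
  · rw [hvol]
    exact ENNReal.mul_ne_top (ENNReal.natCast_ne_top _) (hfin m)
  · have h0 := congrArg (fun x => ((x.toReal : ℝ) : ℂ)) (hvol 0)
    simp only [hds, ENNReal.toReal_mul, ENNReal.toReal_natCast, ENNReal.toReal_one,
      Complex.ofReal_one, Complex.ofReal_mul, Complex.ofReal_natCast] at h0
    rw [levelLength_zero, ← iUnion_sphereCell (red_radius_ne_zero hF C),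
      sum_ncard_eq (pairwise_disjoint_sphereCell _), Fin.sum_univ_two, Nat.cast_add] at h0
    change 1 = ((Nat.card (openCell (red C.radius)) : ℂ) + (Nat.card (hyperCell (red C.radius)) : ℂ))
      * _ at h0
    rw [card_openCell_complex hF, card_hyperCell_complex hF, ← hq] at h0
    linear_combination -h0
  · have h0 := congrArg (fun x => ((x.toReal : ℝ) : ℂ)) (hstep m)
    simp only [ENNReal.toReal_mul, ENNReal.toReal_natCast,
      Complex.ofReal_mul, Complex.ofReal_natCast] at h0
    have h1 := card_coneCell_complex (F := F) hF 3
    change (Nat.card (closedCell 𝓀[F]) : ℂ) = (_ - 1) * _ ^ 0 at h1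
    rw [card_openCell_complex hF, h1, ← hq] at h0
    have hne : q - 1 ≠ 0 := hq ▸ residueCard_sub_one_ne_zero
    refine mul_left_cancel₀ hne ?_
    linear_combination -h0
  · have h0 := congrArg (fun x => ((x.toReal : ℝ) : ℂ)) (hvol (m + 1))
    simp only [ENNReal.toReal_mul, ENNReal.toReal_natCast,
      Complex.ofReal_mul, Complex.ofReal_natCast] at h0
    rw [levelLength_succ hϖ, ← iUnion_coneCell, sum_ncard_eq pairwise_disjoint_coneCell,
      Nat.cast_sum, sum_card_coneCell hF, ← hq] at h0
    exact h0

end Volumes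

end SplitSO5

end

noncomputable section

namespace SplitSO5

/-! ### Solution of the recurrences and the final summation. -/

theorem powQuotient_zero (X : ℂ) : powQuotient X 0 = 0 := by
  simp [powQuotient]

theorem powQuotient_one (X : ℂ) : powQuotient X 1 = 1 := by
  unfold powQuotient
  split_ifs with h
  · simp
  · simp [div_self (sub_ne_zero.mpr h)]

/-- This is the recurrence of the Chebyshev polynomials of the second kind in `X + X⁻¹`. At `X =
X⁻¹` it is an identity between the limit values `n X ^ (n - 1)`, by `X² = 1`. -/
theorem powQuotient_add_two {X : ℂ} (hX : X ≠ 0) (n : ℕ) :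
    powQuotient X (n + 2) = (X + X⁻¹) * powQuotient X (n + 1) - powQuotient X n := by
  unfold powQuotient
  split_ifs with h
  · have e : (X ^ 2 : ℂ) = 1 := by
      rw [pow_two]
      nth_rewrite 2 [h]
      exact mul_inv_cancel₀ hX
    rw [← h]
    have e1 : X ^ (((n + 2 : ℕ) : ℤ) - 1) = X ^ ((n : ℤ) - 1) := by
      rw [show (((n + 2 : ℕ) : ℤ) - 1) = ((n : ℤ) - 1) + ((2 : ℕ) : ℤ) by push_cast; ring,
        zpow_add₀ hX, zpow_natCast, e, mul_one]
    have e2 : X ^ (((n + 1 : ℕ) : ℤ) - 1) = X * X ^ ((n : ℤ) - 1) := by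
      rw [show (((n + 1 : ℕ) : ℤ) - 1) = 1 + ((n : ℤ) - 1) by push_cast; ring,
        zpow_add₀ hX, zpow_one]
    rw [e1, e2]
    push_cast
    linear_combination (-2 * ((n : ℂ) + 1) * X ^ ((n : ℤ) - 1)) * e
  · have h' := sub_ne_zero.mpr h
    rw [mul_div_assoc', div_sub_div_same]
    congr 1
    simp only [zpow_neg, zpow_natCast]
    field_simp
    ring

/-- The defect of the partial sums from the recurrence `S (r + 2) = y S (r + 1) - q³ S r` does not
change with `r`, by `h3`, and vanishes at `r = 0`, by `h0`, `h1` and `h2`. The constant `q³ - ε q`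
in `h2`, in place of `q³`, reflects that the volume of the zeroth orbit does not follow the pattern
of the others. -/
theorem sum_eq_of_recurrence {q ε y : ℂ} {w : ℕ → ℂ} (h0 : w 0 = 1) (h1 : w 1 = y - 1 - ε * q)
    (h2 : w 2 + (q ^ 3 - ε * q) = y * w 1) (h3 : ∀ m, w (m + 3) + q ^ 3 * w (m + 1) = y * w (m + 2))
    {S : ℕ → ℂ} (hS0 : S 0 = 1) (hS1 : S 1 = y - ε * q)
    (hS : ∀ r, S (r + 2) = y * S (r + 1) - q ^ 3 * S r) (r : ℕ) :
    ∑ i ∈ Finset.range (r + 1), w i = S r := by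
  have key : ∀ r, ∑ i ∈ Finset.range (r + 3), w i =
      y * ∑ i ∈ Finset.range (r + 2), w i - q ^ 3 * ∑ i ∈ Finset.range (r + 1), w i := by
    intro r
    induction r with
    | zero =>
      simp only [Finset.sum_range_succ, Finset.sum_range_zero, h0, h1] at h2 ⊢
      linear_combination h2
    | succ r ih =>
      have e3 := Finset.sum_range_succ w (r + 3)
      have e2 := Finset.sum_range_succ w (r + 2)
      have e1 := Finset.sum_range_succ w (r + 1)
      simp only [add_assoc, Nat.reduceAdd] at *
      linear_combination ih + h3 r + e3 - y * e2 + q ^ 3 * e1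
  have main : ∀ r, ∑ i ∈ Finset.range (r + 1), w i = S r ∧
      ∑ i ∈ Finset.range (r + 2), w i = S (r + 1) := by
    intro r
    induction r with
    | zero =>
      simp only [Finset.sum_range_succ, Finset.sum_range_zero, h0, h1, hS0, hS1]
      constructor <;> ring
    | succ r ih => exact ⟨ih.2, by rw [key, ih.1, ih.2, hS]⟩
  exact (main r).1

theorem SphereCase.sign_sq {F : Type*} [Field F] [ValuativeRel F] (C : SphereCase F) :
    C.sign ^ 2 = 1 := by
  cases C <;> simp [SphereCase.sign]

section

variable {F : Type*} [Field F] [ValuativeRel F] [TopologicalSpace F]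
  [IsNonarchimedeanLocalField F]

theorem sum_volume_mul_eq {hF : ringChar 𝓀[F] ≠ 2} {ϖ : Fˣ}
    (hϖ : IsUniformizer ϖ) {C : SphereCase F} {dg : Measure (SO32 F)} [dg.IsHaarMeasure]
    (hdg : dg (maxCompact F : Set (SO32 F)) = 1)
    (ds : Measure (Sphere C)) [SMulInvariantMeasure (SO32 F) (Sphere C) ds]
    (hds : ds (orbitK hF ϖ C 0) = 1) {ζ : ℂ}
    {T : Sphere C → ℂ} (hT : IsSphericalEigenfunction hF C dg ζ T)
    {q Y X : ℂ} (hq : q = (residueCard F : ℂ)) (hY : Y = q ^ (1 / 2 : ℂ)) (hX : X = q ^ ζ)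
    (r : ℕ) :
    ∑ i ∈ Finset.range (r + 1),
        (ds.real (orbitK hF ϖ C i) : ℂ) * T (torusElt (ϖ ^ i) • basePoint hF C) =
      Y ^ (3 * r) * (powQuotient X (r + 1) - C.sign * (Y⁻¹ * powQuotient X r)) := by
  obtain ⟨-, u, hu0, hu, hv⟩ := exists_volumes hF hϖ ds hds hq
  have hq0 : q ≠ 0 := hq ▸ residueCard_cast_ne_zero F
  have hq1 : q - 1 ≠ 0 := hq ▸ residueCard_sub_one_ne_zero
  have hX0 : X ≠ 0 := by rw [hX]; simp [Complex.cpow_eq_zero_iff, hq0]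
  have hY0 : Y ≠ 0 := by rw [hY]; simp [Complex.cpow_eq_zero_iff, hq0]
  have hYq : Y ^ 2 = q := by
    rw [hY, ← Complex.cpow_nat_mul]
    norm_num
  have hε := C.sign_sq
  have r0 := hT.recurrence_zero hϖ hdg hq hY hX
  have r1 := hT.recurrence_succ hϖ hdg hq hY hX
  have ht0 : T (torusElt (ϖ ^ 0) • basePoint hF C) = 1 := by
    rw [pow_zero, torusElt_one, one_smul, hT.normalized]
  generalize C.sign = ε at *
  -- As `ε² = 1`, `(q² + ε)(q² - ε) = q⁴ - 1`; the normalization of the zeroth orbit thus fixes the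
  -- scale of all the other volumes.
  have hv0 : (q ^ 4 - 1) * (q ^ 2 * u 0) = q ^ 2 - ε := by
    linear_combination (q ^ 2 - ε) * hu0 + u 0 * q ^ 2 * hε
  have hv1 : (q ^ 4 - 1) * u 1 = q ^ 3 - ε * q := by
    rw [hu]
    linear_combination q * hv0
  refine sum_eq_of_recurrence (q := q) (ε := ε) (y := Y ^ 3 * (X + X⁻¹))
    (S := fun r => Y ^ (3 * r) * (powQuotient X (r + 1) - ε * (Y⁻¹ * powQuotient X r)))
    ?_ ?_ ?_ ?_ ?_ ?_ ?_ r
  · rw [ht0, Measure.real, hds]; simp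
  · refine mul_left_cancel₀ hq1 ?_
    rw [hv, hu]
    linear_combination (-u 0) * r0 + (q - 1) * (Y ^ 3 * (X + X⁻¹) + q + q ^ 2) * hu0 -
      (q + ε) * hv0 + hε
  · rw [hv, hv, hu 1]
    linear_combination (-((q ^ 4 - 1) * u 1)) * r1 0 - (q ^ 4 - 1) * u 1 * ht0 - hv1
  · intro m
    rw [hv, hv, hv, hu (m + 2), hu (m + 1)]
    linear_combination (-((q ^ 4 - 1) * (q ^ 3 * u (m + 1)))) * r1 (m + 1)
  · simp [powQuotient_zero, powQuotient_one]
  · simp only [powQuotient_add_two hX0 0, powQuotient_zero, powQuotient_one, zero_add]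
    rw [← hYq]
    field_simp
    ring
  · intro r
    simp only [powQuotient_add_two hX0]
    rw [← hYq]
    ring

end

theorem bigPhi_mul_eq {F : Type*} [Field F] [ValuativeRel F] [TopologicalSpace F]
    [IsNonarchimedeanLocalField F] {hF : ringChar 𝓀[F] ≠ 2} {ϖ : Fˣ}
    (hϖ : IsUniformizer ϖ) {C : SphereCase F} {dg : Measure (SO32 F)} [dg.IsHaarMeasure]
    {ζ : ℂ} {T : Sphere C → ℂ} (hT : IsSphericalEigenfunction hF C dg ζ T) (r : ℕ) (s : Sphere C) :
    bigPhi hF ϖ C r s * T s = ∑ i ∈ Finset.range (r + 1),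
      (orbitK hF ϖ C i).indicator (fun _ => T (torusElt (ϖ ^ i) • basePoint hF C)) s := by
  rw [bigPhi, Finset.sum_mul]
  refine Finset.sum_congr rfl fun i _ => ?_
  by_cases hs : s ∈ orbitK hF ϖ C i
  · rw [Set.indicator_of_mem hs, Set.indicator_of_mem hs, one_mul,
      hT.eq_of_isLevel hϖ ((mem_orbitK_iff hF hϖ i s).mp hs)]
  · rw [Set.indicator_of_notMem hs, Set.indicator_of_notMem hs, zero_mul]

theorem cpow_half_nat {q : ℂ} (r : ℕ) : q ^ ((r : ℂ) / 2) = (q ^ (1 / 2 : ℂ)) ^ r := by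
  rw [← Complex.cpow_nat_mul]
  congr 1
  ring

theorem cpow_half_nat_sub_one {q : ℂ} (hq : q ≠ 0) (r : ℕ) :
    q ^ (((r : ℂ) - 1) / 2) = (q ^ (1 / 2 : ℂ)) ^ r * (q ^ (1 / 2 : ℂ))⁻¹ := by
  rw [sub_div, Complex.cpow_sub _ _ hq, cpow_half_nat, div_eq_mul_inv]

end SplitSO5

end

theorem proposition2p3 {F : Type*} [Field F] [ValuativeRel F] [TopologicalSpace F]
    [IsNonarchimedeanLocalField F] (hF : ringChar 𝓀[F] ≠ 2)
    (ϖ : Fˣ) (hϖ : IsUniformizer ϖ) (C : SphereCase F)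
    (dg : Measure (SO32 F)) [dg.IsHaarMeasure] (hdg : dg (maxCompact F : Set (SO32 F)) = 1)
    (ds : Measure (Sphere C)) [SMulInvariantMeasure (SO32 F) (Sphere C) ds]
    (hds : ds (orbitK hF ϖ C 0) = 1)
    (ζ : ℂ) (T : Sphere C → ℂ) (hT : IsSphericalEigenfunction hF C dg ζ T)
    (r : ℕ) (q X : ℂ) (hq : q = (residueCard F : ℂ)) (hX : X = q ^ ζ) :
    Integrable (fun s => bigPhi hF ϖ C r s * T s) ds ∧
      ∫ s, bigPhi hF ϖ C r s * T s ∂ds =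
        q ^ r * (q ^ ((r : ℂ) / 2) * powQuotient X (r + 1)
          - C.sign * (q ^ (((r : ℂ) - 1) / 2) * powQuotient X r)) := by
  have hq0 : q ≠ 0 := hq ▸ residueCard_cast_ne_zero F
  have hfin := (exists_volumes hF hϖ ds hds hq).1
  -- On each orbit `T` is constant, so the integrand is a finite combination of indicators of sets
  -- of finite measure.
  have hint : ∀ i ∈ Finset.range (r + 1), Integrable ((orbitK hF ϖ C i).indicator
      (fun _ => T (torusElt (ϖ ^ i) • basePoint hF C))) ds := fun i _ =>
    (integrable_indicator_iff (measurableSet_orbitK hF hϖ C i)).mpr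
      (integrableOn_const (hfin i))
  have heq := funext (bigPhi_mul_eq hϖ hT r)
  rw [heq]
  refine ⟨integrable_finsetSum _ hint, ?_⟩
  rw [integral_finsetSum _ hint]
  simp only [integral_indicator_const _ (measurableSet_orbitK hF hϖ C _), Complex.real_smul]
  rw [sum_volume_mul_eq hϖ hdg ds hds hT hq rfl hX, cpow_half_nat, cpow_half_nat_sub_one hq0]
  have hYq : (q ^ (1 / 2 : ℂ)) ^ 2 = q := by
    rw [← Complex.cpow_nat_mul]
    norm_num
  -- With `Y² = q` the prefactor `q ^ r * q ^ (r / 2)` is `Y ^ (3 * r)`, and what is left is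
  -- polynomial algebra.
  generalize q ^ (1 / 2 : ℂ) = Y at *
  rw [← hYq]
  ring
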